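/- All gradings are by $RO(\mathbb{Z}/2)=\mathbb{Z}\oplus\mathbb{Z}\alpha$, where $\alpha$ is the sign representation, and all rings are commutative of characteristic $2$. **The coefficient ring.** Let $H=H\underline{\mathbb{F}}_\star$ be the graded ring $\mathbb{F}_2[a,u]\oplus \mathbb{F}_2\{\theta/(a^iu^j) : i,j\ge 0\}$, where $u=\sigma^{-1}$, $|a|=-\alpha$, $|u|=1-\alpha$, $|\theta|=2\alpha-2$ and $|\theta/(a^iu^j)|=|\theta|-i|a|-j|u|$. Here $a\cdot\theta/(a^{i+1}u^j)=\theta/(a^iu^j)$, $u\cdot\theta/(a^iu^{j+1})=\theta/(a^iu^j)$, $a\cdot\theta/u^j=0$, $u\cdot\theta/a^i=0$, and the product of any two elements $\theta/(a^iu^j)$ is zero. **The dual Steenrod algebra.** Let $$\mathcal{A}_\star=H[\tau_i,\xi_{i+1} : i\ge 0]\big/\big(\tau_i^2=a\tau_{i+1}+(u+a\tau_0)\xi_{i+1} : i\ge 0\big),$$ with $|\tau_i|=2^i(1+\alpha)-\alpha$, $|\xi_i|=(2^i-1)(1+\alpha)$, and put $\xi_0=1$. It is the $\mathbb{Z}/2$-equivariant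 dual Steenrod algebra, a graded Hopf algebroid over $H$. Its left unit is the inclusion of $H$. Its right unit is given by $\eta_R(a)=a$, $\eta_R(u)=u+a\tau_0$ and $$\eta_R\Big(\frac{\theta}{a^iu^j}\Big)=\sum_{k=0}^{i}\binom{j+k}{k}\frac{\theta}{a^{i-k}u^{j+k}}\,\tau_0^k .$$ The counit is the map of $H$-algebras with $\varepsilon(\tau_i)=0$ and $\varepsilon(\xi_{i+1})=0$ for $i\ge0$. The coproduct is the ring map $\Delta:\mathcal{A}_\star\to\mathcal{A}_\star\otimes_H\mathcal{A}_\star$ (the left factor being an $H$-module through $\eta_R$, the right factor through the left unit) with $\Delta(h)=h\otimes 1$ for $h\in H$ and $$\Delta(\xi_n)=\sum_{i=0}^n\xi_{n-i}^{2^i}\otimes\xi_i,\qquad \Delta(\tau_n)=\sum_{i=0}^n\xi_{n-i}^{2^i}\otimes\tau_i+\tau_n\otimes 1 .$$ The antipode is the one determined by these data. **The quotients.** A profile function is a pair $(h,k)$ of maps $h:\{1,2,\dots\}\to\mathbb{N}\cup\{\infty\}$ and $k:\{0,1,2,\dots\}\to\mathbb{N}\cup\{\infty\}$; profile functions are ordered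 pointwise. Let $I(h,k)\subseteq\mathcal{A}_\star$ be the ideal generated by all $\xi_i^{2^{h(i)}}$ and $\tau_i^{2^{k(i)}}$ (with $x^{2^\infty}=0$). For $n\ge 0$ put $h_n(i)=\max(n-i,0)$ for $i\ge1$ and $k_n(i)=\max(n-i,0)$ for $i\ge0$, and let $$\mathcal{E}(n)_\star=\mathcal{A}_\star/I(0,k_n),\qquad \mathcal{A}(n)_\star=\mathcal{A}_\star/I(h_n,k_n).$$ **Cofreeness.** Let $f:B\to C$ be a map of graded Hopf algebroids over $H$ that is the identity on $H$. Then $B$ is a graded left $C$-comodule with coaction $(f\otimes\mathrm{id})\Delta:B\to C\otimes_H B$. We call $B$ cofree over $C$ if, as a graded left $C$-comodule, it is isomorphic to $C\otimes_H F$ with coaction $\Delta\otimes\mathrm{id}$ for some free graded $H$-module $F$. **Statement.** For every $n\ge 0$ the ideals $I(0,k_n)$ and $I(h_n,k_n)$ are graded Hopf algebroid ideals of $\mathcal{A}_\star$, so that $\mathcal{E}(n)_\star$ and $\mathcal{A}(n)_\star$ are quotient Hopf algebroids of $(H,\mathcal{A}_\star)$, and $\mathcal{A}_\star$ is cofree over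 $\mathcal{E}(n)_\star$ and over $\mathcal{A}(n)_\star$. Moreover these quotients are cofree over each other: if $B$ and $C$ are any two of the Hopf algebroids $\mathcal{E}(m)_\star,\mathcal{A}(m)_\star$ ($m\ge0$) and their profile functions satisfy $(h_B,k_B)\ge(h_C,k_C)$, then the ideal that defines $B$ is contained in the one that defines $C$, and $B$ is cofree over $C$ along the projection $B\to C$. -/

import Mathlib

open scoped TensorProduct
set_option linter.unusedSectionVars false
set_option linter.unnecessarySeqFocus false

noncomputable section
namespace EquivSteenrod

section Tensor

/-- The ring `A`, regarded as an `H`-module through a ring map `ηR : H → A`. -/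
def RightMod {H A : Type*} [CommRing H] [CommRing A] (_ηR : H →+* A) : Type _ := A

variable {H A : Type*} [CommRing H] [CommRing A] (ηR : H →+* A)

instance : CommRing (RightMod ηR) := inferInstanceAs (CommRing A)
instance : Algebra H (RightMod ηR) := ηR.toAlgebra
instance : Algebra A (RightMod ηR) := Algebra.id A
instance : SMulCommClass H A (RightMod ηR) :=
  ⟨fun h a x => mul_left_comm (ηR h) a (show A from x)⟩
instance : SMulCommClass A H (RightMod ηR) := SMulCommClass.symm _ _ _

/-- The tensor product over `H` of `A` (a right `H`-module through `ηR`) and a left `H`-module `M`.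
It is an `A`-module through its first factor, and, when `A` also has a left unit
`algebraMap H A`, a left `H`-module through that left unit. -/
def BiTensor (M : Type*) [AddCommGroup M] [Module H M] : Type _ := RightMod ηR ⊗[H] M

namespace BiTensor

section Module
variable (M : Type*) [AddCommGroup M] [Module H M]

instance : AddCommGroup (BiTensor ηR M) := inferInstanceAs (AddCommGroup (RightMod ηR ⊗[H] M))
instance : Module A (BiTensor ηR M) := inferInstanceAs (Module A (RightMod ηR ⊗[H] M))
instance [Algebra H A] : Module H (BiTensor ηR M) := Module.compHom _ (algebraMap H A)

variable {M}

/-- The pure tensor `a ⊗ m`. -/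
def tmul (a : A) (m : M) : BiTensor ηR M := (show RightMod ηR from a) ⊗ₜ[H] m

theorem tmul_add (a : A) (m n : M) : tmul ηR a (m + n) = tmul ηR a m + tmul ηR a n :=
  TensorProduct.tmul_add _ _ _

theorem add_tmul (a b : A) (m : M) : tmul ηR (a + b) m = tmul ηR a m + tmul ηR b m :=
  TensorProduct.add_tmul (R := H) (show RightMod ηR from a) (show RightMod ηR from b) m

theorem balanced (a : A) (h : H) (m : M) : tmul ηR (a * ηR h) m = tmul ηR a (h • m) := by
  have := TensorProduct.smul_tmul (R := H) h (show RightMod ηR from a) m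
  rw [mul_comm]
  exact this

theorem smul_tmul (a b : A) (m : M) : a • tmul ηR b m = tmul ηR (a * b) m := rfl

theorem hsmul_def [Algebra H A] (h : H) (x : BiTensor ηR M) : h • x = algebraMap H A h • x := rfl

variable {ηR} in
@[elab_as_elim]
theorem induction {P : BiTensor ηR M → Prop} (x : BiTensor ηR M) (zero : P 0)
    (pure : ∀ a m, P (tmul ηR a m)) (add : ∀ x y, P x → P y → P (x + y)) : P x :=
  TensorProduct.induction_on (R := H) (M := RightMod ηR) (N := M) x zero pure add

/-- The additive map out of the tensor product induced by a balanced biadditive map. -/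
def lift {N : Type*} [AddCommGroup N] (f : A →+ M →+ N)
    (hf : ∀ a h m, f (a * ηR h) m = f a (h • m)) : BiTensor ηR M →+ N :=
  TensorProduct.liftAddHom (R := H) (M := RightMod ηR) (N := M) f (fun h a m => by
    have key := hf (show A from a) h m
    rw [mul_comm (show A from a) (ηR h)] at key
    exact key)

@[simp] theorem lift_tmul {N : Type*} [AddCommGroup N] (f : A →+ M →+ N)
    (hf : ∀ a h m, f (a * ηR h) m = f a (h • m)) (a : A) (m : M) :
    lift ηR f hf (tmul ηR a m) = f a m := rfl

variable {ηR} in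
theorem addHom_ext {N : Type*} [AddCommGroup N] {f g : BiTensor ηR M →+ N}
    (h : ∀ a m, f (tmul ηR a m) = g (tmul ηR a m)) : f = g := by
  ext x
  induction x using induction with
  | zero => simp
  | pure a m => exact h a m
  | add x y hx hy => simp [hx, hy]

/-- `b ↦ b ⊗ m`, as a map of left `H`-modules. -/
def mkLeft [Algebra H A] (m : M) : A →ₗ[H] BiTensor ηR M where
  toFun b := tmul ηR b m
  map_add' a b := add_tmul ηR a b m
  map_smul' h b := by
    rw [Algebra.smul_def, RingHom.id_apply, hsmul_def, smul_tmul]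

@[simp] theorem mkLeft_apply [Algebra H A] (m : M) (b : A) : mkLeft ηR m b = tmul ηR b m := rfl

/-- `a ↦ (m ↦ a ⊗ m)` as a biadditive map. -/
def tmulHom : A →+ M →+ BiTensor ηR M where
  toFun a :=
    { toFun := fun m => tmul ηR a m
      map_zero' := TensorProduct.tmul_zero _ _
      map_add' := tmul_add ηR a }
  map_zero' := by
    ext m
    exact TensorProduct.zero_tmul (R := H) (RightMod ηR) m
  map_add' a b := by
    ext m
    exact add_tmul ηR a b m

@[simp] theorem tmulHom_apply (a : A) (m : M) : tmulHom ηR a m = tmul ηR a m := rfl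

/-- `id ⊗ f`. -/
def mapRight [Algebra H A] {N : Type*} [AddCommGroup N] [Module H N] (f : M →ₗ[H] N) :
    BiTensor ηR M →ₗ[H] BiTensor ηR N :=
  let L : BiTensor ηR M →+ BiTensor ηR N :=
    lift ηR ((AddMonoidHom.compHom.flip f.toAddMonoidHom).comp (tmulHom ηR)) (fun a h m => by
      simpa using balanced ηR a h (f m))
  { L with
    map_smul' := fun h x => by
      change L (h • x) = h • L x
      induction x using induction with
      | zero => simp
      | pure a m => rfl
      | add x y hx hy => rw [smul_add, map_add, hx, hy, map_add, smul_add] }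

@[simp] theorem mapRight_tmul [Algebra H A] {N : Type*} [AddCommGroup N] [Module H N]
    (f : M →ₗ[H] N) (a : A) (m : M) :
    mapRight ηR f (tmul ηR a m) = tmul ηR a (f m) := rfl

/-- The piece of degree `V` of a tensor product: it is generated by the `a ⊗ m` with
`a` and `m` homogeneous and `|a| + |m| = V`. -/
def deg {G : Type*} [AddCommGroup G] (𝒶 : G → AddSubgroup A) (ℳ : G → AddSubgroup M) (V : G) :
    AddSubgroup (BiTensor ηR M) :=
  AddSubgroup.closure {x | ∃ i j a m, a ∈ 𝒶 i ∧ m ∈ ℳ j ∧ i + j = V ∧ x = tmul ηR a m}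

end Module

section Ring
variable (B : Type*) [CommRing B] [Algebra H B]

instance : CommRing (BiTensor ηR B) := inferInstanceAs (CommRing (RightMod ηR ⊗[H] B))
instance : Algebra A (BiTensor ηR B) := inferInstanceAs (Algebra A (RightMod ηR ⊗[H] B))
instance [Algebra H A] : Algebra H (BiTensor ηR B) := Algebra.compHom _ (algebraMap H A)

variable {B}

theorem tmul_mul_tmul (a a' : A) (b b' : B) :
    tmul ηR a b * tmul ηR a' b' = tmul ηR (a * a') (b * b') :=
  Algebra.TensorProduct.tmul_mul_tmul (R := H) (A := RightMod ηR) (B := B) a a' b b'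

theorem one_def : (1 : BiTensor ηR B) = tmul ηR 1 1 := rfl

variable (B) in
/-- `a ↦ a ⊗ 1`. -/
def inl : A →+* BiTensor ηR B := algebraMap A _

/-- `b ↦ 1 ⊗ b`. -/
def inr : B →+* BiTensor ηR B where
  toFun b := tmul ηR 1 b
  map_one' := rfl
  map_mul' b b' := by rw [tmul_mul_tmul, one_mul]
  map_zero' := TensorProduct.tmul_zero _ _
  map_add' b b' := tmul_add ηR 1 b b'

theorem inl_apply (a : A) : inl ηR B a = tmul ηR a 1 := rfl
theorem inr_apply (b : B) : inr ηR b = tmul ηR 1 b := rfl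

theorem tmul_eq (a : A) (b : B) : tmul ηR a b = inl ηR B a * inr ηR b := by
  rw [inl_apply, inr_apply, tmul_mul_tmul, mul_one, one_mul]

theorem inl_ηR (h : H) : inl ηR B (ηR h) = inr ηR (algebraMap H B h) := by
  have := balanced ηR (1 : A) h (1 : B)
  rw [one_mul, Algebra.smul_def, mul_one] at this
  exact this

theorem algebraMap_eq [Algebra H A] (h : H) :
    algebraMap H (BiTensor ηR B) h = inl ηR B (algebraMap H A h) := rfl

/-- The ring map `a ⊗ b ↦ f a * g b`. -/
def ringLift {T : Type*} [CommRing T] (f : A →+* T) (g : B →+* T)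
    (hfg : ∀ h, f (ηR h) = g (algebraMap H B h)) : BiTensor ηR B →+* T :=
  let L : BiTensor ηR B →+ T := lift ηR
    { toFun := fun a => (AddMonoidHom.mulLeft (f a)).comp g.toAddMonoidHom
      map_zero' := by ext; simp
      map_add' := fun a b => by ext; simp [add_mul] }
    (fun a h m => by
      simp [hfg, Algebra.smul_def, mul_assoc])
  have hL : ∀ a b, L (tmul ηR a b) = f a * g b := fun a b => rfl
  { L with
    map_one' := by
      change L (tmul ηR 1 1) = 1
      rw [hL]; simp
    map_mul' := fun x y => by
      change L (x * y) = L x * L y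
      induction x using induction with
      | zero => simp
      | add x x' hx hx' => rw [add_mul, map_add, map_add, hx, hx', add_mul]
      | pure a b =>
        induction y using induction with
        | zero => simp
        | add y y' hy hy' => rw [mul_add, map_add, map_add, hy, hy', mul_add]
        | pure a' b' =>
          rw [tmul_mul_tmul, hL, hL, hL, map_mul, map_mul]
          ring }

@[simp] theorem ringLift_tmul {T : Type*} [CommRing T] (f : A →+* T) (g : B →+* T)
    (hfg : ∀ h, f (ηR h) = g (algebraMap H B h)) (a : A) (b : B) :
    ringLift ηR f g hfg (tmul ηR a b) = f a * g b := rfl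

@[simp] theorem ringLift_inl {T : Type*} [CommRing T] (f : A →+* T) (g : B →+* T)
    (hfg : ∀ h, f (ηR h) = g (algebraMap H B h)) (a : A) :
    ringLift ηR f g hfg (inl ηR B a) = f a := by
  rw [inl_apply, ringLift_tmul, map_one, mul_one]

@[simp] theorem ringLift_inr {T : Type*} [CommRing T] (f : A →+* T) (g : B →+* T)
    (hfg : ∀ h, f (ηR h) = g (algebraMap H B h)) (b : B) :
    ringLift ηR f g hfg (inr ηR b) = g b := by
  rw [inr_apply, ringLift_tmul, map_one, one_mul]

variable {ηR} in
theorem ringHom_ext {T : Type*} [CommRing T] {f g : BiTensor ηR B →+* T}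
    (hl : ∀ a, f (inl ηR B a) = g (inl ηR B a)) (hr : ∀ b, f (inr ηR b) = g (inr ηR b)) :
    f = g := by
  ext x
  induction x using induction with
  | zero => simp
  | pure a m => rw [tmul_eq, map_mul, map_mul, hl, hr]
  | add x y hx hy => simp [hx, hy]

end Ring
end BiTensor
end Tensor

section Grading
variable {G : Type*} [AddCommGroup G] [DecidableEq G]

/-- `𝒶` is a grading of the ring `A` by the group `G`. -/
structure IsGrading {A : Type*} [CommRing A] (𝒶 : G → AddSubgroup A) : Prop where
  gradedMonoid : SetLike.GradedMonoid 𝒶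
  isInternal : DirectSum.IsInternal 𝒶

/-- The grading induced on the quotient by an ideal. -/
def quotDeg {A : Type*} [CommRing A] (𝒶 : G → AddSubgroup A) (I : Ideal A) (V : G) :
    AddSubgroup (A ⧸ I) :=
  (𝒶 V).map (Ideal.Quotient.mk I).toAddMonoidHom

/-- The ideal `I` is generated by homogeneous elements. -/
def IsHomogeneousIdeal {A : Type*} [CommRing A] (𝒶 : G → AddSubgroup A) (I : Ideal A) : Prop :=
  ∃ S : Set A, (∀ x ∈ S, ∃ V, x ∈ 𝒶 V) ∧ I = Ideal.span S

/-- The grading of a polynomial ring over a graded ring in which the variable `s` has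
degree `w s`. -/
def polyDeg {R σ : Type*} [CommRing R] (𝓇 : G → AddSubgroup R) (w : σ → G) (V : G) :
    AddSubgroup (MvPolynomial σ R) where
  carrier := {p | ∀ m, p.coeff m ∈ 𝓇 (V - Finsupp.weight w m)}
  zero_mem' m := by simp
  add_mem' hp hq m := by
    rw [MvPolynomial.coeff_add]
    exact add_mem (hp m) (hq m)
  neg_mem' hp m := by
    rw [MvPolynomial.coeff_neg]
    exact neg_mem (hp m)

/-- The grading of a ring that is concentrated in degree zero. -/
def trivialDeg (R : Type*) [CommRing R] (V : G) : AddSubgroup R := if V = 0 then ⊤ else ⊥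

theorem isInternal_iff {A : Type*} [AddCommGroup A] (𝒶 : G → AddSubgroup A) :
    DirectSum.IsInternal 𝒶 ↔
      (∀ (s : Finset G) (x : G → A), (∀ V, x V ∈ 𝒶 V) → ∑ V ∈ s, x V = 0 → ∀ V ∈ s, x V = 0) ∧
      ∀ a : A, a ∈ ⨆ V, 𝒶 V := by
  constructor
  · intro h
    constructor
    · intro s x hx hs V hV
      have h0 : (∑ W ∈ s, DirectSum.of (fun W => 𝒶 W) W ⟨x W, hx W⟩) = 0 := by
        apply h.injective
        simp [hs]
      have h1 := DFunLike.congr_fun h0 V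
      rw [DFinsupp.finsetSum_apply] at h1
      rw [Finset.sum_eq_single V] at h1
      · have h2 : (DirectSum.of (fun W => 𝒶 W) V ⟨x V, hx V⟩) V = 0 := h1
        rw [DirectSum.of_eq_same] at h2
        exact congrArg Subtype.val h2
      · intro W _ hWV
        exact DirectSum.of_eq_of_ne _ _ _ hWV.symm
      · intro h; exact absurd hV h
    · intro a
      obtain ⟨y, rfl⟩ := h.surjective a
      induction y using DirectSum.induction_on with
      | zero => simp
      | of V z => simpa using AddSubgroup.mem_iSup_of_mem V z.2
      | add x y hx hy => rw [map_add]; exact add_mem hx hy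
  · rintro ⟨h1, h2⟩
    constructor
    · rw [injective_iff_map_eq_zero]
      intro y hy
      classical
      rw [DirectSum.coeAddMonoidHom_eq_dfinsuppSum] at hy
      have := h1 y.support (fun V => y V) (fun V => (y V).2) hy
      ext V
      by_cases hV : V ∈ y.support
      · exact this V hV
      · simpa using hV
    · intro a
      refine AddSubgroup.iSup_induction 𝒶
        (C := fun a => ∃ y, DirectSum.coeAddMonoidHom 𝒶 y = a) (h2 a) ?_ ?_ ?_
      · exact fun V x hx => ⟨DirectSum.of (fun W => 𝒶 W) V ⟨x, hx⟩, by simp⟩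
      · exact ⟨0, map_zero _⟩
      · rintro _ _ ⟨x, rfl⟩ ⟨y, rfl⟩
        exact ⟨x + y, map_add _ _ _⟩

theorem isGrading_trivialDeg (R : Type*) [CommRing R] :
    IsGrading (trivialDeg R : G → AddSubgroup R) := by
  refine ⟨{ one_mem := ?_, mul_mem := ?_ }, (isInternal_iff _).2 ⟨?_, ?_⟩⟩
  · simp [trivialDeg]
  · intro i j x y hx hy
    by_cases hi : i = 0 <;> by_cases hj : j = 0 <;> simp_all [trivialDeg]
  · intro s x hx hs V hV
    by_cases hV0 : V = 0
    · subst hV0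
      rwa [Finset.sum_eq_single 0] at hs
      · intro W _ hW
        simpa [trivialDeg, hW] using hx W
      · intro h; exact absurd hV h
    · simpa [trivialDeg, hV0] using hx V
  · intro a
    exact AddSubgroup.mem_iSup_of_mem 0 (by simp [trivialDeg])

theorem polyDeg_monomial {R σ : Type*} [CommRing R] {𝓇 : G → AddSubgroup R} (w : σ → G)
    {V : G} {r : R} (hr : r ∈ 𝓇 V) (m : σ →₀ ℕ) :
    MvPolynomial.monomial m r ∈ polyDeg 𝓇 w (V + Finsupp.weight w m) := by
  classical
  intro m'
  rw [MvPolynomial.coeff_monomial]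
  split_ifs with h
  · subst h; simpa using hr
  · exact zero_mem _

theorem IsGrading.polyDeg {R σ : Type*} [CommRing R] {𝓇 : G → AddSubgroup R} (h𝓇 : IsGrading 𝓇)
    (w : σ → G) : IsGrading (EquivSteenrod.polyDeg 𝓇 w) := by
  classical
  have := h𝓇.gradedMonoid
  obtain ⟨h1, h2⟩ := (isInternal_iff _).1 h𝓇.isInternal
  refine ⟨{ one_mem := ?_, mul_mem := ?_ }, (isInternal_iff _).2 ⟨?_, ?_⟩⟩
  · have := polyDeg_monomial (𝓇 := 𝓇) w (SetLike.GradedOne.one_mem) 0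
    simpa using this
  · intro i j p q hp hq m
    rw [MvPolynomial.coeff_mul]
    refine sum_mem fun x hx => ?_
    rw [Finset.HasAntidiagonal.mem_antidiagonal] at hx
    have := SetLike.GradedMul.mul_mem (hp x.1) (hq x.2)
    rwa [sub_add_sub_comm, ← map_add, hx] at this
  · intro s x hx hs V hV
    ext m
    have hm : ∑ W ∈ s, (x W).coeff m = 0 := by
      rw [← MvPolynomial.coeff_sum, hs, MvPolynomial.coeff_zero]
    have := h1 (s.image (fun W => W - Finsupp.weight w m))
      (fun W => (x (W + Finsupp.weight w m)).coeff m)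
      (fun W => by simpa using hx (W + Finsupp.weight w m) m)
      (by
        rw [Finset.sum_image (by intro a _ b _ h; simpa using h)]
        simpa using hm)
      (V - Finsupp.weight w m) (Finset.mem_image_of_mem _ hV)
    simpa using this
  · intro p
    induction p using MvPolynomial.induction_on' with
    | monomial m r =>
      refine AddSubgroup.iSup_induction 𝓇
        (C := fun r => MvPolynomial.monomial m r ∈ ⨆ V, EquivSteenrod.polyDeg 𝓇 w V)
        (h2 r) ?_ ?_ ?_
      · exact fun V r hr => AddSubgroup.mem_iSup_of_mem _ (polyDeg_monomial w hr m)
      · simp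
      · intro x y hx hy
        rw [map_add]
        exact add_mem hx hy
    | add p q hp hq => exact add_mem hp hq

theorem IsGrading.quotDeg {A : Type*} [CommRing A] {𝒶 : G → AddSubgroup A} (h𝒶 : IsGrading 𝒶)
    {I : Ideal A} (hI : IsHomogeneousIdeal 𝒶 I) : IsGrading (EquivSteenrod.quotDeg 𝒶 I) := by
  have gm := h𝒶.gradedMonoid
  obtain ⟨-, h2⟩ := (isInternal_iff _).1 h𝒶.isInternal
  refine ⟨{ one_mem := ?_, mul_mem := ?_ }, (isInternal_iff _).2 ⟨?_, ?_⟩⟩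
  · exact ⟨1, SetLike.GradedOne.one_mem, map_one (Ideal.Quotient.mk I)⟩
  · rintro i j _ _ ⟨x, hx, rfl⟩ ⟨y, hy, rfl⟩
    exact ⟨x * y, SetLike.GradedMul.mul_mem hx hy, map_mul (Ideal.Quotient.mk I) _ _⟩
  · intro s x hx hs V hV
    choose y hy hyx using hx
    let _ : DirectSum.Decomposition 𝒶 := h𝒶.isInternal.chooseDecomposition
    let _ : GradedRing 𝒶 := { gm with toDecomposition := inferInstance }
    obtain ⟨S, hS, rfl⟩ := hI
    have hom := Ideal.homogeneous_span 𝒶 S hS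
    have hmem : ∑ W ∈ s, y W ∈ Ideal.span S := by
      rw [← Ideal.Quotient.eq_zero_iff_mem, map_sum, ← hs]
      exact Finset.sum_congr rfl fun W _ => hyx W
    have h3 := hom V hmem
    have h4 : (DirectSum.decompose 𝒶 (∑ W ∈ s, y W) V : A) = y V := by
      rw [DirectSum.decompose_sum, DFinsupp.finsetSum_apply, AddSubmonoidClass.coe_finsetSum,
        Finset.sum_eq_single V]
      · exact DirectSum.decompose_of_mem_same 𝒶 (hy V)
      · intro W _ hW
        exact DirectSum.decompose_of_mem_ne 𝒶 (hy W) hW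
      · intro h; exact absurd hV h
    rw [h4, ← Ideal.Quotient.eq_zero_iff_mem] at h3
    rw [← hyx]
    exact h3
  · intro a
    obtain ⟨a, rfl⟩ := Ideal.Quotient.mk_surjective a
    refine AddSubgroup.iSup_induction 𝒶
      (C := fun a => Ideal.Quotient.mk I a ∈ ⨆ V, EquivSteenrod.quotDeg 𝒶 I V) (h2 a) ?_ ?_ ?_
    · exact fun V r hr => AddSubgroup.mem_iSup_of_mem V ⟨r, hr, rfl⟩
    · simp
    · intro x y hx hy
      rw [map_add]
      exact add_mem hx hy

end Grading

section Hopf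
variable {G : Type*} [AddCommGroup G] [DecidableEq G]
variable {H : Type*} [CommRing H] {𝒽 : G → AddSubgroup H}

/-- A `G`-graded commutative Hopf algebroid `(H, A)`, with left unit `algebraMap H A`
(all rings in use have characteristic two, so that no signs occur). -/
structure HopfAlgebroid (𝒽 : G → AddSubgroup H) {A : Type*} [CommRing A] [Algebra H A]
    (𝒶 : G → AddSubgroup A) where
  isGrading_base : IsGrading 𝒽
  isGrading : IsGrading 𝒶
  /-- the right unit -/
  ηR : H →+* A
  /-- the counit -/
  ε : A →+* H
  /-- the coproduct -/
  Δ : A →+* BiTensor ηR A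
  /-- the antipode -/
  c : A →+* A
  ηL_mem : ∀ {V h}, h ∈ 𝒽 V → algebraMap H A h ∈ 𝒶 V
  ηR_mem : ∀ {V h}, h ∈ 𝒽 V → ηR h ∈ 𝒶 V
  ε_mem : ∀ {V a}, a ∈ 𝒶 V → ε a ∈ 𝒽 V
  Δ_mem : ∀ {V a}, a ∈ 𝒶 V → Δ a ∈ BiTensor.deg ηR 𝒶 𝒶 V
  c_mem : ∀ {V a}, a ∈ 𝒶 V → c a ∈ 𝒶 V
  ε_ηL : ∀ h, ε (algebraMap H A h) = h
  ε_ηR : ∀ h, ε (ηR h) = h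
  Δ_ηL : ∀ h, Δ (algebraMap H A h) = BiTensor.inl ηR A (algebraMap H A h)
  Δ_ηR : ∀ h, Δ (ηR h) = BiTensor.inr ηR (ηR h)
  /-- `(ε ⊗ id) ∘ Δ = id` -/
  counit_left : ∀ a, BiTensor.ringLift ηR ((algebraMap H A).comp ε) (RingHom.id A)
    (fun h => by simp [ε_ηR]) (Δ a) = a
  /-- `(id ⊗ ε) ∘ Δ = id` -/
  counit_right : ∀ a, BiTensor.ringLift ηR (RingHom.id A) (ηR.comp ε)
    (fun h => by simp [ε_ηL]) (Δ a) = a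
  /-- `(Δ ⊗ id) ∘ Δ = (id ⊗ Δ) ∘ Δ`, in `A ⊗ (A ⊗ A)` -/
  coassoc : ∀ a,
    BiTensor.ringLift (T := BiTensor ηR (BiTensor ηR A)) ηR
      ((BiTensor.ringLift ηR (BiTensor.inl ηR _)
        ((BiTensor.inr ηR).comp (BiTensor.inl ηR A))
        (fun h => by rw [BiTensor.inl_ηR, BiTensor.algebraMap_eq]; rfl)).comp Δ)
      ((BiTensor.inr ηR).comp (BiTensor.inr ηR))
      (fun h => by simp [Δ_ηR, BiTensor.inl_ηR]) (Δ a) =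
    BiTensor.ringLift (T := BiTensor ηR (BiTensor ηR A)) ηR
      (BiTensor.inl ηR _) ((BiTensor.inr ηR).comp Δ)
      (fun h => by rw [BiTensor.inl_ηR, BiTensor.algebraMap_eq]; simp [Δ_ηL]) (Δ a)
  c_ηL : ∀ h, c (algebraMap H A h) = ηR h
  c_ηR : ∀ h, c (ηR h) = algebraMap H A h
  c_c : ∀ a, c (c a) = a
  /-- `μ ∘ (c ⊗ id) ∘ Δ = ηR ∘ ε` -/
  antipode_left : ∀ a, BiTensor.ringLift ηR c (RingHom.id A)
    (fun h => by simp [c_ηR]) (Δ a) = ηR (ε a)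
  /-- `μ ∘ (id ⊗ c) ∘ Δ = ηL ∘ ε` -/
  antipode_right : ∀ a, BiTensor.ringLift ηR (RingHom.id A) c
    (fun h => by simp [c_ηL]) (Δ a) = algebraMap H A (ε a)

namespace HopfAlgebroid

variable {A : Type*} [CommRing A] [Algebra H A] {𝒶 : G → AddSubgroup A}
variable {B : Type*} [CommRing B] [Algebra H B] {𝒷 : G → AddSubgroup B}
variable {C : Type*} [CommRing C] [Algebra H C] {𝒸 : G → AddSubgroup C}

/-- A morphism of graded Hopf algebroids that is the identity on `H`. -/
structure Hom (X : HopfAlgebroid 𝒽 𝒷) (Y : HopfAlgebroid 𝒽 𝒸) where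
  toRingHom : B →+* C
  map_mem : ∀ {V b}, b ∈ 𝒷 V → toRingHom b ∈ 𝒸 V
  map_ηL : ∀ h, toRingHom (algebraMap H B h) = algebraMap H C h
  map_ηR : ∀ h, toRingHom (X.ηR h) = Y.ηR h
  map_ε : ∀ b, Y.ε (toRingHom b) = X.ε b
  map_Δ : ∀ b, Y.Δ (toRingHom b) =
    BiTensor.ringLift X.ηR ((BiTensor.inl Y.ηR C).comp toRingHom)
      ((BiTensor.inr Y.ηR).comp toRingHom)
      (fun h => by simp [map_ηL, map_ηR, BiTensor.inl_ηR]) (X.Δ b)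
  map_c : ∀ b, Y.c (toRingHom b) = toRingHom (X.c b)

/-- A graded Hopf algebroid ideal. In the commutative ring `A ⊗ A` the subgroup
`I ⊗ A + A ⊗ I` is the sum of the ideals generated by `I ⊗ 1` and `1 ⊗ I`. -/
structure IsHopfIdeal (X : HopfAlgebroid 𝒽 𝒶) (I : Ideal A) : Prop where
  homogeneous : IsHomogeneousIdeal 𝒶 I
  ε_mem : ∀ x ∈ I, X.ε x = 0
  Δ_mem : ∀ x ∈ I, X.Δ x ∈ I.map (BiTensor.inl X.ηR A) ⊔ I.map (BiTensor.inr X.ηR)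
  c_mem : ∀ x ∈ I, X.c x ∈ I

section Quotient
variable (X : HopfAlgebroid 𝒽 𝒶) {I : Ideal A}

variable (I) in
/-- `π ⊗ π : A ⊗ A → A/I ⊗ A/I`. -/
def quotTensor : BiTensor X.ηR A →+* BiTensor ((Ideal.Quotient.mk I).comp X.ηR) (A ⧸ I) :=
  BiTensor.ringLift X.ηR
    ((BiTensor.inl ((Ideal.Quotient.mk I).comp X.ηR) (A ⧸ I)).comp (Ideal.Quotient.mk I))
    ((BiTensor.inr ((Ideal.Quotient.mk I).comp X.ηR)).comp (Ideal.Quotient.mk I))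
    (fun h => BiTensor.inl_ηR ((Ideal.Quotient.mk I).comp X.ηR) h)

@[simp] theorem quotTensor_tmul (x y : A) : X.quotTensor I (BiTensor.tmul _ x y) =
    BiTensor.tmul _ (Ideal.Quotient.mk I x) (Ideal.Quotient.mk I y) := by
  rw [quotTensor, BiTensor.ringLift_tmul, BiTensor.tmul_eq]; rfl

@[simp] theorem quotTensor_inl (x : A) : X.quotTensor I (BiTensor.inl _ _ x) =
    BiTensor.inl _ _ (Ideal.Quotient.mk I x) := BiTensor.ringLift_inl _ _ _ _ _

@[simp] theorem quotTensor_inr (x : A) : X.quotTensor I (BiTensor.inr _ x) =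
    BiTensor.inr _ (Ideal.Quotient.mk I x) := BiTensor.ringLift_inr _ _ _ _ _

theorem quotTensor_Δ (hI : X.IsHopfIdeal I) (x : A) (hx : x ∈ I) :
    X.quotTensor I (X.Δ x) = 0 := by
  have h : I.map (BiTensor.inl X.ηR A) ⊔ I.map (BiTensor.inr X.ηR) ≤
      RingHom.ker (X.quotTensor I) := by
    refine sup_le (Ideal.map_le_iff_le_comap.2 fun y hy => ?_)
      (Ideal.map_le_iff_le_comap.2 fun y hy => ?_)
    · rw [Ideal.mem_comap, RingHom.mem_ker, quotTensor_inl, Ideal.Quotient.eq_zero_iff_mem.2 hy,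
        map_zero]
    · rw [Ideal.mem_comap, RingHom.mem_ker, quotTensor_inr, Ideal.Quotient.eq_zero_iff_mem.2 hy,
        map_zero]
  exact h (hI.Δ_mem x hx)

variable (I) in
/-- `π ⊗ π ⊗ π`. -/
def quotTensor₃ : BiTensor X.ηR (BiTensor X.ηR A) →+*
    BiTensor ((Ideal.Quotient.mk I).comp X.ηR)
      (BiTensor ((Ideal.Quotient.mk I).comp X.ηR) (A ⧸ I)) :=
  BiTensor.ringLift X.ηR
    ((BiTensor.inl ((Ideal.Quotient.mk I).comp X.ηR) _).comp (Ideal.Quotient.mk I))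
    ((BiTensor.inr ((Ideal.Quotient.mk I).comp X.ηR)).comp (X.quotTensor I))
    (fun h => by
      simp only [RingHom.comp_apply, BiTensor.algebraMap_eq, quotTensor_inl]
      exact BiTensor.inl_ηR ((Ideal.Quotient.mk I).comp X.ηR) h)

@[simp] theorem quotTensor₃_inl (x : A) : X.quotTensor₃ I (BiTensor.inl _ _ x) =
    BiTensor.inl _ _ (Ideal.Quotient.mk I x) := BiTensor.ringLift_inl _ _ _ _ _

@[simp] theorem quotTensor₃_inr (x : BiTensor X.ηR A) : X.quotTensor₃ I (BiTensor.inr _ x) =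
    BiTensor.inr _ (X.quotTensor I x) := BiTensor.ringLift_inr _ _ _ _ _

theorem quotient_coassoc (hI : X.IsHopfIdeal I) (h₁ h₂ h₃) (a : A) :
    BiTensor.ringLift (T := BiTensor ((Ideal.Quotient.mk I).comp X.ηR)
        (BiTensor ((Ideal.Quotient.mk I).comp X.ηR) (A ⧸ I))) ((Ideal.Quotient.mk I).comp X.ηR)
      ((BiTensor.ringLift ((Ideal.Quotient.mk I).comp X.ηR) (BiTensor.inl _ _)
        ((BiTensor.inr _).comp (BiTensor.inl ((Ideal.Quotient.mk I).comp X.ηR) (A ⧸ I))) h₁).comp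
        (Ideal.Quotient.lift I ((X.quotTensor I).comp X.Δ) (X.quotTensor_Δ hI)))
      ((BiTensor.inr _).comp (BiTensor.inr _)) h₂ (X.quotTensor I (X.Δ a)) =
    BiTensor.ringLift (T := BiTensor ((Ideal.Quotient.mk I).comp X.ηR)
        (BiTensor ((Ideal.Quotient.mk I).comp X.ηR) (A ⧸ I))) ((Ideal.Quotient.mk I).comp X.ηR)
      (BiTensor.inl _ _) ((BiTensor.inr _).comp
        (Ideal.Quotient.lift I ((X.quotTensor I).comp X.Δ) (X.quotTensor_Δ hI))) h₃
      (X.quotTensor I (X.Δ a)) := by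
  have key := congrArg (X.quotTensor₃ I) (X.coassoc a)
  rw [← RingHom.comp_apply, ← RingHom.comp_apply (X.quotTensor₃ I)] at key
  rw [← RingHom.comp_apply _ (X.quotTensor I), ← RingHom.comp_apply _ (X.quotTensor I)]
  refine Eq.trans ?_ (key.trans ?_)
  · refine RingHom.congr_fun (BiTensor.ringHom_ext (fun x => ?_) (fun x => ?_)) _
    · simp only [RingHom.comp_apply, quotTensor_inl, BiTensor.ringLift_inl, Ideal.Quotient.lift_mk]
      rw [← RingHom.comp_apply, ← RingHom.comp_apply (X.quotTensor₃ I)]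
      refine RingHom.congr_fun (BiTensor.ringHom_ext (fun x => ?_) (fun x => ?_)) _
      · simp only [RingHom.comp_apply, quotTensor_inl, BiTensor.ringLift_inl, quotTensor₃_inl]
      · simp only [RingHom.comp_apply, quotTensor_inr, BiTensor.ringLift_inr, quotTensor₃_inr,
          quotTensor_inl]
    · simp only [RingHom.comp_apply, quotTensor_inr, BiTensor.ringLift_inr, quotTensor₃_inr]
  · refine RingHom.congr_fun (BiTensor.ringHom_ext (fun x => ?_) (fun x => ?_)) _
    · simp only [RingHom.comp_apply, quotTensor_inl, BiTensor.ringLift_inl, quotTensor₃_inl]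
    · simp only [RingHom.comp_apply, quotTensor_inr, BiTensor.ringLift_inr, quotTensor₃_inr,
        Ideal.Quotient.lift_mk]

/-- The quotient of a Hopf algebroid by a Hopf algebroid ideal. -/
def quotient (hI : X.IsHopfIdeal I) : HopfAlgebroid 𝒽 (quotDeg 𝒶 I) where
  isGrading_base := X.isGrading_base
  isGrading := X.isGrading.quotDeg hI.homogeneous
  ηR := (Ideal.Quotient.mk I).comp X.ηR
  ε := Ideal.Quotient.lift I X.ε hI.ε_mem
  Δ := Ideal.Quotient.lift I ((X.quotTensor I).comp X.Δ) (X.quotTensor_Δ hI)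
  c := Ideal.Quotient.lift I ((Ideal.Quotient.mk I).comp X.c)
    (fun x hx => Ideal.Quotient.eq_zero_iff_mem.2 (hI.c_mem x hx))
  ηL_mem hh := ⟨_, X.ηL_mem hh, rfl⟩
  ηR_mem hh := ⟨_, X.ηR_mem hh, rfl⟩
  ε_mem := by
    rintro V _ ⟨a, ha, rfl⟩
    exact X.ε_mem ha
  Δ_mem := by
    rintro V _ ⟨a, ha, rfl⟩
    change X.quotTensor I (X.Δ a) ∈ _
    have h := X.Δ_mem ha
    unfold BiTensor.deg at h
    generalize X.Δ a = z at h
    induction h using AddSubgroup.closure_induction with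
    | mem x hx =>
      obtain ⟨i, j, a, m, ha, hm, hij, rfl⟩ := hx
      rw [quotTensor_tmul]
      exact AddSubgroup.subset_closure ⟨i, j, _, _, ⟨a, ha, rfl⟩, ⟨m, hm, rfl⟩, hij, rfl⟩
    | zero => rw [map_zero]; exact zero_mem _
    | add x y _ _ hx hy => rw [map_add]; exact add_mem hx hy
    | neg x _ hx => rw [map_neg]; exact neg_mem hx
  c_mem := by
    rintro V _ ⟨a, ha, rfl⟩
    exact ⟨_, X.c_mem ha, rfl⟩
  ε_ηL h := X.ε_ηL h
  ε_ηR h := X.ε_ηR h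
  Δ_ηL h := by
    change X.quotTensor I (X.Δ (algebraMap H A h)) = _
    rw [X.Δ_ηL, quotTensor_inl]; rfl
  Δ_ηR h := by
    change X.quotTensor I (X.Δ (X.ηR h)) = _
    rw [X.Δ_ηR, quotTensor_inr]; rfl
  counit_left a := by
    obtain ⟨a, rfl⟩ := Ideal.Quotient.mk_surjective a
    conv_rhs => rw [← X.counit_left a]
    simp only [Ideal.Quotient.lift_mk, RingHom.comp_apply]
    induction X.Δ a using BiTensor.induction with
    | zero => simp
    | pure x y => simp
    | add x y hx hy => simp only [map_add, hx, hy]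
  counit_right a := by
    obtain ⟨a, rfl⟩ := Ideal.Quotient.mk_surjective a
    conv_rhs => rw [← X.counit_right a]
    simp only [Ideal.Quotient.lift_mk, RingHom.comp_apply]
    induction X.Δ a using BiTensor.induction with
    | zero => simp
    | pure x y => simp
    | add x y hx hy => simp only [map_add, hx, hy]
  coassoc a := by
    obtain ⟨a, rfl⟩ := Ideal.Quotient.mk_surjective a
    exact X.quotient_coassoc hI _ _ _ a
  c_ηL h := congrArg (Ideal.Quotient.mk I) (X.c_ηL h)
  c_ηR h := congrArg (Ideal.Quotient.mk I) (X.c_ηR h)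
  c_c a := by
    obtain ⟨a, rfl⟩ := Ideal.Quotient.mk_surjective a
    exact congrArg (Ideal.Quotient.mk I) (X.c_c a)
  antipode_left a := by
    obtain ⟨a, rfl⟩ := Ideal.Quotient.mk_surjective a
    refine Eq.trans ?_ (congrArg (Ideal.Quotient.mk I) (X.antipode_left a))
    simp only [Ideal.Quotient.lift_mk, RingHom.comp_apply]
    induction X.Δ a using BiTensor.induction with
    | zero => simp
    | pure x y => simp
    | add x y hx hy => simp only [map_add, hx, hy]
  antipode_right a := by
    obtain ⟨a, rfl⟩ := Ideal.Quotient.mk_surjective a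
    refine Eq.trans ?_ (congrArg (Ideal.Quotient.mk I) (X.antipode_right a))
    simp only [Ideal.Quotient.lift_mk, RingHom.comp_apply]
    induction X.Δ a using BiTensor.induction with
    | zero => simp
    | pure x y => simp
    | add x y hx hy => simp only [map_add, hx, hy]

end Quotient
end HopfAlgebroid
end Hopf

section Comodules
variable {G : Type*} [AddCommGroup G] [DecidableEq G]
variable {H : Type*} [CommRing H] {𝒽 : G → AddSubgroup H}

namespace HopfAlgebroid

variable {A : Type*} [CommRing A] [Algebra H A] {𝒶 : G → AddSubgroup A}
variable {B : Type*} [CommRing B] [Algebra H B] {𝒷 : G → AddSubgroup B}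
variable {C : Type*} [CommRing C] [Algebra H C] {𝒸 : G → AddSubgroup C}

/-- The projection onto a quotient Hopf algebroid. -/
def quotientHom (X : HopfAlgebroid 𝒽 𝒶) {I : Ideal A} (hI : X.IsHopfIdeal I) :
    Hom X (X.quotient hI) where
  toRingHom := Ideal.Quotient.mk I
  map_mem hb := ⟨_, hb, rfl⟩
  map_ηL _ := rfl
  map_ηR _ := rfl
  map_ε _ := rfl
  map_Δ _ := rfl
  map_c _ := rfl

/-- The projection between the quotients by two nested Hopf algebroid ideals. -/
def factorHom (X : HopfAlgebroid 𝒽 𝒶) {I J : Ideal A} (hI : X.IsHopfIdeal I)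
    (hJ : X.IsHopfIdeal J) (hIJ : I ≤ J) : Hom (X.quotient hI) (X.quotient hJ) where
  toRingHom := Ideal.Quotient.factor hIJ
  map_mem := by
    rintro V _ ⟨a, ha, rfl⟩
    exact ⟨a, ha, rfl⟩
  map_ηL _ := rfl
  map_ηR _ := rfl
  map_ε b := by
    obtain ⟨a, rfl⟩ := Ideal.Quotient.mk_surjective b
    rfl
  map_Δ b := by
    obtain ⟨a, rfl⟩ := Ideal.Quotient.mk_surjective b
    have h₁ : (X.quotient hI).Δ (Ideal.Quotient.mk I a) = X.quotTensor I (X.Δ a) := rfl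
    have h₂ : (X.quotient hJ).Δ (Ideal.Quotient.factor hIJ (Ideal.Quotient.mk I a)) =
      X.quotTensor J (X.Δ a) := rfl
    rw [h₁, h₂]
    induction X.Δ a using BiTensor.induction with
    | zero =>
      rw [map_zero, map_zero]
      exact (map_zero _).symm
    | pure p q =>
      rw [quotTensor_tmul, quotTensor_tmul, BiTensor.tmul_eq]
      rfl
    | add x y hx hy =>
      rw [map_add, map_add, hx, hy]
      exact (map_add _ _ _).symm
  map_c b := by
    obtain ⟨a, rfl⟩ := Ideal.Quotient.mk_surjective b
    rfl

section Maps
variable (Y : HopfAlgebroid 𝒽 𝒸) (M : Type*) [AddCommGroup M] [Module H M]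

/-- `ε ⊗ id : C ⊗ M → M`. -/
def counitMap : BiTensor Y.ηR M →+ M :=
  BiTensor.lift Y.ηR
    ((Module.toAddMonoidEnd H M).toAddMonoidHom.comp Y.ε.toAddMonoidHom)
    (fun a h m => by
      change Y.ε (a * Y.ηR h) • m = Y.ε a • h • m
      rw [map_mul, Y.ε_ηR, mul_smul])

@[simp] theorem counitMap_tmul (a : C) (m : M) :
    Y.counitMap M (BiTensor.tmul Y.ηR a m) = Y.ε a • m := rfl

/-- The coproduct as a map of left `H`-modules. -/
def Δₗ : C →ₗ[H] BiTensor Y.ηR C where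
  toFun := Y.Δ
  map_add' := map_add Y.Δ
  map_smul' h a := by
    rw [Algebra.smul_def, map_mul, Y.Δ_ηL, RingHom.id_apply, Algebra.smul_def,
      BiTensor.algebraMap_eq]

@[simp] theorem Δₗ_apply (a : C) : Y.Δₗ a = Y.Δ a := rfl

theorem mapRight_mkLeft_balanced (h : H) (m : M) (z : BiTensor Y.ηR C) :
    BiTensor.mapRight Y.ηR (BiTensor.mkLeft Y.ηR m) (z * BiTensor.inr Y.ηR (Y.ηR h)) =
      BiTensor.mapRight Y.ηR (BiTensor.mkLeft Y.ηR (h • m)) z := by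
  induction z using BiTensor.induction with
  | zero => simp
  | pure a b =>
    rw [BiTensor.inr_apply, BiTensor.tmul_mul_tmul]
    simp [BiTensor.balanced]
  | add x y hx hy => rw [add_mul, map_add, map_add, hx, hy]

/-- `Δ ⊗ id : C ⊗ M → C ⊗ (C ⊗ M)`. -/
def comulMap : BiTensor Y.ηR M →ₗ[H] BiTensor Y.ηR (BiTensor Y.ηR M) :=
  let L : BiTensor Y.ηR M →+ BiTensor Y.ηR (BiTensor Y.ηR M) := BiTensor.lift Y.ηR
    { toFun := fun a =>
        { toFun := fun m => BiTensor.mapRight Y.ηR (BiTensor.mkLeft Y.ηR m) (Y.Δ a)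
          map_zero' := by
            induction Y.Δ a using BiTensor.induction with
            | zero => simp
            | pure a b =>
              rw [BiTensor.mapRight_tmul, BiTensor.mkLeft_apply, ← BiTensor.tmulHom_apply,
                ← BiTensor.tmulHom_apply, map_zero, map_zero]
            | add x y hx hy => rw [map_add, hx, hy, add_zero]
          map_add' := fun m n => by
            induction Y.Δ a using BiTensor.induction with
            | zero => simp
            | pure a b =>
              simp only [BiTensor.mapRight_tmul, BiTensor.mkLeft_apply, BiTensor.tmul_add]
            | add x y hx hy => simp only [map_add, hx, hy]; abel }
      map_zero' := by ext; simp
      map_add' := fun a b => by ext; simp }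
    (fun a h m => by
      change BiTensor.mapRight Y.ηR (BiTensor.mkLeft Y.ηR m) (Y.Δ (a * Y.ηR h)) =
        BiTensor.mapRight Y.ηR (BiTensor.mkLeft Y.ηR (h • m)) (Y.Δ a)
      rw [map_mul, Y.Δ_ηR, mapRight_mkLeft_balanced])
  { L with
    map_smul' := fun h x => by
      change L (h • x) = h • L x
      induction x using BiTensor.induction with
      | zero => simp
      | pure a m =>
        change BiTensor.mapRight Y.ηR (BiTensor.mkLeft Y.ηR m) (Y.Δₗ (algebraMap H C h * a)) =
          h • BiTensor.mapRight Y.ηR (BiTensor.mkLeft Y.ηR m) (Y.Δₗ a)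
        rw [← Algebra.smul_def, map_smul, map_smul]
      | add x y hx hy => rw [smul_add, map_add, hx, hy, map_add, smul_add] }

@[simp] theorem comulMap_tmul (a : C) (m : M) : Y.comulMap M (BiTensor.tmul Y.ηR a m) =
    BiTensor.mapRight Y.ηR (BiTensor.mkLeft Y.ηR m) (Y.Δ a) := rfl

theorem coassoc' (a : C) :
    BiTensor.mapRight Y.ηR Y.Δₗ (Y.Δ a) = Y.comulMap C (Y.Δ a) := by
  refine Eq.trans ?_ ((Y.coassoc a).symm.trans ?_)
  · induction Y.Δ a using BiTensor.induction with
    | zero => simp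
    | pure a b =>
      rw [BiTensor.mapRight_tmul, BiTensor.ringLift_tmul, BiTensor.tmul_eq]; rfl
    | add x y hx hy => rw [map_add, map_add, hx, hy]
  · induction Y.Δ a using BiTensor.induction with
    | zero => simp
    | pure a b =>
      rw [BiTensor.ringLift_tmul, comulMap_tmul, RingHom.comp_apply]
      induction Y.Δ a using BiTensor.induction with
      | zero => simp
      | pure p q =>
        rw [BiTensor.mapRight_tmul, BiTensor.ringLift_tmul, BiTensor.mkLeft_apply, mul_assoc,
          RingHom.comp_apply, RingHom.comp_apply, ← map_mul, ← BiTensor.tmul_eq,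
          ← BiTensor.tmul_eq]
      | add x y hx hy => rw [map_add, add_mul, hx, hy, map_add]
    | add x y hx hy => rw [map_add, map_add, hx, hy]

end Maps

/-- A left comodule over a Hopf algebroid `(H, C)`: a left `H`-module `M` with a coassociative and
counital left `H`-linear map `M → C ⊗ M`. -/
structure Comodule (Y : HopfAlgebroid 𝒽 𝒸) (M : Type*) [AddCommGroup M] [Module H M] where
  coact : M →ₗ[H] BiTensor Y.ηR M
  counit : ∀ m, Y.counitMap M (coact m) = m
  coassoc : ∀ m, BiTensor.mapRight Y.ηR coact (coact m) = Y.comulMap M (coact m)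

/-- The cofree left comodule `C ⊗ M` on a left `H`-module `M`, with coaction `Δ ⊗ id`. -/
def cofree (Y : HopfAlgebroid 𝒽 𝒸) (M : Type*) [AddCommGroup M] [Module H M] :
    Comodule Y (BiTensor Y.ηR M) where
  coact := Y.comulMap M
  counit x := by
    induction x using BiTensor.induction with
    | zero => simp
    | pure a m =>
      rw [comulMap_tmul]
      conv_rhs => rw [← Y.counit_left a]
      induction Y.Δ a using BiTensor.induction with
      | zero => simp [← BiTensor.mkLeft_apply]
      | pure p q =>
        rw [BiTensor.mapRight_tmul, counitMap_tmul, BiTensor.ringLift_tmul, BiTensor.mkLeft_apply]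
        rfl
      | add x y hx hy => simp only [map_add, BiTensor.add_tmul, hx, hy]
    | add x y hx hy => rw [map_add, map_add, hx, hy]
  coassoc x := by
    induction x using BiTensor.induction with
    | zero => simp
    | pure a m =>
      rw [comulMap_tmul]
      have key := congrArg
        (BiTensor.mapRight Y.ηR (BiTensor.mapRight Y.ηR (BiTensor.mkLeft Y.ηR m))) (Y.coassoc' a)
      refine Eq.trans ?_ (key.trans ?_)
      · induction Y.Δ a using BiTensor.induction with
        | zero => simp
        | pure p q => simp
        | add x y hx hy => simp only [map_add, hx, hy]
      · induction Y.Δ a using BiTensor.induction with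
        | zero => simp
        | pure p q =>
          rw [comulMap_tmul, BiTensor.mapRight_tmul, comulMap_tmul]
          induction Y.Δ p using BiTensor.induction with
          | zero => simp
          | pure r s => simp
          | add x y hx hy => simp only [map_add, hx, hy]
        | add x y hx hy => simp only [map_add, hx, hy]
    | add x y hx hy => simp only [map_add, hx, hy]

namespace Hom
variable {X : HopfAlgebroid 𝒽 𝒷} {Y : HopfAlgebroid 𝒽 𝒸} (f : Hom X Y)

/-- `f ⊗ id : B ⊗ M → C ⊗ M`. -/
def mapLeft (M : Type*) [AddCommGroup M] [Module H M] :
    BiTensor X.ηR M →ₗ[H] BiTensor Y.ηR M :=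
  let L : BiTensor X.ηR M →+ BiTensor Y.ηR M := BiTensor.lift X.ηR
    ((BiTensor.tmulHom Y.ηR).comp f.toRingHom.toAddMonoidHom)
    (fun a h m => by simp [f.map_ηR, BiTensor.balanced])
  { L with
    map_smul' := fun h x => by
      change L (h • x) = h • L x
      induction x using BiTensor.induction with
      | zero => simp
      | pure a m =>
        change BiTensor.tmul Y.ηR (f.toRingHom (algebraMap H B h * a)) m =
          BiTensor.tmul Y.ηR (algebraMap H C h * f.toRingHom a) m
        rw [map_mul, f.map_ηL]
      | add x y hx hy => rw [smul_add, map_add, hx, hy, map_add, smul_add] }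

@[simp] theorem mapLeft_tmul (M : Type*) [AddCommGroup M] [Module H M] (b : B) (m : M) :
    f.mapLeft M (BiTensor.tmul X.ηR b m) = BiTensor.tmul Y.ηR (f.toRingHom b) m := rfl

/-- The left `C`-comodule structure on `B` induced by a morphism of Hopf algebroids `B → C`:
the coaction is `(f ⊗ id) ∘ Δ`. -/
def comodule : Comodule Y B where
  coact := (f.mapLeft B).comp X.Δₗ
  counit b := by
    conv_rhs => rw [← X.counit_left b]
    rw [LinearMap.comp_apply, Δₗ_apply]
    induction X.Δ b using BiTensor.induction with
    | zero => simp
    | pure p q => simp [f.map_ε, Algebra.smul_def]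
    | add x y hx hy => simp only [map_add, hx, hy]
  coassoc b := by
    rw [LinearMap.comp_apply, Δₗ_apply]
    have key := congrArg (fun z => BiTensor.mapRight Y.ηR (f.mapLeft B) (f.mapLeft _ z))
      (X.coassoc' b)
    refine Eq.trans ?_ (key.trans ?_)
    · induction X.Δ b using BiTensor.induction with
      | zero => simp
      | pure p q => simp
      | add x y hx hy => simp only [map_add, hx, hy]
    · induction X.Δ b using BiTensor.induction with
      | zero => simp
      | pure p q =>
        rw [comulMap_tmul, mapLeft_tmul, comulMap_tmul, f.map_Δ]
        induction X.Δ p using BiTensor.induction with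
        | zero => simp
        | pure r s =>
          rw [BiTensor.ringLift_tmul, RingHom.comp_apply, RingHom.comp_apply, ← BiTensor.tmul_eq]
          simp
        | add x y hx hy => simp only [map_add, hx, hy]
      | add x y hx hy => simp only [map_add, hx, hy]

end Hom

/-- The grading of the free `H`-module `H{b_i}` on generators `b_i` of degree `d i`. -/
def freeDeg (𝒽 : G → AddSubgroup H) {ι : Type*} (d : ι → G) (V : G) : AddSubgroup (ι →₀ H) where
  carrier := {m | ∀ i, m i ∈ 𝒽 (V - d i)}
  zero_mem' _ := zero_mem _
  add_mem' hx hy i := add_mem (hx i) (hy i)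
  neg_mem' hx i := neg_mem (hx i)

/-- For a morphism of Hopf algebroids `f : B → C`, the `C`-comodule `B` is cofree: there is an
isomorphism of graded left `C`-comodules between `B` and the cofree comodule `C ⊗ H{b_i}` on a
free graded `H`-module. -/
def Hom.IsCofree {X : HopfAlgebroid 𝒽 𝒷} {Y : HopfAlgebroid 𝒽 𝒸} (f : Hom X Y) : Prop :=
  ∃ (ι : Type) (d : ι → G) (φ : B ≃ₗ[H] BiTensor Y.ηR (ι →₀ H)),
    (∀ b, (Y.cofree (ι →₀ H)).coact (φ b) =
      BiTensor.mapRight Y.ηR φ.toLinearMap (f.comodule.coact b)) ∧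
    ∀ V b, b ∈ 𝒷 V ↔ φ b ∈ BiTensor.deg Y.ηR 𝒸 (freeDeg 𝒽 d) V

end HopfAlgebroid
end Comodules

section GradedHelpers
variable {G : Type*} [AddCommGroup G]

theorem map_polyDeg_mem {R σ T : Type*} [CommRing R] [CommRing T] {𝓇 : G → AddSubgroup R}
    {𝓉 : G → AddSubgroup T} [SetLike.GradedMonoid 𝓉] {w : σ → G} (F : MvPolynomial σ R →+* T)
    (hC : ∀ V, ∀ r ∈ 𝓇 V, F (MvPolynomial.C r) ∈ 𝓉 V) (hX : ∀ s, F (MvPolynomial.X s) ∈ 𝓉 (w s))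
    {V : G} {p : MvPolynomial σ R} (hp : p ∈ polyDeg 𝓇 w V) : F p ∈ 𝓉 V := by
  rw [p.as_sum, map_sum]
  refine sum_mem fun m _ => ?_
  rw [MvPolynomial.monomial_eq, map_mul, Finsupp.prod, map_prod]
  have h1 := hC _ _ (hp m)
  have h2 : ∏ s ∈ m.support, F (MvPolynomial.X s ^ m s) ∈ 𝓉 (∑ s ∈ m.support, m s • w s) := by
    refine SetLike.prod_mem_graded (A := 𝓉) (fun s => m s • w s) _ fun s _ => ?_
    rw [map_pow]
    exact SetLike.pow_mem_graded _ (hX s)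
  have h3 := SetLike.GradedMul.mul_mem h1 h2
  rwa [Finsupp.weight_apply, Finsupp.sum, sub_add_cancel] at h3

variable {H A B : Type*} [CommRing H] [CommRing A] [CommRing B] [Algebra H B] (ηR : H →+* A)
variable (𝒶 : G → AddSubgroup A) (𝒷 : G → AddSubgroup B)
variable [SetLike.GradedMonoid 𝒶] [SetLike.GradedMonoid 𝒷]

theorem BiTensor.inl_mem {V : G} {a : A} (ha : a ∈ 𝒶 V) :
    BiTensor.inl ηR B a ∈ BiTensor.deg ηR 𝒶 𝒷 V :=
  AddSubgroup.subset_closure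
    ⟨V, 0, a, 1, ha, SetLike.GradedOne.one_mem, add_zero V, rfl⟩

theorem BiTensor.inr_mem {V : G} {b : B} (hb : b ∈ 𝒷 V) :
    BiTensor.inr ηR b ∈ BiTensor.deg ηR 𝒶 𝒷 V :=
  AddSubgroup.subset_closure
    ⟨0, V, 1, b, SetLike.GradedOne.one_mem, hb, zero_add V, rfl⟩

theorem BiTensor.gradedMonoid : SetLike.GradedMonoid (BiTensor.deg ηR 𝒶 𝒷) where
  one_mem := by
    rw [← map_one (BiTensor.inl ηR B)]
    exact BiTensor.inl_mem ηR 𝒶 𝒷 SetLike.GradedOne.one_mem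
  mul_mem i j x y hx hy := by
    unfold BiTensor.deg at hx hy
    induction hx using AddSubgroup.closure_induction with
    | zero => rw [zero_mul]; exact zero_mem _
    | add x x' _ _ hx hx' => rw [add_mul]; exact add_mem hx hx'
    | neg x _ hx => rw [neg_mul]; exact neg_mem hx
    | mem x hx =>
      induction hy using AddSubgroup.closure_induction with
      | zero => rw [mul_zero]; exact zero_mem _
      | add y y' _ _ hy hy' => rw [mul_add]; exact add_mem hy hy'
      | neg y _ hy => rw [mul_neg]; exact neg_mem hy
      | mem y hy =>
        obtain ⟨i₁, j₁, a, b, ha, hb, rfl, rfl⟩ := hx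
        obtain ⟨i₂, j₂, a', b', ha', hb', rfl, rfl⟩ := hy
        rw [BiTensor.tmul_mul_tmul]
        exact AddSubgroup.subset_closure ⟨i₁ + i₂, j₁ + j₂, _, _,
          SetLike.GradedMul.mul_mem ha ha', SetLike.GradedMul.mul_mem hb hb',
          add_add_add_comm _ _ _ _, rfl⟩

end GradedHelpers

section Conv

theorem sum_antidiagonal_assoc {N : Type*} [AddCommMonoid N] (f : ℕ → ℕ → ℕ → N) (n : ℕ) :
    ∑ x ∈ Finset.HasAntidiagonal.antidiagonal n, ∑ y ∈ Finset.HasAntidiagonal.antidiagonal x.1, f y.1 y.2 x.2 =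
      ∑ x ∈ Finset.HasAntidiagonal.antidiagonal n, ∑ y ∈ Finset.HasAntidiagonal.antidiagonal x.2, f x.1 y.1 y.2 := by
  rw [Finset.sum_sigma', Finset.sum_sigma']
  refine Finset.sum_bij' (fun z _ => ⟨(z.2.1, z.2.2 + z.1.2), (z.2.2, z.1.2)⟩)
    (fun z _ => ⟨(z.1.1 + z.2.1, z.2.2), (z.1.1, z.2.1)⟩) ?_ ?_ ?_ ?_ ?_
  · rintro ⟨⟨a, b⟩, ⟨c, d⟩⟩ h
    simp only [Finset.mem_sigma, Finset.HasAntidiagonal.mem_antidiagonal] at h ⊢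
    exact ⟨by omega, trivial⟩
  · rintro ⟨⟨a, b⟩, ⟨c, d⟩⟩ h
    simp only [Finset.mem_sigma, Finset.HasAntidiagonal.mem_antidiagonal] at h ⊢
    exact ⟨by omega, trivial⟩
  · rintro ⟨⟨a, b⟩, ⟨c, d⟩⟩ h
    simp only [Finset.mem_sigma, Finset.HasAntidiagonal.mem_antidiagonal] at h
    obtain ⟨h1, rfl⟩ := h
    rfl
  · rintro ⟨⟨a, b⟩, ⟨c, d⟩⟩ h
    simp only [Finset.mem_sigma, Finset.HasAntidiagonal.mem_antidiagonal] at h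
    obtain ⟨h1, rfl⟩ := h
    rfl
  · intros; rfl

variable {R : Type*} [CommRing R]

theorem sum_pow_two_pow (h2 : (2 : R) = 0) {ι : Type*} (s : Finset ι) (f : ι → R) (q : ℕ) :
    (∑ i ∈ s, f i) ^ 2 ^ q = ∑ i ∈ s, f i ^ 2 ^ q := by
  rcases subsingleton_or_nontrivial R with h | h
  · exact Subsingleton.elim _ _
  · have : CharP R 2 := CharTwo.of_one_ne_zero_of_two_eq_zero one_ne_zero h2
    exact sum_pow_char_pow 2 q s f

/-- The sequence `n ↦ ∑_{p + q = n} x_p ^ (2 ^ q) * y_q`. -/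
def conv (x y : ℕ → R) (n : ℕ) : R :=
  ∑ p ∈ Finset.HasAntidiagonal.antidiagonal n, x p.1 ^ 2 ^ p.2 * y p.2

theorem conv_zero (x y : ℕ → R) : conv x y 0 = x 0 * y 0 := by simp [conv]

theorem conv_add (x y z : ℕ → R) (n : ℕ) :
    conv x (fun q => y q + z q) n = conv x y n + conv x z n := by
  simp [conv, mul_add, Finset.sum_add_distrib]

theorem map_conv {S : Type*} [CommRing S] (f : R →+* S) (x y : ℕ → R) (n : ℕ) :
    f (conv x y n) = conv (fun p => f (x p)) (fun q => f (y q)) n := by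
  simp [conv]

theorem conv_assoc (h2 : (2 : R) = 0) (x y z : ℕ → R) (n : ℕ) :
    conv (conv x y) z n = conv x (conv y z) n := by
  have := sum_antidiagonal_assoc
    (fun r l k => x r ^ 2 ^ (l + k) * (y l ^ 2 ^ k * z k)) n
  unfold conv
  refine Eq.trans ?_ (this.trans ?_)
  · refine Finset.sum_congr rfl fun p _ => ?_
    rw [sum_pow_two_pow h2, Finset.sum_mul]
    refine Finset.sum_congr rfl fun q _ => ?_
    rw [mul_pow, ← pow_mul, ← pow_add, mul_assoc]
  · refine Finset.sum_congr rfl fun p _ => ?_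
    rw [Finset.mul_sum]
    refine Finset.sum_congr rfl fun q hq => ?_
    rw [Finset.HasAntidiagonal.mem_antidiagonal.1 hq]

/-- The unit for `conv`. -/
def convOne (n : ℕ) : R := if n = 0 then 1 else 0

theorem convOne_conv (y : ℕ → R) (n : ℕ) : conv convOne y n = y n := by
  unfold conv
  rw [Finset.sum_eq_single (0, n)]
  · simp [convOne]
  · rintro ⟨p, q⟩ h1 h3
    have hp : p ≠ 0 := by
      rintro rfl
      rw [Finset.HasAntidiagonal.mem_antidiagonal] at h1
      simp_all
    simp [convOne, hp]
  · intro h; simp at h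

theorem conv_convOne (x : ℕ → R) (n : ℕ) : conv x convOne n = x n := by
  unfold conv
  rw [Finset.sum_eq_single (n, 0)]
  · simp [convOne]
  · rintro ⟨p, q⟩ h1 h3
    have hp : q ≠ 0 := by
      rintro rfl
      rw [Finset.HasAntidiagonal.mem_antidiagonal] at h1
      simp_all
    simp [convOne, hp]
  · intro h; simp at h

/-- The inverse for `conv` (in characteristic two) of a sequence that starts with `1`. -/
def convInv (x : ℕ → R) : ℕ → R
  | 0 => 1
  | n + 1 => ∑ q : Fin (n + 1), x (n + 1 - q) ^ 2 ^ (q : ℕ) * convInv x q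

theorem conv_convInv (h2 : (2 : R) = 0) {x : ℕ → R} (hx : x 0 = 1) (n : ℕ) :
    conv x (convInv x) n = convOne n := by
  cases n with
  | zero => simp [conv, convOne, convInv, hx]
  | succ n =>
    unfold conv
    rw [← Finset.Nat.sum_antidiagonal_swap, Finset.Nat.sum_antidiagonal_eq_sum_range_succ_mk,
      Finset.sum_range_succ]
    have h : convInv x (n + 1) =
        ∑ q ∈ Finset.range (n + 1), x (n + 1 - q) ^ 2 ^ q * convInv x q := by
      rw [convInv, ← Fin.sum_univ_eq_sum_range (fun q => x (n + 1 - q) ^ 2 ^ q * convInv x q)]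
    simp only [Prod.swap_prod_mk, Nat.sub_self, hx, one_pow, one_mul]
    rw [← h, ← two_mul, h2, zero_mul]
    simp [convOne]

theorem convInv_zero (x : ℕ → R) : convInv x 0 = 1 := by rw [convInv]

theorem eq_of_conv_eq (h2 : (2 : R) = 0) {x y z : ℕ → R} (h1 : ∀ n, conv x y n = convOne n)
    (h3 : ∀ n, conv y z n = convOne n) (n : ℕ) : x n = z n := by
  have e1 : conv x y = convOne := funext h1
  have e2 : conv y z = convOne := funext h3
  rw [← conv_convOne x, ← e2, ← conv_assoc h2, e1, convOne_conv]

theorem convInv_conv (h2 : (2 : R) = 0) {x : ℕ → R} (hx : x 0 = 1) (n : ℕ) :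
    conv (convInv x) x n = convOne n := by
  have h := eq_of_conv_eq h2 (conv_convInv h2 hx)
    (conv_convInv h2 (x := convInv x) (convInv_zero x))
  have e : x = convInv (convInv x) := funext h
  conv_lhs => rw [e]
  conv_lhs => rw [← e]
  nth_rw 2 [e]
  exact conv_convInv h2 (convInv_zero x) n

theorem conv_sq (h2 : (2 : R) = 0) (x y z : ℕ → R) (a s : R)
    (hrel : ∀ q, y q ^ 2 = a * y (q + 1) + s * x (q + 1)) (n : ℕ) :
    conv z y n ^ 2 = a * (conv z y (n + 1) - z (n + 1) * y 0) +
      s * (conv z x (n + 1) - z (n + 1) * x 0) := by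
  have h := sum_pow_two_pow h2 (Finset.HasAntidiagonal.antidiagonal n) (fun p => z p.1 ^ 2 ^ p.2 * y p.2) 1
  rw [pow_one] at h
  unfold conv
  rw [h, Finset.Nat.sum_antidiagonal_succ', Finset.Nat.sum_antidiagonal_succ']
  simp only [pow_zero, pow_one, add_sub_cancel_left, Finset.mul_sum, ← Finset.sum_add_distrib]
  refine Finset.sum_congr rfl fun p _ => ?_
  rw [mul_pow, hrel, ← pow_mul, ← pow_succ]
  ring

end Conv

section Coefficients

/-- The representation ring `RO(ℤ/2) = ℤ ⊕ ℤα`: the pair `(p, q)` stands for `p + qα`. -/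
abbrev RO : Type := ℤ × ℤ

/-- Generators of the coefficient ring: the Euler class `a`, the class `u = σ⁻¹`, and the elements
`θ i j = θ / (a ^ i u ^ j)` of the negative cone. -/
inductive CoeffGen : Type
  | a : CoeffGen
  | u : CoeffGen
  | θ (i j : ℕ) : CoeffGen

/-- `|a| = -α`, `|u| = 1 - α`, `|θ i j| = 2α - 2 + iα + j(α - 1)`. -/
def CoeffGen.deg : CoeffGen → RO
  | a => (0, -1)
  | u => (1, -1)
  | θ i j => (-2 - (j : ℤ), 2 + (i : ℤ) + (j : ℤ))

/-- The relations between the generators of the coefficient ring. -/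
inductive CoeffRel : MvPolynomial CoeffGen (ZMod 2) → Prop
  | a_θ_zero (j : ℕ) : CoeffRel (MvPolynomial.X .a * MvPolynomial.X (.θ 0 j))
  | a_θ_succ (i j : ℕ) :
      CoeffRel (MvPolynomial.X .a * MvPolynomial.X (.θ (i + 1) j) - MvPolynomial.X (.θ i j))
  | u_θ_zero (i : ℕ) : CoeffRel (MvPolynomial.X .u * MvPolynomial.X (.θ i 0))
  | u_θ_succ (i j : ℕ) :
      CoeffRel (MvPolynomial.X .u * MvPolynomial.X (.θ i (j + 1)) - MvPolynomial.X (.θ i j))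
  | θ_θ (i j k l : ℕ) : CoeffRel (MvPolynomial.X (.θ i j) * MvPolynomial.X (.θ k l))

/-- The ideal of relations of the coefficient ring. -/
def coeffIdeal : Ideal (MvPolynomial CoeffGen (ZMod 2)) := Ideal.span {p | CoeffRel p}

/-- The coefficient ring `HF̲_⋆` of `ℤ/2`-equivariant ordinary homology with coefficients in the
constant Mackey functor `F̲₂`: it is `F₂[a, u] ⊕ F₂{θ / (a ^ i u ^ j)}`, where the negative cone
`F₂{θ / (a ^ i u ^ j)}` has square zero. -/
def Coeff : Type := MvPolynomial CoeffGen (ZMod 2) ⧸ coeffIdeal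

instance : CommRing Coeff := inferInstanceAs (CommRing (MvPolynomial CoeffGen (ZMod 2) ⧸ coeffIdeal))

namespace Coeff

/-- The projection from the polynomial ring. -/
def mk : MvPolynomial CoeffGen (ZMod 2) →+* Coeff := Ideal.Quotient.mk coeffIdeal

/-- The `RO(ℤ/2)`-grading of the coefficient ring. -/
def deg : RO → AddSubgroup Coeff := quotDeg (polyDeg (trivialDeg (ZMod 2)) CoeffGen.deg) coeffIdeal

/-- The Euler class. -/
def a : Coeff := mk (MvPolynomial.X .a)

/-- The class `u = σ⁻¹`. -/
def u : Coeff := mk (MvPolynomial.X .u)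

/-- The class `θ / (a ^ i u ^ j)`. -/
def θ (i j : ℕ) : Coeff := mk (MvPolynomial.X (.θ i j))

theorem mk_eq_zero {p : MvPolynomial CoeffGen (ZMod 2)} (h : CoeffRel p) : mk p = 0 :=
  Ideal.Quotient.eq_zero_iff_mem.2 (Ideal.subset_span h)

theorem a_mul_θ_zero (j : ℕ) : a * θ 0 j = 0 := by
  have := mk_eq_zero (.a_θ_zero j)
  rwa [map_mul] at this

theorem a_mul_θ_succ (i j : ℕ) : a * θ (i + 1) j = θ i j := by
  have := mk_eq_zero (.a_θ_succ i j)
  rwa [map_sub, map_mul, sub_eq_zero] at this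

theorem u_mul_θ_zero (i : ℕ) : u * θ i 0 = 0 := by
  have := mk_eq_zero (.u_θ_zero i)
  rwa [map_mul] at this

theorem u_mul_θ_succ (i j : ℕ) : u * θ i (j + 1) = θ i j := by
  have := mk_eq_zero (.u_θ_succ i j)
  rwa [map_sub, map_mul, sub_eq_zero] at this

theorem θ_mul_θ (i j k l : ℕ) : θ i j * θ k l = 0 := by
  have := mk_eq_zero (.θ_θ i j k l)
  rwa [map_mul] at this

theorem two_eq_zero : (2 : Coeff) = 0 := by
  have h : ((2 : ZMod 2)) = 0 := by decide
  have := congrArg (mk.comp MvPolynomial.C) h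
  rwa [map_ofNat, map_zero] at this

theorem map_two {R : Type*} [CommRing R] (φ : Coeff →+* R) : (2 : R) = 0 := by
  have := congrArg φ two_eq_zero
  rwa [map_ofNat, map_zero] at this

theorem ringHom_ext {R : Type*} [CommRing R] {f g : Coeff →+* R} (ha : f a = g a) (hu : f u = g u)
    (hθ : ∀ i j, f (θ i j) = g (θ i j)) : f = g := by
  refine Ideal.Quotient.ringHom_ext (MvPolynomial.ringHom_ext' ?_ ?_)
  · exact RingHom.ext_zmod _ _
  · rintro (_ | _ | ⟨i, j⟩)
    · exact ha
    · exact hu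
    · exact hθ i j

section Translate
variable {R : Type*} [CommRing R] (φ : Coeff →+* R) (x : R)

/-- The values on the generators of the map `translate` below. -/
def translateGen : CoeffGen → R
  | .a => φ a
  | .u => φ u + φ a * x
  | .θ i j => ∑ p ∈ Finset.HasAntidiagonal.antidiagonal i,
      ((j + p.2).choose p.2 : R) * φ (θ p.1 (j + p.2)) * x ^ p.2

theorem translate_rel {p : MvPolynomial CoeffGen (ZMod 2)} (h : CoeffRel p) :
    MvPolynomial.eval₂Hom ((φ.comp mk).comp MvPolynomial.C) (translateGen φ x) p = 0 := by
  have h2 := map_two φ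
  have a0 : ∀ j, φ a * φ (θ 0 j) = 0 := fun j => by rw [← map_mul, a_mul_θ_zero, map_zero]
  have aS : ∀ i j, φ a * φ (θ (i + 1) j) = φ (θ i j) := fun i j => by rw [← map_mul, a_mul_θ_succ]
  have u0 : ∀ i, φ u * φ (θ i 0) = 0 := fun j => by rw [← map_mul, u_mul_θ_zero, map_zero]
  have uS : ∀ i j, φ u * φ (θ i (j + 1)) = φ (θ i j) := fun i j => by rw [← map_mul, u_mul_θ_succ]
  have θθ : ∀ i j k l, φ (θ i j) * φ (θ k l) = 0 := fun i j k l => by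
    rw [← map_mul, θ_mul_θ, map_zero]
  -- multiplication by `a` lowers the first index
  have key : ∀ (i : ℕ) (F : ℕ → R) (k : ℕ → ℕ),
      φ a * ∑ p ∈ Finset.HasAntidiagonal.antidiagonal (i + 1), F p.2 * φ (θ p.1 (k p.2)) =
        ∑ p ∈ Finset.HasAntidiagonal.antidiagonal i, F p.2 * φ (θ p.1 (k p.2)) := by
    intro i F k
    rw [Finset.Nat.sum_antidiagonal_succ, mul_add, Finset.mul_sum]
    rw [mul_left_comm, a0, mul_zero, zero_add]
    refine Finset.sum_congr rfl fun p _ => ?_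
    rw [mul_left_comm, aS]
  have hθ : ∀ i j, translateGen φ x (.θ i j) = ∑ p ∈ Finset.HasAntidiagonal.antidiagonal i,
      (((j + p.2).choose p.2 : R) * x ^ p.2) * φ (θ p.1 (j + p.2)) := fun i j =>
    Finset.sum_congr rfl fun p _ => by ring
  cases h with
  | a_θ_zero j =>
    simp only [map_mul, MvPolynomial.coe_eval₂Hom, MvPolynomial.eval₂_X]
    simp [translateGen, a0]
  | a_θ_succ i j =>
    simp only [map_sub, map_mul, MvPolynomial.coe_eval₂Hom, MvPolynomial.eval₂_X]
    rw [hθ, hθ, sub_eq_zero]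
    exact key i (fun q => ((j + q).choose q : R) * x ^ q) (fun q => j + q)
  | u_θ_zero i =>
    simp only [map_mul, MvPolynomial.coe_eval₂Hom, MvPolynomial.eval₂_X]
    rw [hθ]
    simp only [zero_add, Nat.choose_self, Nat.cast_one, one_mul]
    change (φ u + φ a * x) * _ = 0
    cases i with
    | zero =>
      simp only [Finset.Nat.antidiagonal_zero, Finset.sum_singleton, pow_zero, one_mul]
      linear_combination u0 0 + x * a0 0
    | succ i =>
      have e1 := key i (fun q => x ^ q) (fun q => q)
      have e2 : φ u * ∑ p ∈ Finset.HasAntidiagonal.antidiagonal (i + 1),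
          x ^ p.2 * φ (θ p.1 p.2) =
          x * ∑ p ∈ Finset.HasAntidiagonal.antidiagonal i, x ^ p.2 * φ (θ p.1 p.2) := by
        rw [Finset.Nat.sum_antidiagonal_succ', mul_add, Finset.mul_sum, Finset.mul_sum]
        rw [mul_left_comm, u0, mul_zero, zero_add]
        refine Finset.sum_congr rfl fun p _ => ?_
        rw [mul_left_comm, uS]
        ring
      linear_combination e2 + x * e1 +
        x * (∑ p ∈ Finset.HasAntidiagonal.antidiagonal i, x ^ p.2 * φ (θ p.1 p.2)) * h2
  | u_θ_succ i j =>
    simp only [map_sub, map_mul, MvPolynomial.coe_eval₂Hom, MvPolynomial.eval₂_X]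
    rw [hθ, hθ, sub_eq_zero]
    change (φ u + φ a * x) * _ = _
    have e2 : φ u * ∑ p ∈ Finset.HasAntidiagonal.antidiagonal i,
          (((j + 1 + p.2).choose p.2 : R) * x ^ p.2) * φ (θ p.1 (j + 1 + p.2)) =
        ∑ p ∈ Finset.HasAntidiagonal.antidiagonal i,
          (((j + 1 + p.2).choose p.2 : R) * x ^ p.2) * φ (θ p.1 (j + p.2)) := by
      rw [Finset.mul_sum]
      refine Finset.sum_congr rfl fun p _ => ?_
      rw [mul_left_comm, show j + 1 + p.2 = j + p.2 + 1 by ring, uS]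
    cases i with
    | zero =>
      rw [add_mul, e2]
      simp only [Finset.Nat.antidiagonal_zero, Finset.sum_singleton, pow_zero, add_zero,
        Nat.choose_zero_right, Nat.cast_one, one_mul]
      linear_combination x * a0 (j + 1)
    | succ i =>
      have e1 := key i (fun q => ((j + 1 + q).choose q : R) * x ^ q) (fun q => j + 1 + q)
      rw [add_mul, e2, mul_right_comm, e1, Finset.Nat.sum_antidiagonal_succ',
        Finset.Nat.sum_antidiagonal_succ', add_assoc, Finset.sum_mul, ← Finset.sum_add_distrib]
      congr 1
      · simp
      · refine Finset.sum_congr rfl fun p _ => ?_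
        have hp : ((j + 1 + (p.2 + 1)).choose (p.2 + 1) : R) =
            (j + 1 + p.2).choose p.2 + (j + (p.2 + 1)).choose (p.2 + 1) := by
          rw [← Nat.cast_add, show j + 1 + (p.2 + 1) = (j + 1 + p.2) + 1 by ring,
            Nat.choose_succ_succ, show j + (p.2 + 1) = j + 1 + p.2 by ring]
        rw [hp, show j + (p.2 + 1) = j + 1 + p.2 by ring]
        linear_combination ((j + 1 + p.2).choose p.2 : R) * x ^ (p.2 + 1) *
          φ (θ p.1 (j + 1 + p.2)) * h2
  | θ_θ i j k l =>
    simp only [map_mul, MvPolynomial.coe_eval₂Hom, MvPolynomial.eval₂_X]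
    rw [hθ, hθ, Finset.sum_mul_sum]
    refine Finset.sum_eq_zero fun p _ => Finset.sum_eq_zero fun q _ => ?_
    rw [mul_mul_mul_comm, θθ, mul_zero]

/-- The ring map that agrees with `φ` on `a`, maps `u` to `φ u + φ a * x`, and maps the element
`θ / (a ^ i u ^ j)` to `∑_k C(j + k, k) φ(θ / (a ^ (i - k) u ^ (j + k))) x ^ k`, the expansion of
`θ u / (a ^ i (u + a x) ^ (j + 1))`. -/
def translate : Coeff →+* R :=
  Ideal.Quotient.lift coeffIdeal
    (MvPolynomial.eval₂Hom ((φ.comp mk).comp MvPolynomial.C) (translateGen φ x))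
    (fun p hp => by
      have : coeffIdeal ≤ RingHom.ker
          (MvPolynomial.eval₂Hom ((φ.comp mk).comp MvPolynomial.C) (translateGen φ x)) :=
        Ideal.span_le.2 fun q hq => translate_rel φ x hq
      exact this hp)

theorem translate_mk_X (s : CoeffGen) :
    translate φ x (mk (MvPolynomial.X s)) = translateGen φ x s :=
  MvPolynomial.eval₂_X _ _ _

theorem translate_a : translate φ x a = φ a := translate_mk_X φ x .a
theorem translate_u : translate φ x u = φ u + φ a * x := translate_mk_X φ x .u
theorem translate_θ (i j : ℕ) : translate φ x (θ i j) =
    ∑ p ∈ Finset.HasAntidiagonal.antidiagonal i,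
      ((j + p.2).choose p.2 : R) * φ (θ p.1 (j + p.2)) * x ^ p.2 := translate_mk_X φ x (.θ i j)

theorem translate_zero : translate φ 0 = φ := by
  refine ringHom_ext (translate_a φ 0) (by rw [translate_u, mul_zero, add_zero]) fun i j => ?_
  rw [translate_θ, Finset.sum_eq_single (i, 0)]
  · simp
  · rintro ⟨p, q⟩ h1 h3
    have hq : q ≠ 0 := by
      rintro rfl
      rw [Finset.HasAntidiagonal.mem_antidiagonal] at h1
      simp_all
    simp [hq]
  · intro h; simp at h

theorem translate_translate (y : R) : translate (translate φ x) y = translate φ (x + y) := by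
  refine ringHom_ext ?_ ?_ fun i j => ?_
  · rw [translate_a, translate_a, translate_a]
  · rw [translate_u, translate_u, translate_u, translate_a]
    ring
  · rw [translate_θ, translate_θ]
    have := sum_antidiagonal_assoc (fun r l k => ((j + k).choose k : R) *
      (((j + k + l).choose l : R) * φ (θ r (j + k + l)) * x ^ l) * y ^ k) i
    refine Eq.trans ?_ (this.trans ?_)
    · refine Finset.sum_congr rfl fun p _ => ?_
      rw [translate_θ, Finset.mul_sum, Finset.sum_mul]
    · refine Finset.sum_congr rfl fun p _ => ?_
      rw [(Commute.all x y).add_pow', Finset.mul_sum]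
      refine Finset.sum_congr rfl fun q hq => ?_
      rw [Finset.HasAntidiagonal.mem_antidiagonal] at hq
      rw [← hq, show j + q.2 + q.1 = j + (q.1 + q.2) by ring, nsmul_eq_mul]
      have hc : ((j + q.2).choose q.2 : R) * ((j + (q.1 + q.2)).choose q.1 : R) =
          ((j + (q.1 + q.2)).choose (q.1 + q.2) : R) * ((q.1 + q.2).choose q.1 : R) := by
        rw [← Nat.cast_mul, ← Nat.cast_mul, Nat.choose_mul (Nat.le_add_right _ _), mul_comm]
        congr 3 <;> omega
      linear_combination φ (θ p.1 (j + (q.1 + q.2))) * x ^ q.1 * y ^ q.2 * hc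

theorem comp_translate {S : Type*} [CommRing S] (f : R →+* S) :
    f.comp (translate φ x) = translate (f.comp φ) (f x) := by
  refine ringHom_ext ?_ ?_ fun i j => ?_
  · rw [RingHom.comp_apply, translate_a, translate_a]; rfl
  · rw [RingHom.comp_apply, translate_u, translate_u]; simp
  · rw [RingHom.comp_apply, translate_θ, translate_θ]; simp

end Translate

theorem isHomogeneous_coeffIdeal :
    IsHomogeneousIdeal (polyDeg (trivialDeg (ZMod 2)) CoeffGen.deg) coeffIdeal := by
  have := ((isGrading_trivialDeg (G := RO) (ZMod 2)).polyDeg CoeffGen.deg).gradedMonoid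
  have hX : ∀ s, (MvPolynomial.X s : MvPolynomial CoeffGen (ZMod 2)) ∈
      polyDeg (trivialDeg (ZMod 2)) CoeffGen.deg (CoeffGen.deg s) := fun s => by
    have h := polyDeg_monomial (𝓇 := trivialDeg (ZMod 2)) CoeffGen.deg (V := (0 : RO))
      (r := 1) (by simp [trivialDeg]) (Finsupp.single s 1)
    rw [zero_add, Finsupp.weight_single, one_smul] at h
    exact h
  refine ⟨_, ?_, rfl⟩
  rintro _ (j | ⟨i, j⟩ | i | ⟨i, j⟩ | ⟨i, j, k, l⟩)
  · exact ⟨_, SetLike.GradedMul.mul_mem (hX _) (hX _)⟩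
  · refine ⟨CoeffGen.deg (.θ i j), sub_mem ?_ (hX _)⟩
    have := SetLike.GradedMul.mul_mem (hX .a) (hX (.θ (i + 1) j))
    convert this using 2
    ext <;> simp [CoeffGen.deg] <;> ring
  · exact ⟨_, SetLike.GradedMul.mul_mem (hX _) (hX _)⟩
  · refine ⟨CoeffGen.deg (.θ i j), sub_mem ?_ (hX _)⟩
    have := SetLike.GradedMul.mul_mem (hX .u) (hX (.θ i (j + 1)))
    convert this using 2
    ext <;> simp [CoeffGen.deg] <;> ring
  · exact ⟨_, SetLike.GradedMul.mul_mem (hX _) (hX _)⟩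

theorem isGrading_deg : IsGrading deg :=
  ((isGrading_trivialDeg (ZMod 2)).polyDeg CoeffGen.deg).quotDeg isHomogeneous_coeffIdeal

theorem map_mem {T : Type*} [CommRing T] {𝓉 : RO → AddSubgroup T} [SetLike.GradedMonoid 𝓉]
    (f : Coeff →+* T) (hf : ∀ s, f (mk (MvPolynomial.X s)) ∈ 𝓉 (CoeffGen.deg s)) {V : RO}
    {h : Coeff} (hh : h ∈ deg V) : f h ∈ 𝓉 V := by
  obtain ⟨p, hp, rfl⟩ := hh
  refine map_polyDeg_mem (f.comp mk) (fun W r hr => ?_) hf hp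
  by_cases hW : W = 0
  · subst hW
    obtain ⟨n, rfl⟩ := ZMod.natCast_zmod_surjective r
    rw [map_natCast, map_natCast]
    exact SetLike.natCast_mem_graded 𝓉 n
  · have : r = 0 := by simpa [trivialDeg, hW] using hr
    rw [this, map_zero, map_zero]
    exact zero_mem _

theorem mk_X_mem (s : CoeffGen) : mk (MvPolynomial.X s) ∈ deg (CoeffGen.deg s) := by
  refine ⟨MvPolynomial.X s, ?_, rfl⟩
  have h := polyDeg_monomial (𝓇 := trivialDeg (ZMod 2)) CoeffGen.deg (V := (0 : RO))
    (r := 1) (by simp [trivialDeg]) (Finsupp.single s 1)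
  rw [zero_add, Finsupp.weight_single, one_smul] at h
  exact h

theorem translate_mem {T : Type*} [CommRing T] {𝓉 : RO → AddSubgroup T} [SetLike.GradedMonoid 𝓉]
    (φ : Coeff →+* T) (hφ : ∀ V, ∀ h ∈ deg V, φ h ∈ 𝓉 V) {x : T} (hx : x ∈ 𝓉 (1, 0)) {V : RO}
    {h : Coeff} (hh : h ∈ deg V) : translate φ x h ∈ 𝓉 V := by
  refine map_mem _ (fun s => ?_) hh
  rw [translate_mk_X]
  have hg : ∀ s, φ (mk (MvPolynomial.X s)) ∈ 𝓉 (CoeffGen.deg s) := fun s => hφ _ _ (mk_X_mem s)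
  rcases s with _ | _ | ⟨i, j⟩
  · exact hg .a
  · refine add_mem (hg .u) ?_
    have := SetLike.GradedMul.mul_mem (hg .a) hx
    exact this
  · refine sum_mem fun p hp => ?_
    rw [Finset.HasAntidiagonal.mem_antidiagonal] at hp
    have h1 := SetLike.GradedMul.mul_mem (SetLike.GradedMul.mul_mem
      (SetLike.natCast_mem_graded 𝓉 ((j + p.2).choose p.2)) (hg (.θ p.1 (j + p.2))))
      (SetLike.pow_mem_graded p.2 hx)
    have e : CoeffGen.deg (.θ i j) =
        0 + CoeffGen.deg (.θ p.1 (j + p.2)) + p.2 • ((1, 0) : RO) := by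
      rw [← hp]
      ext <;> simp [CoeffGen.deg] <;> ring
    rw [e]
    exact h1

end Coeff
end Coefficients

section Steenrod

/-- Polynomial generators of the dual Steenrod algebra over the coefficient ring; `ξ i` is the
generator `ξ_{i+1}`. -/
inductive SteenrodGen : Type
  | τ (i : ℕ) : SteenrodGen
  | ξ (i : ℕ) : SteenrodGen

/-- `|τ_i| = 2 ^ i (1 + α) - α` and `|ξ_i| = (2 ^ i - 1)(1 + α)`. -/
def SteenrodGen.deg : SteenrodGen → RO
  | τ i => (2 ^ i, 2 ^ i - 1)
  | ξ i => (2 ^ (i + 1) - 1, 2 ^ (i + 1) - 1)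

/-- The ideal of the relations `τ_i ^ 2 = a τ_{i+1} + (u + a τ_0) ξ_{i+1}`. -/
def steenrodIdeal : Ideal (MvPolynomial SteenrodGen Coeff) :=
  Ideal.span (Set.range fun i : ℕ =>
    MvPolynomial.X (.τ i) ^ 2 - (MvPolynomial.C Coeff.a * MvPolynomial.X (.τ (i + 1)) +
      (MvPolynomial.C Coeff.u + MvPolynomial.C Coeff.a * MvPolynomial.X (.τ 0)) *
        MvPolynomial.X (.ξ i)))

/-- The `ℤ/2`-equivariant dual Steenrod algebra
`A_⋆ = HF̲_⋆[τ_i, ξ_{i+1} | i ≥ 0] / (τ_i ^ 2 = a τ_{i+1} + (u + a τ_0) ξ_{i+1})`. -/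
def DualSteenrod : Type := MvPolynomial SteenrodGen Coeff ⧸ steenrodIdeal

instance : CommRing DualSteenrod :=
  inferInstanceAs (CommRing (MvPolynomial SteenrodGen Coeff ⧸ steenrodIdeal))

/-- The left unit of the dual Steenrod algebra is the inclusion of the coefficients. -/
instance : Algebra Coeff DualSteenrod :=
  inferInstanceAs (Algebra Coeff (MvPolynomial SteenrodGen Coeff ⧸ steenrodIdeal))

namespace DualSteenrod

/-- The projection from the polynomial ring. -/
def mk : MvPolynomial SteenrodGen Coeff →+* DualSteenrod := Ideal.Quotient.mk steenrodIdeal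

theorem mk_C (h : Coeff) : mk (MvPolynomial.C h) = algebraMap Coeff DualSteenrod h := rfl

/-- The `RO(ℤ/2)`-grading of the dual Steenrod algebra. -/
def deg : RO → AddSubgroup DualSteenrod := quotDeg (polyDeg Coeff.deg SteenrodGen.deg) steenrodIdeal

/-- The class `τ_i`. -/
def τ (i : ℕ) : DualSteenrod := mk (MvPolynomial.X (.τ i))

/-- The class `ξ_i`, with `ξ_0 = 1`. -/
def ξ : ℕ → DualSteenrod
  | 0 => 1
  | i + 1 => mk (MvPolynomial.X (.ξ i))

theorem τ_sq (i : ℕ) : τ i ^ 2 = algebraMap _ _ Coeff.a * τ (i + 1) +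
    (algebraMap _ _ Coeff.u + algebraMap _ _ Coeff.a * τ 0) * ξ (i + 1) := by
  have h : mk (MvPolynomial.X (.τ i) ^ 2 -
      (MvPolynomial.C Coeff.a * MvPolynomial.X (.τ (i + 1)) +
      (MvPolynomial.C Coeff.u + MvPolynomial.C Coeff.a * MvPolynomial.X (.τ 0)) *
        MvPolynomial.X (.ξ i))) = 0 :=
    Ideal.Quotient.eq_zero_iff_mem.2 (Ideal.subset_span ⟨i, rfl⟩)
  rw [map_sub, sub_eq_zero] at h
  simp only [map_pow, map_add, map_mul, mk_C] at h
  exact h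

theorem two_eq_zero : (2 : DualSteenrod) = 0 := Coeff.map_two (algebraMap _ _)

section Lift
variable {R : Type*} [CommRing R] (φ : Coeff →+* R) (t x : ℕ → R)

/-- The values of `lift` on the generators. -/
def liftGen : SteenrodGen → R
  | .τ i => t i
  | .ξ i => x (i + 1)

/-- The ring map out of the dual Steenrod algebra with given values on the coefficients, on the
`τ_i` and on the `ξ_{i+1}`. -/
def lift (h : ∀ i, t i ^ 2 = φ Coeff.a * t (i + 1) + (φ Coeff.u + φ Coeff.a * t 0) * x (i + 1)) :
    DualSteenrod →+* R :=
  Ideal.Quotient.lift steenrodIdeal (MvPolynomial.eval₂Hom φ (liftGen t x)) (fun p hp => by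
    have : steenrodIdeal ≤ RingHom.ker (MvPolynomial.eval₂Hom φ (liftGen t x)) := by
      refine Ideal.span_le.2 ?_
      rintro _ ⟨i, rfl⟩
      rw [SetLike.mem_coe, RingHom.mem_ker, map_sub, sub_eq_zero]
      simpa [liftGen] using h i
    exact this hp)

variable (h : ∀ i, t i ^ 2 = φ Coeff.a * t (i + 1) + (φ Coeff.u + φ Coeff.a * t 0) * x (i + 1))

@[simp] theorem lift_mk_X (s : SteenrodGen) :
    lift φ t x h (mk (MvPolynomial.X s)) = liftGen t x s := MvPolynomial.eval₂_X _ _ _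

@[simp] theorem lift_algebraMap (r : Coeff) : lift φ t x h (algebraMap _ _ r) = φ r :=
  MvPolynomial.eval₂_C _ _ _

@[simp] theorem lift_τ (i : ℕ) : lift φ t x h (τ i) = t i := lift_mk_X φ t x h (.τ i)

theorem lift_ξ (hx : x 0 = 1) (i : ℕ) : lift φ t x h (ξ i) = x i := by
  cases i with
  | zero => rw [hx]; exact map_one _
  | succ i => exact lift_mk_X φ t x h (.ξ i)

theorem ringHom_ext {f g : DualSteenrod →+* R}
    (hH : ∀ r : Coeff, f (algebraMap _ _ r) = g (algebraMap _ _ r)) (hτ : ∀ i, f (τ i) = g (τ i))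
    (hξ : ∀ i, f (ξ i) = g (ξ i)) : f = g := by
  refine Ideal.Quotient.ringHom_ext (MvPolynomial.ringHom_ext' (RingHom.ext hH) ?_)
  rintro (i | i)
  · exact hτ i
  · exact hξ (i + 1)

theorem map_mem {𝓉 : RO → AddSubgroup R} [SetLike.GradedMonoid 𝓉] (f : DualSteenrod →+* R)
    (hH : ∀ V, ∀ r ∈ Coeff.deg V, f (algebraMap _ _ r) ∈ 𝓉 V)
    (hτ : ∀ i, f (τ i) ∈ 𝓉 (2 ^ i, 2 ^ i - 1))
    (hξ : ∀ i, f (ξ i) ∈ 𝓉 (2 ^ i - 1, 2 ^ i - 1)) {V : RO}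
    {a : DualSteenrod} (ha : a ∈ deg V) : f a ∈ 𝓉 V := by
  obtain ⟨p, hp, rfl⟩ := ha
  refine map_polyDeg_mem (f.comp mk) hH ?_ hp
  rintro (i | i)
  · exact hτ i
  · exact hξ (i + 1)

end Lift

theorem mk_X_mem (s : SteenrodGen) : mk (MvPolynomial.X s) ∈ deg (SteenrodGen.deg s) := by
  have := Coeff.isGrading_deg.gradedMonoid
  refine ⟨MvPolynomial.X s, ?_, rfl⟩
  have h := polyDeg_monomial (𝓇 := Coeff.deg) SteenrodGen.deg (V := (0 : RO))
    (r := 1) SetLike.GradedOne.one_mem (Finsupp.single s 1)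
  rw [zero_add, Finsupp.weight_single, one_smul] at h
  exact h

theorem isHomogeneous_steenrodIdeal :
    IsHomogeneousIdeal (polyDeg Coeff.deg SteenrodGen.deg) steenrodIdeal := by
  have := Coeff.isGrading_deg.gradedMonoid
  have := (Coeff.isGrading_deg.polyDeg SteenrodGen.deg).gradedMonoid
  have hX : ∀ s, (MvPolynomial.X s : MvPolynomial SteenrodGen Coeff) ∈
      polyDeg Coeff.deg SteenrodGen.deg (SteenrodGen.deg s) := fun s => by
    have h := polyDeg_monomial (𝓇 := Coeff.deg) SteenrodGen.deg (V := (0 : RO))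
      (r := 1) SetLike.GradedOne.one_mem (Finsupp.single s 1)
    rw [zero_add, Finsupp.weight_single, one_smul] at h
    exact h
  have hC : ∀ V, ∀ r ∈ Coeff.deg V, (MvPolynomial.C r : MvPolynomial SteenrodGen Coeff) ∈
      polyDeg Coeff.deg SteenrodGen.deg V := fun V r hr => by
    have h := polyDeg_monomial (𝓇 := Coeff.deg) SteenrodGen.deg hr 0
    rw [map_zero, add_zero] at h
    exact h
  have ha := hC _ _ (Coeff.mk_X_mem .a)
  have hu := hC _ _ (Coeff.mk_X_mem .u)
  refine ⟨_, ?_, rfl⟩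
  rintro _ ⟨i, rfl⟩
  refine ⟨2 • SteenrodGen.deg (.τ i), sub_mem (SetLike.pow_mem_graded 2 (hX _)) (add_mem ?_ ?_)⟩
  · have h1 := SetLike.GradedMul.mul_mem ha (hX (.τ (i + 1)))
    have e : 2 • SteenrodGen.deg (.τ i) = CoeffGen.deg .a + SteenrodGen.deg (.τ (i + 1)) := by
      ext <;> simp [CoeffGen.deg, SteenrodGen.deg] <;> ring
    rw [e]
    exact h1
  · have h0 := SetLike.GradedMul.mul_mem ha (hX (.τ 0))
    have h1 := SetLike.GradedMul.mul_mem (add_mem hu h0) (hX (.ξ i))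
    have e : 2 • SteenrodGen.deg (.τ i) = CoeffGen.deg .u + SteenrodGen.deg (.ξ i) := by
      ext <;> simp [CoeffGen.deg, SteenrodGen.deg] <;> ring
    rw [e]
    exact h1

theorem isGrading_deg : IsGrading deg :=
  (Coeff.isGrading_deg.polyDeg SteenrodGen.deg).quotDeg isHomogeneous_steenrodIdeal

instance : SetLike.GradedMonoid deg := isGrading_deg.gradedMonoid

theorem algebraMap_mem {V : RO} {h : Coeff} (hh : h ∈ Coeff.deg V) :
    algebraMap Coeff DualSteenrod h ∈ deg V := by
  refine ⟨MvPolynomial.C h, ?_, rfl⟩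
  have h := polyDeg_monomial (𝓇 := Coeff.deg) SteenrodGen.deg hh 0
  rw [map_zero, add_zero] at h
  exact h

theorem τ_mem (i : ℕ) : τ i ∈ deg (2 ^ i, 2 ^ i - 1) := mk_X_mem (.τ i)

theorem ξ_mem (i : ℕ) : ξ i ∈ deg (2 ^ i - 1, 2 ^ i - 1) := by
  cases i with
  | zero => exact SetLike.GradedOne.one_mem
  | succ i => exact mk_X_mem (.ξ i)

theorem conv_mem {R : Type*} [CommRing R] {𝓉 : RO → AddSubgroup R} [SetLike.GradedMonoid 𝓉]
    {x y : ℕ → R} {δ : RO} (hx : ∀ n, x n ∈ 𝓉 (2 ^ n - 1, 2 ^ n - 1))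
    (hy : ∀ n, y n ∈ 𝓉 ((2 ^ n, 2 ^ n) + δ)) (n : ℕ) : conv x y n ∈ 𝓉 ((2 ^ n, 2 ^ n) + δ) := by
  refine sum_mem fun p hp => ?_
  rw [Finset.HasAntidiagonal.mem_antidiagonal] at hp
  have h := SetLike.GradedMul.mul_mem (SetLike.pow_mem_graded (2 ^ p.2) (hx p.1)) (hy p.2)
  have e : ((2 ^ n, 2 ^ n) + δ : RO) =
      (2 ^ p.2) • ((2 ^ p.1 - 1, 2 ^ p.1 - 1) : RO) + ((2 ^ p.2, 2 ^ p.2) + δ) := by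
    rw [← hp]
    ext <;> simp <;> ring
  rw [e]
  exact h

/-- The right unit: `a ↦ a`, `u ↦ u + a τ_0`. -/
def ηR : Coeff →+* DualSteenrod := Coeff.translate (algebraMap _ _) (τ 0)

theorem ηR_a : ηR Coeff.a = algebraMap _ _ Coeff.a := Coeff.translate_a _ _
theorem ηR_u : ηR Coeff.u = algebraMap _ _ Coeff.u + algebraMap _ _ Coeff.a * τ 0 :=
  Coeff.translate_u _ _

/-- The counit: `τ_i ↦ 0`, `ξ_{i+1} ↦ 0`. -/
def ε : DualSteenrod →+* Coeff :=
  lift (RingHom.id _) (fun _ => 0) convOne (fun i => by simp [convOne])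

theorem inr_algebraMap_a : BiTensor.inr ηR (algebraMap Coeff DualSteenrod Coeff.a) =
    BiTensor.inl ηR DualSteenrod (algebraMap _ _ Coeff.a) := by
  rw [← BiTensor.inl_ηR, ηR_a]

theorem inr_algebraMap_u : BiTensor.inr ηR (algebraMap Coeff DualSteenrod Coeff.u) =
    BiTensor.inl ηR DualSteenrod (algebraMap _ _ Coeff.u) +
      BiTensor.inl ηR DualSteenrod (algebraMap _ _ Coeff.a) * BiTensor.inl ηR _ (τ 0) := by
  rw [← BiTensor.inl_ηR, ηR_u, map_add, map_mul]

theorem tensor_two_eq_zero : (2 : BiTensor ηR DualSteenrod) = 0 :=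
  Coeff.map_two ((BiTensor.inl ηR DualSteenrod).comp (algebraMap _ _))

/-- The coproduct: `ξ_n ↦ ∑_{i + j = n} ξ_i ^ (2 ^ j) ⊗ ξ_j` and
`τ_n ↦ ∑_{i + j = n} ξ_i ^ (2 ^ j) ⊗ τ_j + τ_n ⊗ 1`. -/
def Δ : DualSteenrod →+* BiTensor ηR DualSteenrod :=
  lift ((BiTensor.inl ηR DualSteenrod).comp (algebraMap _ _))
    (fun n => conv (fun p => BiTensor.inl ηR DualSteenrod (ξ p)) (fun q => BiTensor.inr ηR (τ q)) n
      + BiTensor.inl ηR DualSteenrod (τ n))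
    (conv (fun p => BiTensor.inl ηR DualSteenrod (ξ p)) (fun q => BiTensor.inr ηR (ξ q)))
    (fun i => by
      have h2 := tensor_two_eq_zero
      have h1 := conv_sq h2 (fun q => BiTensor.inr ηR (ξ q)) (fun q => BiTensor.inr ηR (τ q))
        (fun p => BiTensor.inl ηR DualSteenrod (ξ p))
        (BiTensor.inr ηR (algebraMap Coeff DualSteenrod Coeff.a))
        (BiTensor.inr ηR (algebraMap Coeff DualSteenrod Coeff.u +
          algebraMap Coeff DualSteenrod Coeff.a * τ 0))
        (fun q => by rw [← map_pow, τ_sq, map_add, map_mul, map_mul]) i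
      have h3 := congrArg (BiTensor.inl ηR DualSteenrod) (τ_sq i)
      simp only [map_pow, map_add, map_mul, inr_algebraMap_a, inr_algebraMap_u,
        show ξ 0 = 1 from rfl, map_one] at h1 h3
      simp only [RingHom.comp_apply, conv_zero, show ξ 0 = 1 from rfl, map_one, one_mul]
      linear_combination h1 + h3 +
        (conv (fun p => BiTensor.inl ηR DualSteenrod (ξ p)) (fun q => BiTensor.inr ηR (τ q)) i *
          BiTensor.inl ηR DualSteenrod (τ i) -
          BiTensor.inl ηR DualSteenrod (algebraMap _ _ Coeff.a) * BiTensor.inr ηR (τ 0) *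
            BiTensor.inl ηR DualSteenrod (ξ (i + 1))) * h2)

theorem Δ_algebraMap (h : Coeff) :
    Δ (algebraMap _ _ h) = BiTensor.inl ηR DualSteenrod (algebraMap _ _ h) :=
  lift_algebraMap _ _ _ _ h

theorem Δ_τ (n : ℕ) : Δ (τ n) =
    conv (fun p => BiTensor.inl ηR DualSteenrod (ξ p)) (fun q => BiTensor.inr ηR (τ q)) n
      + BiTensor.inl ηR DualSteenrod (τ n) := lift_τ _ _ _ _ n

theorem Δ_ξ (n : ℕ) : Δ (ξ n) =
    conv (fun p => BiTensor.inl ηR DualSteenrod (ξ p)) (fun q => BiTensor.inr ηR (ξ q)) n :=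
  lift_ξ _ _ _ _ (by simp [conv_zero, show ξ 0 = 1 from rfl]) n

/-- The antipode, determined by `∑_{i + j = n} ξ_i ^ (2 ^ j) c(ξ_j) = 0` for `n > 0` and by
`∑_{i + j = n} ξ_i ^ (2 ^ j) c(τ_j) + τ_n = 0`. -/
def c : DualSteenrod →+* DualSteenrod :=
  lift ηR (conv (convInv ξ) τ) (convInv ξ) (fun i => by
    have h2 := two_eq_zero
    have h1 := conv_sq h2 ξ τ (convInv ξ) (algebraMap Coeff DualSteenrod Coeff.a)
      (algebraMap Coeff DualSteenrod Coeff.u + algebraMap Coeff DualSteenrod Coeff.a * τ 0) τ_sq i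
    rw [convInv_conv h2 rfl] at h1
    rw [ηR_a, ηR_u, conv_zero, convInv_zero]
    simp only [convOne, Nat.add_eq_zero_iff, one_ne_zero, and_false, if_false,
      show ξ 0 = 1 from rfl] at h1
    linear_combination h1 - ((algebraMap Coeff DualSteenrod Coeff.u) +
      2 * algebraMap Coeff DualSteenrod Coeff.a * τ 0) * convInv ξ (i + 1) * h2)

theorem c_algebraMap (h : Coeff) : c (algebraMap _ _ h) = ηR h := lift_algebraMap _ _ _ _ h
theorem c_τ (n : ℕ) : c (τ n) = conv (convInv ξ) τ n := lift_τ _ _ _ _ n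
theorem c_ξ (n : ℕ) : c (ξ n) = convInv ξ n := lift_ξ _ _ _ _ (convInv_zero _) n

theorem ε_algebraMap (h : Coeff) : ε (algebraMap _ _ h) = h := lift_algebraMap _ _ _ _ h
theorem ε_τ (n : ℕ) : ε (τ n) = 0 := lift_τ _ _ _ _ n
theorem ε_ξ (n : ℕ) : ε (ξ n) = convOne n := lift_ξ _ _ _ _ rfl n

theorem ηR_mem {V : RO} {h : Coeff} (hh : h ∈ Coeff.deg V) : ηR h ∈ deg V :=
  Coeff.translate_mem _ (fun _ _ => algebraMap_mem) (τ_mem 0) hh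

theorem convInv_ξ_mem (n : ℕ) : convInv ξ n ∈ deg (2 ^ n - 1, 2 ^ n - 1) := by
  induction n using Nat.strong_induction_on with
  | _ n ih =>
    cases n with
    | zero => rw [convInv_zero]; exact SetLike.GradedOne.one_mem
    | succ n =>
      rw [convInv]
      refine sum_mem fun q _ => ?_
      have h := SetLike.GradedMul.mul_mem (SetLike.pow_mem_graded (2 ^ (q : ℕ))
        (ξ_mem (n + 1 - q))) (ih q q.2)
      have e : ((2 ^ (n + 1) - 1, 2 ^ (n + 1) - 1) : RO) =
          (2 ^ (q : ℕ)) • ((2 ^ (n + 1 - (q : ℕ)) - 1, 2 ^ (n + 1 - (q : ℕ)) - 1) : RO) +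
            (2 ^ (q : ℕ) - 1, 2 ^ (q : ℕ) - 1) := by
        have e1 : (2 : ℤ) ^ (n + 1) = 2 ^ (q : ℕ) * 2 ^ (n + 1 - (q : ℕ)) := by
          rw [← pow_add]
          congr 1
          omega
        ext <;> simp [e1] <;> ring
      rw [e]
      exact h

theorem c_ηR (h : Coeff) : c (ηR h) = algebraMap _ _ h := by
  have e : c.comp ηR = algebraMap Coeff DualSteenrod := by
    have e1 : c.comp (algebraMap Coeff DualSteenrod) = ηR := RingHom.ext c_algebraMap
    conv_lhs => rw [ηR, Coeff.comp_translate, e1, ηR, Coeff.translate_translate, c_τ, conv_zero,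
      convInv_zero, one_mul, ← two_mul, two_eq_zero, zero_mul, Coeff.translate_zero]
  exact RingHom.congr_fun e h

theorem ε_ηR (h : Coeff) : ε (ηR h) = h := by
  have e : ε.comp ηR = RingHom.id Coeff := by
    have e1 : ε.comp (algebraMap Coeff DualSteenrod) = RingHom.id Coeff := RingHom.ext ε_algebraMap
    rw [ηR, Coeff.comp_translate, e1, ε_τ, Coeff.translate_zero]
  exact RingHom.congr_fun e h

theorem Δ_ηR (h : Coeff) : Δ (ηR h) = BiTensor.inr ηR (ηR h) := by
  have e : Δ.comp ηR = (BiTensor.inr ηR).comp ηR := by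
    have e1 : Δ.comp (algebraMap Coeff DualSteenrod) =
        (BiTensor.inl ηR DualSteenrod).comp (algebraMap _ _) := RingHom.ext Δ_algebraMap
    have e2 : (BiTensor.inr ηR).comp (algebraMap Coeff DualSteenrod) =
        (BiTensor.inl ηR DualSteenrod).comp ηR := RingHom.ext fun h => (BiTensor.inl_ηR ηR h).symm
    have e3 : (BiTensor.inl ηR DualSteenrod).comp ηR = Coeff.translate
        ((BiTensor.inl ηR DualSteenrod).comp (algebraMap _ _)) (BiTensor.inl ηR _ (τ 0)) :=
      Coeff.comp_translate _ _ _
    have e4 : Δ.comp ηR = Coeff.translate (Δ.comp (algebraMap _ _)) (Δ (τ 0)) :=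
      Coeff.comp_translate _ _ _
    have e5 : (BiTensor.inr ηR).comp ηR = Coeff.translate
        ((BiTensor.inr ηR).comp (algebraMap Coeff DualSteenrod)) (BiTensor.inr ηR (τ 0)) :=
      Coeff.comp_translate _ _ _
    rw [e4, e5, e1, e2, e3, Coeff.translate_translate, Δ_τ, conv_zero, show ξ 0 = 1 from rfl,
      map_one, one_mul, add_comm]
  exact RingHom.congr_fun e h

/-- The `ℤ/2`-equivariant dual Steenrod Hopf algebroid `(HF̲_⋆, A_⋆)`. -/
def hopfAlgebroid : HopfAlgebroid Coeff.deg deg where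
  isGrading_base := Coeff.isGrading_deg
  isGrading := isGrading_deg
  ηR := ηR
  ε := ε
  Δ := Δ
  c := c
  ηL_mem := algebraMap_mem
  ηR_mem := ηR_mem
  ε_mem ha := by
    have := Coeff.isGrading_deg.gradedMonoid
    refine map_mem ε (fun V r hr => ?_) (fun i => ?_) (fun i => ?_) ha
    · rwa [ε_algebraMap]
    · rw [ε_τ]; exact zero_mem _
    · rw [ε_ξ, convOne]
      split_ifs with h
      · subst h; exact SetLike.GradedOne.one_mem
      · exact zero_mem _
  Δ_mem ha := by
    have := BiTensor.gradedMonoid ηR deg deg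
    refine map_mem Δ (fun V r hr => ?_) (fun i => ?_) (fun i => ?_) ha
    · rw [Δ_algebraMap]
      exact BiTensor.inl_mem ηR deg deg (algebraMap_mem hr)
    · rw [Δ_τ]
      refine add_mem ?_ (BiTensor.inl_mem ηR deg deg (τ_mem i))
      have h := conv_mem (δ := (0, -1)) (fun n => BiTensor.inl_mem ηR deg deg (ξ_mem n))
        (fun n => BiTensor.inr_mem ηR deg deg
          (show τ n ∈ deg ((2 ^ n, 2 ^ n) + (0, -1)) by simpa [sub_eq_add_neg] using τ_mem n)) i
      simpa [sub_eq_add_neg] using h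
    · rw [Δ_ξ]
      have h := conv_mem (δ := (-1, -1)) (fun n => BiTensor.inl_mem ηR deg deg (ξ_mem n))
        (fun n => BiTensor.inr_mem ηR deg deg
          (show ξ n ∈ deg ((2 ^ n, 2 ^ n) + (-1, -1)) by simpa [sub_eq_add_neg] using ξ_mem n)) i
      simpa [sub_eq_add_neg] using h
  c_mem ha := by
    refine map_mem c (fun V r hr => ?_) (fun i => ?_) (fun i => ?_) ha
    · rw [c_algebraMap]; exact ηR_mem hr
    · rw [c_τ]
      have h := conv_mem (δ := (0, -1)) convInv_ξ_mem
        (fun n => show τ n ∈ deg ((2 ^ n, 2 ^ n) + (0, -1)) by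
          simpa [sub_eq_add_neg] using τ_mem n) i
      simpa [sub_eq_add_neg] using h
    · rw [c_ξ]; exact convInv_ξ_mem i
  ε_ηL := ε_algebraMap
  ε_ηR := ε_ηR
  Δ_ηL := Δ_algebraMap
  Δ_ηR := Δ_ηR
  counit_left a := by
    rw [← RingHom.comp_apply]
    refine RingHom.congr_fun (g := RingHom.id _) (ringHom_ext ?_ ?_ ?_) a
    · intro h; simp [Δ_algebraMap, ε_algebraMap]
    · intro i
      simp only [RingHom.comp_apply, Δ_τ, map_add, map_conv, BiTensor.ringLift_inl,
        BiTensor.ringLift_inr, ε_τ, ε_ξ, map_zero, add_zero, RingHom.id_apply]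
      rw [← convOne_conv τ i]
      simp [conv, convOne]
    · intro i
      simp only [RingHom.comp_apply, Δ_ξ, map_conv, BiTensor.ringLift_inl,
        BiTensor.ringLift_inr, ε_ξ, RingHom.id_apply]
      conv_rhs => rw [← convOne_conv ξ i]
      simp [conv, convOne]
  counit_right a := by
    rw [← RingHom.comp_apply]
    refine RingHom.congr_fun (g := RingHom.id _) (ringHom_ext ?_ ?_ ?_) a
    · intro h; simp [Δ_algebraMap]
    · intro i
      simp only [RingHom.comp_apply, Δ_τ, map_add, map_conv, BiTensor.ringLift_inl,
        BiTensor.ringLift_inr, ε_τ, map_zero, RingHom.id_apply]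
      simp [conv]
    · intro i
      simp only [RingHom.comp_apply, Δ_ξ, map_conv, BiTensor.ringLift_inl,
        BiTensor.ringLift_inr, ε_ξ, RingHom.id_apply]
      conv_rhs => rw [← conv_convOne ξ i]
      simp [conv, convOne]
  coassoc a := by
    rw [← RingHom.comp_apply, ← RingHom.comp_apply]
    have h2 : (2 : BiTensor ηR (BiTensor ηR DualSteenrod)) = 0 :=
      Coeff.map_two ((BiTensor.inl ηR (BiTensor ηR DualSteenrod)).comp (algebraMap _ _))
    refine RingHom.congr_fun (ringHom_ext (fun h => ?_) (fun i => ?_) (fun i => ?_)) a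
    · simp only [RingHom.comp_apply, Δ_algebraMap, BiTensor.ringLift_inl]
    · simp only [RingHom.comp_apply, Δ_τ, Δ_ξ, map_add, map_conv, BiTensor.ringLift_inl,
        BiTensor.ringLift_inr, conv_add]
      rw [← conv_assoc h2, add_assoc]
    · simp only [RingHom.comp_apply, Δ_ξ, map_conv, BiTensor.ringLift_inl,
        BiTensor.ringLift_inr]
      rw [← conv_assoc h2]
  c_ηL := c_algebraMap
  c_ηR := c_ηR
  c_c a := by
    rw [← RingHom.comp_apply]
    have h2 := two_eq_zero
    have hc : (fun n => c (ξ n)) = convInv ξ := funext c_ξ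
    have hξ : ∀ n, c (convInv ξ n) = ξ n := fun n => by
      refine (eq_of_conv_eq h2 (conv_convInv h2 rfl) (z := fun n => c (convInv ξ n))
        (fun n => ?_) n).symm
      have h := congrArg c (conv_convInv h2 (x := ξ) rfl n)
      rw [map_conv, hc] at h
      rw [h, convOne]
      split_ifs <;> simp
    refine RingHom.congr_fun (g := RingHom.id _) (ringHom_ext (fun h => ?_) (fun i => ?_)
      (fun i => ?_)) a
    · simp [c_algebraMap, c_ηR]
    · have e1 : (fun n => c (convInv ξ n)) = ξ := funext hξ
      have e2 : (fun n => c (τ n)) = conv (convInv ξ) τ := funext c_τ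
      have e3 : conv ξ (convInv ξ) = convOne := funext (conv_convInv h2 rfl)
      rw [RingHom.comp_apply, c_τ, map_conv, e1, e2, ← conv_assoc h2, e3, convOne_conv]
      rfl
    · rw [RingHom.comp_apply, c_ξ, hξ]; rfl
  antipode_left a := by
    rw [← RingHom.comp_apply, ← RingHom.comp_apply]
    have h2 := two_eq_zero
    refine RingHom.congr_fun (ringHom_ext (fun h => ?_) (fun i => ?_) (fun i => ?_)) a
    · simp [Δ_algebraMap, c_algebraMap, ε_algebraMap]
    · simp only [RingHom.comp_apply, Δ_τ, map_add, map_conv, BiTensor.ringLift_inl,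
        BiTensor.ringLift_inr, ε_τ, map_zero, RingHom.id_apply, c_τ, c_ξ]
      rw [← two_mul, h2, zero_mul]
    · simp only [RingHom.comp_apply, Δ_ξ, map_conv, BiTensor.ringLift_inl,
        BiTensor.ringLift_inr, RingHom.id_apply, c_ξ, ε_ξ]
      rw [convInv_conv h2 rfl, convOne, convOne]
      split_ifs <;> simp
  antipode_right a := by
    rw [← RingHom.comp_apply, ← RingHom.comp_apply]
    have h2 := two_eq_zero
    refine RingHom.congr_fun (ringHom_ext (fun h => ?_) (fun i => ?_) (fun i => ?_)) a
    · simp [Δ_algebraMap, ε_algebraMap]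
    · simp only [RingHom.comp_apply, Δ_τ, map_add, map_conv, BiTensor.ringLift_inl,
        BiTensor.ringLift_inr, ε_τ, map_zero, RingHom.id_apply, c_τ]
      have e3 : conv ξ (convInv ξ) = convOne := funext (conv_convInv h2 rfl)
      change conv ξ (conv (convInv ξ) τ) i + τ i = 0
      rw [← conv_assoc h2, e3, convOne_conv, ← two_mul, h2, zero_mul]
    · simp only [RingHom.comp_apply, Δ_ξ, map_conv, BiTensor.ringLift_inl,
        BiTensor.ringLift_inr, RingHom.id_apply, c_ξ, ε_ξ]
      refine (conv_convInv h2 rfl i).trans ?_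
      rw [convOne, convOne]
      split_ifs <;> simp

end DualSteenrod
end Steenrod

section Profiles

/-- A profile function `(h, k)`: `h i` (for `i ≥ 1`) is the exponent that belongs to `ξ_i`, and
`k i` (for `i ≥ 0`) is the one that belongs to `τ_i`. The value `h 0` is not used. -/
structure Profile where
  h : ℕ → ℕ∞
  k : ℕ → ℕ∞

/-- `(h, k) ≤ (h', k')` if `h (n + 1) ≤ h' (n + 1)` and `k n ≤ k' n` for all `n ≥ 0`. -/
instance : LE Profile := ⟨fun p q => ∀ n, p.h (n + 1) ≤ q.h (n + 1) ∧ p.k n ≤ q.k n⟩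

/-- The ideal `I(h, k)` generated by all `ξ_i ^ (2 ^ h(i))` with `i ≥ 1` and all
`τ_i ^ (2 ^ k(i))` with `i ≥ 0`, where an infinite exponent gives no generator. -/
def Profile.ideal (p : Profile) : Ideal DualSteenrod :=
  Ideal.span ({x | ∃ i e : ℕ, p.h (i + 1) = e ∧ x = DualSteenrod.ξ (i + 1) ^ 2 ^ e} ∪
    {x | ∃ i e : ℕ, p.k i = e ∧ x = DualSteenrod.τ i ^ 2 ^ e})

/-- The profile function of `E(n)_⋆`: `h = 0` and `k = (n, n - 1, …, 1, 0, 0, …)`. -/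
def profileE (n : ℕ) : Profile where
  h _ := 0
  k i := (n - i : ℕ)

/-- The profile function of `A(n)_⋆`: `h = (n - 1, n - 2, …, 1, 0, 0, …)`, starting with `h 1`,
and `k = (n, n - 1, …, 1, 0, 0, …)`, starting with `k 0`. -/
def profileA (n : ℕ) : Profile where
  h i := (n - i : ℕ)
  k i := (n - i : ℕ)

end Profiles

end EquivSteenrod
end

/-! Both families of quotients are handled through ideals generated by the ξ_i^{2^{h(i)}} with i ≥ 1
and the τ_i with i ≥ n (`shapeIdeal`). The remaining generators τ_i^{2^{n-i}}, i < n, of the profile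
ideals are redundant: by Frobenius, powers of the relation τ_i² = aτ_{i+1} + (u + aτ_0)ξ_{i+1} put
them into the ideal as soon as h(i) ≤ n - i (`τ_pow_mem_shapeIdeal`). Together with h(i) ≤ j +
h(i+j), this inequality also makes the ideal a Hopf ideal (`IsHopfShape.isHopfIdeal`).

Such a quotient has the expected monomial basis over H: exponents of τ_i at most 1 for i < n and 0
for i ≥ n, exponents of ξ_i below 2^{h(i)}. Indeed, replacing X_s^{e(s)} by the relation with that
leading term changes the monomial basis of the polynomial ring unitriangularly, since the relation
for τ_i² lowers the number of τ's. In the new basis the ideal of relations is spanned by basis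
elements (`relIdeal_eq_span`, `IsPresented.basis`).

For cofreeness of B over C, every basis monomial of B is uniquely c·m, with c a basis monomial of C
and the exponents of m divisible by those of C (`reduced_bijective`). Let F be free on the monomials
m. A linear map g : B → F induces a comodule map (id ⊗ g)ψ : B → C ⊗ F, where ψ is the coaction;
take for g the projection onto the monomials m. These are coinvariant, ψ(m) = 1 ⊗ m
(`coactHom_coinvariant`), while ψ(c) is c ⊗ 1 plus terms that have the same number of τ's but a left
factor of smaller degree (`hasLeading_coactHom`). Rewriting a τ_i² in either tensor factor lowers
the number of τ's (`mapRight_biMono_mem`). Ranking pairs of monomials lexicographically, by number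
of τ's and then by degree of the left factor, the comodule map sends c·m to c ⊗ m plus terms of
lower rank. It is therefore bijective (`bijective_of_unitriangular`), and compatibility with the
gradings follows from `Hom.isCofree_of_bijective` and `repr_mem`. -/

noncomputable section
namespace EquivSteenrod

/-! ### Unitriangular linear maps. -/

section Triangular
variable {R M N X W : Type*} [CommRing R] [AddCommGroup M] [Module R M] [AddCommGroup N]
  [Module R N] [LinearOrder W] [WellFoundedLT W]

/-- A linear map whose matrix is unitriangular for a well-founded rank is bijective. -/
theorem bijective_of_unitriangular (b : Module.Basis X R M) (e : Module.Basis X R N) (rk : X → W)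
    (φ : M →ₗ[R] N)
    (h : ∀ x, φ (b x) - e x ∈ Submodule.span R (e '' {y | rk y < rk x})) :
    Function.Bijective φ := by
  classical
  constructor
  · rw [injective_iff_map_eq_zero]
    intro v hv
    by_contra hne
    have hsupp : (b.repr v).support.Nonempty := by
      rw [Finsupp.support_nonempty_iff]
      simpa using hne
    obtain ⟨x, hx, hmax⟩ := Finset.exists_max_image _ rk hsupp
    have hsum := b.linearCombination_repr v
    rw [Finsupp.linearCombination_apply, Finsupp.sum] at hsum
    -- As `x` has maximal rank in the support of `v`, any other `b y` there contributes `e y` and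
    -- terms of rank below `rk y ≤ rk x`, none of which involves `e x`.
    have key : e.repr (φ v) x = b.repr v x := by
      conv_lhs => rw [← hsum]
      rw [map_sum, map_sum, Finsupp.finsetSum_apply, Finset.sum_eq_single x]
      · have h1 := e.repr_support_subset_of_mem_span _ (h x)
        have h2 : e.repr (φ (b x) - e x) x = 0 := by
          by_contra h3
          exact lt_irrefl _ (h1 (Finsupp.mem_support_iff.2 h3))
        rw [map_sub, Finsupp.sub_apply, e.repr_self, Finsupp.single_eq_same, sub_eq_zero] at h2
        rw [map_smul, map_smul, Finsupp.smul_apply, h2, smul_eq_mul, mul_one]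
      · intro y hy hyx
        have h1 := e.repr_support_subset_of_mem_span _ (h y)
        have h2 : e.repr (φ (b y) - e y) x = 0 := by
          by_contra h3
          exact absurd (h1 (Finsupp.mem_support_iff.2 h3)) (not_lt.2 (hmax y hy))
        rw [map_sub, Finsupp.sub_apply, e.repr_self, Finsupp.single_eq_of_ne hyx.symm,
          sub_zero] at h2
        rw [map_smul, map_smul, Finsupp.smul_apply, h2, smul_zero]
      · intro h; exact absurd hx h
    rw [hv, map_zero, Finsupp.zero_apply] at key
    exact Finsupp.mem_support_iff.1 hx key.symm
  · rw [← LinearMap.range_eq_top, eq_top_iff, ← e.span_eq, Submodule.span_le]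
    rintro _ ⟨x, rfl⟩
    -- `e x` is `φ (b x)` minus a combination of `e y` of lower rank, and these lie in the range by
    -- induction.
    induction hw : rk x using WellFoundedLT.induction generalizing x with
    | ind w ih =>
      subst hw
      have h1 : Submodule.span R (e '' {y | rk y < rk x}) ≤ LinearMap.range φ := by
        rw [Submodule.span_le]
        rintro _ ⟨y, hy, rfl⟩
        exact ih _ hy y rfl
      have h2 := sub_mem (LinearMap.mem_range_self φ (b x)) (h1 (h x))
      rwa [sub_sub_cancel] at h2

end Triangular

/-! ### Leading terms with respect to an additive rank. -/

section Leading
variable {R T M W : Type*} [CommRing R] [CommRing T] [Algebra R T] [AddCommMonoid M]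
  [AddCommMonoid W] [LinearOrder W] [IsOrderedCancelAddMonoid W]
  (t : Multiplicative M →* T) (rk : M →+ W)

/-- The span of the `t y` with `y` of rank less than `w`. -/
def lowerSpan (R : Type*) {T M W : Type*} [CommRing R] [CommRing T] [Algebra R T] [AddCommMonoid M]
    [AddCommMonoid W] [LinearOrder W] (t : Multiplicative M →* T) (rk : M →+ W) (w : W) :
    Submodule R T :=
  Submodule.span R ((fun m => t (Multiplicative.ofAdd m)) '' {y | rk y < w})

/-- The element `f` is equal to `t m` up to terms of lower rank. -/
def HasLeading (R : Type*) {T M W : Type*} [CommRing R] [CommRing T] [Algebra R T] [AddCommMonoid M]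
    [AddCommMonoid W] [LinearOrder W] (t : Multiplicative M →* T) (rk : M →+ W) (f : T) (m : M) :
    Prop :=
  f - t (Multiplicative.ofAdd m) ∈ lowerSpan R t rk (rk m)

variable {t rk}

theorem mul_mem_lowerSpan {f : T} {w : W} (hf : f ∈ lowerSpan R t rk w) (m : M) :
    f * t (Multiplicative.ofAdd m) ∈ lowerSpan R t rk (w + rk m) := by
  have h : lowerSpan R t rk w ≤ (lowerSpan R t rk (w + rk m)).comap
      (LinearMap.mulRight R (t (Multiplicative.ofAdd m))) := by
    refine Submodule.span_le.2 ?_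
    rintro _ ⟨y, hy, rfl⟩
    refine Submodule.subset_span ⟨y + m, ?_, ?_⟩
    · simpa using hy
    · simp [ofAdd_add]
  exact h hf

theorem lowerSpan_mul {f g : T} {w w' : W} (hf : f ∈ lowerSpan R t rk w)
    (hg : g ∈ lowerSpan R t rk w') : f * g ∈ lowerSpan R t rk (w + w') := by
  have h : lowerSpan R t rk w' ≤ (lowerSpan R t rk (w + w')).comap (LinearMap.mulLeft R f) := by
    refine Submodule.span_le.2 ?_
    rintro _ ⟨y, hy, rfl⟩
    have h1 := mul_mem_lowerSpan hf y
    refine (Submodule.span_mono (Set.image_mono fun z hz => ?_)) h1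
    exact lt_trans (show rk z < w + rk y from hz) (by simpa using hy)
  exact h hg

theorem HasLeading.one : HasLeading R t rk 1 0 := by
  simp [HasLeading]

theorem HasLeading.refl (m : M) : HasLeading R t rk (t (Multiplicative.ofAdd m)) m := by
  simp [HasLeading]

/-- With f = t(m) + f' and g = t(n) + g', the error is f'g' + f't(n) + g't(m). Each summand has rank
below `rk m + rk n`, because addition of ranks is strictly monotone. -/
theorem HasLeading.mul {f g : T} {m n : M} (hf : HasLeading R t rk f m)
    (hg : HasLeading R t rk g n) : HasLeading R t rk (f * g) (m + n) := by
  have h1 := lowerSpan_mul hf hg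
  have h2 := mul_mem_lowerSpan hf n
  have h3 := mul_mem_lowerSpan hg m
  rw [add_comm] at h3
  have h := add_mem (add_mem h1 h2) h3
  unfold HasLeading
  rw [map_add, ofAdd_add, map_mul]
  convert h using 1
  ring

theorem HasLeading.pow {f : T} {m : M} (hf : HasLeading R t rk f m) (k : ℕ) :
    HasLeading R t rk (f ^ k) (k • m) := by
  induction k with
  | zero => simpa using HasLeading.one
  | succ k ih => rw [pow_succ, succ_nsmul]; exact ih.mul hf

theorem HasLeading.prod {ι : Type*} (s : Finset ι) {f : ι → T} {m : ι → M}
    (h : ∀ i ∈ s, HasLeading R t rk (f i) (m i)) :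
    HasLeading R t rk (∏ i ∈ s, f i) (∑ i ∈ s, m i) := by
  classical
  induction s using Finset.induction_on with
  | empty => simpa using HasLeading.one
  | insert i s hi ih =>
    rw [Finset.prod_insert hi, Finset.sum_insert hi]
    exact (h i (Finset.mem_insert_self i s)).mul (ih fun j hj => h j (Finset.mem_insert_of_mem hj))

end Leading

/-! ### Tensor products with free modules. -/

namespace BiTensor
variable {H C : Type*} [CommRing H] [CommRing C] [Algebra H C] (ηR : H →+* C) (ι : Type*)

/-- The tensor product with a free module is a direct sum of copies of the first factor. -/
def finsuppEquiv : BiTensor ηR (ι →₀ H) ≃ₗ[H] (ι →₀ C) :=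
  let E : RightMod ηR ⊗[H] (ι →₀ H) ≃ₗ[H] (ι →₀ RightMod ηR) :=
    by classical exact TensorProduct.finsuppScalarRight H H (RightMod ηR) ι
  have hE : ∀ (c : C) (m : ι →₀ H) (i : ι), E (tmul ηR c m) i = ηR (m i) * c := fun c m i => by
    classical
    exact TensorProduct.finsuppScalarRight_apply_tmul_apply (R := H) (S := H)
      (M := RightMod ηR) c m i
  { toFun := fun x => (E x : ι →₀ RightMod ηR)
    invFun := fun y => E.symm y
    left_inv := fun x => E.symm_apply_apply x
    right_inv := fun y => E.apply_symm_apply y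
    map_add' := fun x y => map_add E x y
    map_smul' := fun h x => by
      refine Finsupp.ext fun i => ?_
      -- The scalars act here through the left unit of `C`, whereas the tensor product is formed
      -- over the right unit. Linearity is thus not that of `E` and is checked on pure tensors, one
      -- coordinate at a time.
      let K : BiTensor ηR (ι →₀ H) →+ C :=
        { toFun := fun x => E x i
          map_zero' := DFunLike.congr_fun (map_zero E) i
          map_add' := fun x y => DFunLike.congr_fun (map_add E x y) i }
      have hK : K (h • x) = h • K x := by
        rw [Algebra.smul_def]
        induction x using induction with
        | zero => simp
        | pure c m => exact (hE _ m i).trans ((mul_left_comm _ _ _).trans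
            (congrArg (algebraMap H C h * ·) (hE c m i).symm))
        | add x y hx hy => rw [smul_add, map_add, hx, hy, map_add, mul_add]
      exact hK }

/-- Coefficients of the free module cross the tensor sign through the right unit. Since `ηR`
preserves degrees, coordinates of homogeneous tensors will be homogeneous. -/
theorem finsuppEquiv_tmul (c : C) (m : ι →₀ H) (i : ι) :
    finsuppEquiv ηR ι (tmul ηR c m) i = c * ηR (m i) := by
  classical
  refine (TensorProduct.finsuppScalarRight_apply_tmul_apply (R := H) (S := H)
    (M := RightMod ηR) c m i).trans ?_
  exact mul_comm (ηR (m i)) c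

theorem finsuppEquiv_tmul_single [DecidableEq ι] (c : C) (i : ι) :
    finsuppEquiv ηR ι (tmul ηR c (Finsupp.single i 1)) = Finsupp.single i c := by
  ext j
  rw [finsuppEquiv_tmul, Finsupp.single_apply, Finsupp.single_apply]
  split_ifs <;> simp

/-- The basis `c ⊗ e_i` of the tensor product with a free module. -/
def basis {κ : Type*} (b : Module.Basis κ H C) :
    Module.Basis (Σ _ : ι, κ) H (BiTensor ηR (ι →₀ H)) :=
  (Finsupp.basis fun _ => b).map (finsuppEquiv ηR ι).symm

theorem basis_apply {κ : Type*} (b : Module.Basis κ H C) (x : Σ _ : ι, κ) :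
    basis ηR ι b x = tmul ηR (b x.2) (Finsupp.single x.1 1) := by
  classical
  rw [basis, Module.Basis.map_apply, LinearEquiv.symm_apply_eq, finsuppEquiv_tmul_single]
  simp

end BiTensor

/-! ### Comodule maps into cofree comodules, and homogeneity. -/

section Cofree
variable {G : Type*} [AddCommGroup G] [DecidableEq G]
variable {H : Type*} [CommRing H] {𝒽 : G → AddSubgroup H}
variable {B : Type*} [CommRing B] [Algebra H B] {𝒷 : G → AddSubgroup B}
variable {C : Type*} [CommRing C] [Algebra H C] {𝒸 : G → AddSubgroup C}
variable {X : HopfAlgebroid 𝒽 𝒷} {Y : HopfAlgebroid 𝒽 𝒸}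

namespace HopfAlgebroid

theorem comulMap_mapRight (Y : HopfAlgebroid 𝒽 𝒸) {M N : Type*} [AddCommGroup M] [Module H M]
    [AddCommGroup N] [Module H N] (g : M →ₗ[H] N) (x : BiTensor Y.ηR M) :
    Y.comulMap N (BiTensor.mapRight Y.ηR g x) =
      BiTensor.mapRight Y.ηR (BiTensor.mapRight Y.ηR g) (Y.comulMap M x) := by
  induction x using BiTensor.induction with
  | zero => simp
  | pure a m =>
    rw [BiTensor.mapRight_tmul, comulMap_tmul, comulMap_tmul]
    induction Y.Δ a using BiTensor.induction with
    | zero => simp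
    | pure p q => simp
    | add x y hx hy => simp only [map_add, hx, hy]
  | add x y hx hy => simp only [map_add, hx, hy]

/-- The map into a cofree comodule that corresponds to a linear map `g`. -/
def Comodule.toCofree {M N : Type*} [AddCommGroup M] [Module H M] [AddCommGroup N] [Module H N]
    (D : Comodule Y M) (g : M →ₗ[H] N) : M →ₗ[H] BiTensor Y.ηR N :=
  (BiTensor.mapRight Y.ηR g).comp D.coact

/-- With coaction ψ and Φ = (id ⊗ g)ψ, naturality and coassociativity give (Δ ⊗ id)Φ = (id ⊗ id ⊗
g)(Δ ⊗ id)ψ = (id ⊗ id ⊗ g)(id ⊗ ψ)ψ = (id ⊗ Φ)ψ. Hence any linear `g` yields a comodule map, and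
cofreeness becomes the search for a `g` that makes Φ bijective. -/
theorem Comodule.coact_toCofree {M N : Type*} [AddCommGroup M] [Module H M] [AddCommGroup N]
    [Module H N] (D : Comodule Y M) (g : M →ₗ[H] N) (m : M) :
    (Y.cofree N).coact (D.toCofree g m) = BiTensor.mapRight Y.ηR (D.toCofree g) (D.coact m) := by
  change Y.comulMap N (BiTensor.mapRight Y.ηR g (D.coact m)) = _
  rw [comulMap_mapRight, ← D.coassoc]
  induction D.coact m using BiTensor.induction with
  | zero => simp
  | pure p q => simp [toCofree]
  | add x y hx hy => simp only [map_add, hx, hy]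

/-- The coordinates of an element of degree `V` of `C ⊗ H{e_i}` are homogeneous. -/
theorem finsuppEquiv_mem (Y : HopfAlgebroid 𝒽 𝒸) {ι : Type*} (d : ι → G) {V : G}
    {x : BiTensor Y.ηR (ι →₀ H)} (hx : x ∈ BiTensor.deg Y.ηR 𝒸 (freeDeg 𝒽 d) V) (i : ι) :
    BiTensor.finsuppEquiv Y.ηR ι x i ∈ 𝒸 (V - d i) := by
  have := Y.isGrading.gradedMonoid
  unfold BiTensor.deg at hx
  induction hx using AddSubgroup.closure_induction with
  | zero => rw [map_zero]; exact zero_mem _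
  | add x y _ _ hx hy => rw [map_add]; exact add_mem hx hy
  | neg x _ hx => rw [map_neg]; exact neg_mem hx
  | mem x hx =>
    obtain ⟨j, k, c, m, hc, hm, rfl, rfl⟩ := hx
    rw [BiTensor.finsuppEquiv_tmul, add_sub_assoc]
    exact SetLike.GradedMul.mul_mem hc (Y.ηR_mem (hm i))

theorem mapRight_mem (Y : HopfAlgebroid 𝒽 𝒸) {M N : Type*} [AddCommGroup M] [Module H M]
    [AddCommGroup N] [Module H N] {ℳ : G → AddSubgroup M} {𝒩 : G → AddSubgroup N}
    (g : M →ₗ[H] N) (hg : ∀ V, ∀ m ∈ ℳ V, g m ∈ 𝒩 V) {V : G} {x : BiTensor Y.ηR M}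
    (hx : x ∈ BiTensor.deg Y.ηR 𝒸 ℳ V) :
    BiTensor.mapRight Y.ηR g x ∈ BiTensor.deg Y.ηR 𝒸 𝒩 V := by
  unfold BiTensor.deg at hx
  induction hx using AddSubgroup.closure_induction with
  | zero => rw [map_zero]; exact zero_mem _
  | add x y _ _ hx hy => rw [map_add]; exact add_mem hx hy
  | neg x _ hx => rw [map_neg]; exact neg_mem hx
  | mem x hx =>
    obtain ⟨j, k, c, m, hc, hm, hV, rfl⟩ := hx
    exact AddSubgroup.subset_closure ⟨j, k, c, g m, hc, hg _ _ hm, hV, rfl⟩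

theorem Hom.coact_mem (f : Hom X Y) {V : G} {b : B} (hb : b ∈ 𝒷 V) :
    f.comodule.coact b ∈ BiTensor.deg Y.ηR 𝒸 𝒷 V := by
  have hx := X.Δ_mem hb
  change f.mapLeft B (X.Δ b) ∈ _
  unfold BiTensor.deg at hx
  generalize X.Δ b = z at hx
  induction hx using AddSubgroup.closure_induction with
  | zero => rw [map_zero]; exact zero_mem _
  | add x y _ _ hx hy => rw [map_add]; exact add_mem hx hy
  | neg x _ hx => rw [map_neg]; exact neg_mem hx
  | mem x hx =>
    obtain ⟨j, k, c, m, hc, hm, hV, rfl⟩ := hx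
    exact AddSubgroup.subset_closure ⟨j, k, _, m, f.map_mem hc, hm, hV, rfl⟩

/-- A linear map to a free graded module whose associated map into the cofree comodule is bijective
makes `B` a cofree comodule. -/
theorem Hom.isCofree_of_bijective (f : Hom X Y) {ι : Type} (d : ι → G) (g : B →ₗ[H] ι →₀ H)
    (hg : ∀ V, ∀ b ∈ 𝒷 V, g b ∈ freeDeg 𝒽 d V)
    (hbij : Function.Bijective (f.comodule.toCofree g)) : f.IsCofree := by
  classical
  have hmem : ∀ V, ∀ b ∈ 𝒷 V,
      f.comodule.toCofree g b ∈ BiTensor.deg Y.ηR 𝒸 (freeDeg 𝒽 d) V := fun V b hb =>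
    mapRight_mem Y g hg (f.coact_mem hb)
  refine ⟨ι, d, LinearEquiv.ofBijective _ hbij, f.comodule.coact_toCofree g,
    fun V b => ⟨hmem V b, fun hb => ?_⟩⟩
  obtain ⟨hC, -⟩ := (isInternal_iff _).1 Y.isGrading.isInternal
  obtain ⟨y, rfl⟩ := X.isGrading.isInternal.surjective b
  rw [DirectSum.coeAddMonoidHom_eq_dfinsuppSum] at hb ⊢
  -- The comodule map preserves degrees. If the image of `b` is homogeneous of degree `V`, the
  -- images of the other components of `b` must vanish, and by injectivity so do the components.
  have hzero : ∀ W ∈ y.support, W ≠ V → ((y W : 𝒷 W) : B) = 0 := by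
    intro W hW hWV
    apply hbij.injective
    apply (BiTensor.finsuppEquiv Y.ηR ι).injective
    rw [map_zero, map_zero]
    ext i
    let E : B →+ C := (Finsupp.applyAddHom i).comp
      ((BiTensor.finsuppEquiv Y.ηR ι).toLinearMap.comp (f.comodule.toCofree g)).toAddMonoidHom
    have hE : ∀ U, ∀ b ∈ 𝒷 U, E b ∈ 𝒸 (U - d i) := fun U b hb =>
      finsuppEquiv_mem Y d (hmem U b hb) i
    have hb' : E (DFinsupp.sum y fun W b => (b : B)) ∈ 𝒸 (V - d i) := finsuppEquiv_mem Y d hb i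
    -- `V` is included because the family to which directness is applied has the image of the whole
    -- element subtracted in degree `V`, even if the component there is zero.
    let S : Finset G := insert V y.support
    have hs : E (DFinsupp.sum y fun W b => (b : B)) = ∑ U ∈ S, E (y U) := by
      rw [DFinsupp.sum, map_sum]
      refine Finset.sum_subset (Finset.subset_insert _ _) fun U _ hU => ?_
      rw [DFinsupp.notMem_support_iff.1 hU]
      exact map_zero E
    have hd : ∀ U, E (y (U - d i + d i)) = E (y U) := fun U =>
      congrArg (fun U => E (y U)) (sub_add_cancel U (d i))
    -- The `i`-th coordinate shifts degrees by `-d i`. The family consists of the coordinates of the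
    -- components, minus the coordinate of their sum in degree `V - d i`; its total is zero, so each
    -- member vanishes.
    have key := hC (S.image fun U => U - d i)
      (fun U => E (y (U + d i)) - if U = V - d i then E (DFinsupp.sum y fun W b => (b : B)) else 0)
      (fun U => by
        refine sub_mem ?_ ?_
        · simpa using hE _ _ (y (U + d i)).2
        · split_ifs with h
          · rw [h]; exact hb'
          · exact zero_mem _)
      (by
        rw [Finset.sum_image (by intro a _ b _ h; simpa using h), Finset.sum_sub_distrib]
        simp only [hd, sub_left_inj]
        rw [Finset.sum_ite_eq', if_pos (Finset.mem_insert_self _ _), hs, sub_self])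
      (W - d i) (Finset.mem_image_of_mem _ (Finset.mem_insert_of_mem hW))
    simp only [hd, sub_left_inj, hWV, if_false, sub_zero] at key
    exact key
  rw [DFinsupp.sum, Finset.sum_eq_single V]
  · exact (y V).2
  · exact hzero
  · intro h
    rw [DFinsupp.notMem_support_iff.1 h]
    rfl

/-- The coordinates of a homogeneous element in a homogeneous basis are homogeneous. -/
theorem repr_mem (X : HopfAlgebroid 𝒽 𝒷) {κ : Type*} (b : Module.Basis κ H B) (w : κ → G)
    (hw : ∀ k, b k ∈ 𝒷 (w k)) {V : G} {x : B} (hx : x ∈ 𝒷 V) (k : κ) :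
    b.repr x k ∈ 𝒽 (V - w k) := by
  classical
  have := X.isGrading.gradedMonoid
  obtain ⟨hB, -⟩ := (isInternal_iff _).1 X.isGrading.isInternal
  let _ : DirectSum.Decomposition 𝒽 := X.isGrading_base.isInternal.chooseDecomposition
  -- The part of the `k`-th coefficient that makes its product with `b k` homogeneous of degree `U`.
  -- The elements `y U` formed from these parts will be the homogeneous components of `x`.
  let p : G → κ → H := fun U k => (DirectSum.decompose 𝒽 (b.repr x k) (U - w k) : H)
  let y : G → B := fun U => ∑ k ∈ (b.repr x).support, p U k • b k
  have hy : ∀ U, y U ∈ 𝒷 U := fun U => sum_mem fun k _ => by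
    rw [Algebra.smul_def]
    have h := SetLike.GradedMul.mul_mem
      (X.ηL_mem (DirectSum.decompose 𝒽 (b.repr x k) (U - w k)).2) (hw k)
    rwa [sub_add_cancel] at h
  let S : Finset G := insert V ((b.repr x).support.biUnion fun k =>
    (DirectSum.decompose 𝒽 (b.repr x k)).support.image fun U => U + w k)
  have hsum : ∑ U ∈ S, y U = x := by
    conv_rhs => rw [← b.linearCombination_repr x, Finsupp.linearCombination_apply, Finsupp.sum]
    rw [Finset.sum_comm]
    refine Finset.sum_congr rfl fun k hk => ?_
    rw [← Finset.sum_smul]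
    congr 1
    conv_rhs => rw [← DirectSum.sum_support_decompose 𝒽 (b.repr x k)]
    have hp : ∀ U, p (U + w k) k = (DirectSum.decompose 𝒽 (b.repr x k) U : H) := fun U =>
      congrArg (fun U => (DirectSum.decompose 𝒽 (b.repr x k) U : H)) (add_sub_cancel_right U (w k))
    rw [← Finset.sum_image (s := (DirectSum.decompose 𝒽 (b.repr x k)).support)
      (g := fun U => U + w k) (f := fun U => p U k) (by intro a _ b _ h; simpa using h) |>.trans
      (Finset.sum_congr rfl fun U _ => hp U)]
    symm
    refine Finset.sum_subset (fun U hU => Finset.mem_insert_of_mem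
      (Finset.mem_biUnion.2 ⟨k, hk, hU⟩)) fun U _ hU => ?_
    by_contra h
    refine hU (Finset.mem_image.2 ⟨U - w k, DFinsupp.mem_support_iff.2 fun h0 => h ?_, by simp⟩)
    simp only [p, h0]
    rfl
  -- `x` is itself of degree `V`, so by uniqueness of components only `y V` survives. Its
  -- coefficients are homogeneous by construction.
  have hxy : x = y V := by
    have key := hB S (fun U => y U - if U = V then x else 0)
      (fun U => sub_mem (hy U) (by
        split_ifs with h
        · rw [h]; exact hx
        · exact zero_mem _))
      (by rw [Finset.sum_sub_distrib, hsum, Finset.sum_ite_eq',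
        if_pos (Finset.mem_insert_self _ _), sub_self]) V (Finset.mem_insert_self _ _)
    rw [if_pos rfl, sub_eq_zero] at key
    exact key.symm
  by_cases hk : k ∈ (b.repr x).support
  · have : b.repr x k = p V k := by
      conv_lhs => rw [hxy]
      rw [map_sum, Finsupp.finsetSum_apply, Finset.sum_eq_single k]
      · simp
      · intro j _ hj
        simp [Finsupp.single_eq_of_ne hj.symm]
      · intro h; exact absurd hk h
    rw [this]
    exact (DirectSum.decompose 𝒽 (b.repr x k) (V - w k)).2
  · rw [Finsupp.notMem_support_iff.1 hk]
    exact zero_mem _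

end HopfAlgebroid
end Cofree

/-! ### Monomial bases of quotients of the dual Steenrod algebra. -/

section Presentation
open MvPolynomial

/-- The number of factors `τ_i` of a monomial. -/
def numTau : (SteenrodGen →₀ ℕ) →+ ℕ :=
  Finsupp.weight fun s => match s with
    | .τ _ => 1
    | .ξ _ => 0

@[simp] theorem numTau_τ (i k : ℕ) : numTau (Finsupp.single (.τ i) k) = k := by
  simp [numTau, Finsupp.weight_single]

@[simp] theorem numTau_ξ (i k : ℕ) : numTau (Finsupp.single (.ξ i) k) = 0 := by
  simp [numTau, Finsupp.weight_single]

/-- The defining relation `τ_i ^ 2 - (a τ_{i+1} + (u + a τ_0) ξ_{i+1})`. -/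
def steenrodRel (i : ℕ) : MvPolynomial SteenrodGen Coeff :=
  X (.τ i) ^ 2 - (C Coeff.a * X (.τ (i + 1)) + (C Coeff.u + C Coeff.a * X (.τ 0)) * X (.ξ i))

/-- For exponents `e s`, the relation with leading term `X s ^ e s`: for `τ_i` with exponent `2` it
is the defining relation of the dual Steenrod algebra, otherwise it is a power of the variable. -/
def relGen (e : SteenrodGen → ℕ) : SteenrodGen → MvPolynomial SteenrodGen Coeff
  | .τ i => if e (.τ i) = 2 then steenrodRel i else X (.τ i) ^ e (.τ i)
  | .ξ i => X (.ξ i) ^ e (.ξ i)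

/-- The ideal generated by the relations `relGen e s`, where the exponent `0` stands for
"no relation". -/
def relIdeal (e : SteenrodGen → ℕ) : Ideal (MvPolynomial SteenrodGen Coeff) :=
  Ideal.span (relGen e '' {s | e s ≠ 0})

/-- The monomials that are reduced for the exponents `e`. -/
def Reduced (e : SteenrodGen → ℕ) (m : SteenrodGen →₀ ℕ) : Prop := ∀ s, m s % e s = m s

theorem monomialOneHom_single (s : SteenrodGen) (k : ℕ) :
    monomialOneHom Coeff SteenrodGen (Multiplicative.ofAdd (Finsupp.single s k)) = X s ^ k := by
  rw [X_pow_eq_monomial]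
  rfl

theorem hasLeading_X_pow (s : SteenrodGen) (k : ℕ) :
    HasLeading Coeff (monomialOneHom Coeff SteenrodGen) numTau (X s ^ k) (Finsupp.single s k) := by
  rw [← monomialOneHom_single]
  exact HasLeading.refl _

/-- Among τ_i², τ_{i+1}, ξ_{i+1} and τ_0ξ_{i+1} only the first has two factors τ. Counting the τ's
therefore singles out the leading term, which the degree could not do since the relation is
homogeneous. -/
theorem hasLeading_steenrodRel (i : ℕ) :
    HasLeading Coeff (monomialOneHom Coeff SteenrodGen) numTau (steenrodRel i)
      (Finsupp.single (.τ i) 2) := by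
  have hmem : ∀ (r : Coeff) (m : SteenrodGen →₀ ℕ), numTau m < 2 →
      r • monomial m (1 : Coeff) ∈ lowerSpan Coeff (monomialOneHom Coeff SteenrodGen) numTau 2 :=
    fun r m hm => Submodule.smul_mem _ _ (Submodule.subset_span ⟨m, hm, rfl⟩)
  rw [HasLeading, monomialOneHom_single, numTau_τ]
  have h1 := hmem Coeff.a (Finsupp.single (.τ (i + 1)) 1) (by simp)
  have h2 := hmem Coeff.u (Finsupp.single (.ξ i) 1) (by simp)
  have h3 := hmem Coeff.a (Finsupp.single (.τ 0) 1 + Finsupp.single (.ξ i) 1) (by simp)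
  have h := neg_mem (add_mem h1 (add_mem h2 h3))
  have e3 : monomial (Finsupp.single (SteenrodGen.τ 0) 1 + Finsupp.single (.ξ i) 1) (1 : Coeff) =
      X (.τ 0) * X (.ξ i) := by
    rw [X, X, monomial_mul, one_mul]
  rw [e3, smul_eq_C_mul, smul_eq_C_mul, smul_eq_C_mul] at h
  convert h using 1
  rw [steenrodRel]
  simp only [X]
  ring

theorem hasLeading_relGen (e : SteenrodGen → ℕ) (s : SteenrodGen) :
    HasLeading Coeff (monomialOneHom Coeff SteenrodGen) numTau (relGen e s)
      (Finsupp.single s (e s)) := by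
  cases s with
  | τ i =>
    rw [relGen]
    split_ifs with h
    · rw [h]; exact hasLeading_steenrodRel i
    · exact hasLeading_X_pow _ _
  | ξ i => exact hasLeading_X_pow _ _

/-- The contribution of the variable `s` to a normal monomial. -/
def normalFactor (e : SteenrodGen → ℕ) (s : SteenrodGen) (k : ℕ) :
    MvPolynomial SteenrodGen Coeff := X s ^ (k % e s) * relGen e s ^ (k / e s)

theorem normalFactor_zero (e : SteenrodGen → ℕ) (s : SteenrodGen) : normalFactor e s 0 = 1 := by
  simp [normalFactor]

/-- The polynomial obtained from the monomial `m` by replacing `X s ^ e s` by `relGen e s` as often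
as possible. -/
def normalMonomial (e : SteenrodGen → ℕ) (m : SteenrodGen →₀ ℕ) :
    MvPolynomial SteenrodGen Coeff := m.prod (normalFactor e)

/-- Leading terms multiply, and k mod e + e·(k div e) = k recovers the exponent of each variable.
For e = 0 the conventions k mod 0 = k and k div 0 = 0 leave the variable untouched. -/
theorem hasLeading_normalMonomial (e : SteenrodGen → ℕ) (m : SteenrodGen →₀ ℕ) :
    HasLeading Coeff (monomialOneHom Coeff SteenrodGen) numTau (normalMonomial e m) m := by
  have h : HasLeading Coeff (monomialOneHom Coeff SteenrodGen) numTau (normalMonomial e m)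
      (∑ s ∈ m.support, Finsupp.single s (m s)) := by
    refine HasLeading.prod _ fun s _ => ?_
    have h1 := (hasLeading_X_pow s (m s % e s)).mul ((hasLeading_relGen e s).pow (m s / e s))
    rwa [Finsupp.smul_single, smul_eq_mul, mul_comm (m s / e s), ← Finsupp.single_add,
      Nat.mod_add_div] at h1
  rwa [show ∑ s ∈ m.support, Finsupp.single s (m s) = m from m.sum_single] at h

theorem normalMonomial_bijective (e : SteenrodGen → ℕ) : Function.Bijective
    ((basisMonomials SteenrodGen Coeff).constr Coeff (normalMonomial e)) := by
  refine bijective_of_unitriangular (basisMonomials SteenrodGen Coeff)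
    (basisMonomials SteenrodGen Coeff) numTau _ fun m => ?_
  rw [Module.Basis.constr_basis, coe_basisMonomials]
  exact hasLeading_normalMonomial e m

/-- The normal monomials form a basis of the polynomial ring. -/
def normalBasis (e : SteenrodGen → ℕ) :
    Module.Basis (SteenrodGen →₀ ℕ) Coeff (MvPolynomial SteenrodGen Coeff) :=
  (basisMonomials SteenrodGen Coeff).map (LinearEquiv.ofBijective _ (normalMonomial_bijective e))

theorem normalBasis_apply (e : SteenrodGen → ℕ) (m : SteenrodGen →₀ ℕ) :
    normalBasis e m = normalMonomial e m := by
  rw [normalBasis, Module.Basis.map_apply, LinearEquiv.ofBijective_apply,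
    Module.Basis.constr_basis]

/-- Adding `e s` to an exponent keeps the remainder and raises the quotient by one. In the normal
basis, multiplication by a relation thus carries basis elements to basis elements, with no lower
terms. -/
theorem normalMonomial_mul_relGen (e : SteenrodGen → ℕ) {s : SteenrodGen} (hs : e s ≠ 0)
    (m : SteenrodGen →₀ ℕ) :
    normalMonomial e m * relGen e s = normalMonomial e (m + Finsupp.single s (e s)) := by
  rw [normalMonomial, normalMonomial, ← Finsupp.mul_prod_erase' m s _ (normalFactor_zero e),
    ← Finsupp.mul_prod_erase' (m + Finsupp.single s (e s)) s _ (normalFactor_zero e)]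
  have h : Finsupp.erase s (m + Finsupp.single s (e s)) = Finsupp.erase s m := by
    rw [Finsupp.erase_add, Finsupp.erase_single, add_zero]
  rw [h, mul_right_comm]
  congr 1
  rw [normalFactor, normalFactor, Finsupp.add_apply, Finsupp.single_eq_same, Nat.add_mod_right,
    Nat.add_div_right _ (Nat.pos_of_ne_zero hs), pow_succ, mul_assoc]

theorem normalMonomial_of_reduced {e : SteenrodGen → ℕ} {m : SteenrodGen →₀ ℕ}
    (hm : Reduced e m) : normalMonomial e m = monomial m 1 := by
  rw [normalMonomial, monomial_eq, C_1, one_mul]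
  refine Finsupp.prod_congr fun s _ => ?_
  have h1 : m s / e s = 0 := by
    rcases Nat.eq_zero_or_pos (e s) with h | h
    · simp [h]
    · rw [Nat.div_eq_zero_iff, ← hm s]
      exact Or.inr (Nat.mod_lt _ h)
  rw [normalFactor, hm s, h1, pow_zero, mul_one]

/-- A normal monomial times a relation is a normal monomial that is not reduced; conversely, one
that is not reduced contains some relation to a positive power. The ideal is thus spanned by part of
a basis, and the complementary part descends to a basis of the quotient. -/
theorem relIdeal_eq_span (e : SteenrodGen → ℕ) :
    (relIdeal e).restrictScalars Coeff =
      Submodule.span Coeff (normalMonomial e '' {m | ¬ Reduced e m}) := by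
  refine le_antisymm ?_ (Submodule.span_le.2 ?_)
  · have htop : Submodule.span Coeff (Set.range (normalMonomial e)) = ⊤ := by
      have h := (normalBasis e).span_eq
      rwa [show ⇑(normalBasis e) = normalMonomial e from funext (normalBasis_apply e)] at h
    -- Since the normal monomials span the polynomial ring over the coefficients, their products
    -- with the relations span the ideal over the coefficients.
    rw [relIdeal, Ideal.span, ← Submodule.span_smul_of_span_eq_top htop, Submodule.span_le]
    rintro _ ⟨_, ⟨m, rfl⟩, _, ⟨s, hs, rfl⟩, rfl⟩
    change normalMonomial e m * relGen e s ∈ _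
    rw [normalMonomial_mul_relGen e hs]
    refine Submodule.subset_span ⟨_, fun h => ?_, rfl⟩
    have h1 := h s
    have h2 := Nat.mod_lt (m s) (Nat.pos_of_ne_zero hs)
    rw [Finsupp.add_apply, Finsupp.single_eq_same, Nat.add_mod_right] at h1
    omega
  · rintro _ ⟨m, hm, rfl⟩
    simp only [Set.mem_ofPred_eq, Reduced, not_forall] at hm
    obtain ⟨s, hs⟩ := hm
    have he : e s ≠ 0 := fun h => hs (by rw [h, Nat.mod_zero])
    have h1 : m s / e s ≠ 0 := fun h => hs (by
      have := Nat.mod_add_div (m s) (e s)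
      rwa [h, mul_zero, add_zero] at this)
    change normalMonomial e m ∈ relIdeal e
    rw [normalMonomial, ← Finsupp.mul_prod_erase' m s _ (normalFactor_zero e)]
    refine Ideal.mul_mem_right _ _ (Ideal.mul_mem_left _ _ ?_)
    exact Ideal.pow_mem_of_mem _ (Ideal.subset_span (Set.mem_image_of_mem _ he)) _
      (Nat.pos_of_ne_zero h1)

/-- The ring map `π` presents `B` as the quotient of the polynomial ring by `relIdeal e`. -/
structure IsPresented (e : SteenrodGen → ℕ) {B : Type*} [CommRing B] [Algebra Coeff B]
    (π : DualSteenrod →+* B) : Prop where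
  exponent_τ : ∀ i, e (.τ i) = 1 ∨ e (.τ i) = 2
  surjective : Function.Surjective π
  ker : RingHom.ker (π.comp DualSteenrod.mk) = relIdeal e
  map_algebraMap : ∀ h : Coeff, π (algebraMap _ _ h) = algebraMap _ _ h

/-- The image of a monomial. -/
def monoMap {B : Type*} [CommRing B] (π : DualSteenrod →+* B) :
    Multiplicative (SteenrodGen →₀ ℕ) →* B :=
  (π.comp DualSteenrod.mk : MvPolynomial SteenrodGen Coeff →* B).comp
    (monomialOneHom Coeff SteenrodGen)

theorem monoMap_ofAdd {B : Type*} [CommRing B] (π : DualSteenrod →+* B) (m : SteenrodGen →₀ ℕ) :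
    monoMap π (Multiplicative.ofAdd m) = π (DualSteenrod.mk (monomial m 1)) := rfl

theorem monoMap_single {B : Type*} [CommRing B] (π : DualSteenrod →+* B) (s : SteenrodGen)
    (k : ℕ) : monoMap π (Multiplicative.ofAdd (Finsupp.single s k)) =
      π (DualSteenrod.mk (X s)) ^ k := by
  rw [monoMap_ofAdd, ← X_pow_eq_monomial, map_pow, map_pow]

namespace IsPresented
variable {e : SteenrodGen → ℕ} {B : Type*} [CommRing B] [Algebra Coeff B]
  {π : DualSteenrod →+* B} (hπ : IsPresented e π)

/-- The presentation as a linear map. -/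
def toLinearMap : MvPolynomial SteenrodGen Coeff →ₗ[Coeff] B where
  toFun := π.comp DualSteenrod.mk
  map_add' := map_add _
  map_smul' h p := by
    rw [smul_eq_C_mul, map_mul, RingHom.comp_apply, DualSteenrod.mk_C, hπ.map_algebraMap,
      Algebra.smul_def]
    rfl

theorem ker_toLinearMap : LinearMap.ker hπ.toLinearMap =
    Submodule.span Coeff (normalMonomial e '' {m | ¬ Reduced e m}) := by
  rw [← relIdeal_eq_span, ← hπ.ker]
  rfl

/-- The kernel is spanned by the basis elements that are not reduced, so it meets the span of the
reduced ones trivially. -/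
theorem linearIndependent : LinearIndependent Coeff
    fun m : {m // Reduced e m} => hπ.toLinearMap (normalBasis e m) := by
  refine ((normalBasis e).linearIndependent.comp _ Subtype.val_injective).map ?_
  rw [ker_toLinearMap, ← show ⇑(normalBasis e) = normalMonomial e from
    funext (normalBasis_apply e), Set.range_comp]
  refine (normalBasis e).linearIndependent.disjoint_span_image ?_
  refine Set.disjoint_left.2 ?_
  rintro _ ⟨m, rfl⟩ h
  exact h m.2

theorem span_eq_top : ⊤ ≤ Submodule.span Coeff
    (Set.range fun m : {m // Reduced e m} => hπ.toLinearMap (normalBasis e m)) := by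
  rintro b -
  obtain ⟨x, rfl⟩ := hπ.surjective b
  obtain ⟨p, rfl⟩ := Ideal.Quotient.mk_surjective x
  change hπ.toLinearMap p ∈ _
  have hp : p ∈ Submodule.span Coeff (Set.range (normalBasis e)) := by
    rw [(normalBasis e).span_eq]; trivial
  have hle : Submodule.span Coeff (Set.range (normalBasis e)) ≤ (Submodule.span Coeff
      (Set.range fun m : {m // Reduced e m} => hπ.toLinearMap (normalBasis e m))).comap
      hπ.toLinearMap := by
    refine Submodule.span_le.2 ?_
    rintro _ ⟨m, rfl⟩
    by_cases hm : Reduced e m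
    · exact Submodule.subset_span ⟨⟨m, hm⟩, rfl⟩
    · have h : normalBasis e m ∈ LinearMap.ker hπ.toLinearMap := by
        rw [ker_toLinearMap, normalBasis_apply]
        exact Submodule.subset_span ⟨m, hm, rfl⟩
      rw [SetLike.mem_coe, Submodule.mem_comap, LinearMap.mem_ker.1 h]
      exact zero_mem _
  exact hle hp

/-- The reduced monomials form a basis. -/
def basis : Module.Basis {m // Reduced e m} Coeff B :=
  Module.Basis.mk hπ.linearIndependent hπ.span_eq_top

theorem basis_apply (m : {m // Reduced e m}) :
    hπ.basis m = monoMap π (Multiplicative.ofAdd m.1) := by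
  rw [basis, Module.Basis.mk_apply, normalBasis_apply, normalMonomial_of_reduced m.2]
  rfl

theorem X_pow_eq_zero (hπ : IsPresented e π) {s : SteenrodGen} (hs : e s ≠ 0)
    (h2 : ∀ i, s = .τ i → e s ≠ 2) :
    π (DualSteenrod.mk (X s)) ^ e s = 0 := by
  have h : relGen e s ∈ RingHom.ker (π.comp DualSteenrod.mk) := by
    rw [hπ.ker]
    exact Ideal.subset_span ⟨s, hs, rfl⟩
  rw [RingHom.mem_ker] at h
  have h1 : relGen e s = X s ^ e s := by
    cases s with
    | τ i => rw [relGen, if_neg (h2 i rfl)]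
    | ξ i => rfl
  rwa [h1, map_pow] at h

/-- A monomial that is not reduced, but contains no `τ_i ^ 2`, vanishes. -/
theorem monoMap_eq_zero (hπ : IsPresented e π) {m : SteenrodGen →₀ ℕ} (hm : ¬ Reduced e m)
    (hτ : ∀ i, m (.τ i) < 2) :
    monoMap π (Multiplicative.ofAdd m) = 0 := by
  simp only [Reduced, not_forall] at hm
  obtain ⟨s, hs⟩ := hm
  have he : e s ≠ 0 := fun h => hs (by rw [h, Nat.mod_zero])
  have hle : e s ≤ m s := by
    by_contra h
    exact hs (Nat.mod_eq_of_lt (not_le.1 h))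
  have h2 : ∀ i, s = .τ i → e s ≠ 2 := by
    rintro i rfl h
    have := hτ i
    omega
  have h : m = Finsupp.single s (e s) + (m - Finsupp.single s (e s)) := by
    classical
    ext t
    simp only [Finsupp.add_apply, Finsupp.tsub_apply, Finsupp.single_apply]
    split_ifs with h
    · subst h; omega
    · omega
  rw [h, ofAdd_add, map_mul, monoMap_single, hπ.X_pow_eq_zero he h2, zero_mul]

end IsPresented

end Presentation

/-! ### The coaction on monomials: leading terms and coinvariants. -/

section CofreeSteenrod
open MvPolynomial

/-- The degree of a monomial in the first component of the grading. -/
def monoWeight : (SteenrodGen →₀ ℕ) →+ ℕ :=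
  Finsupp.weight fun s => match s with
    | .τ i => 2 ^ i
    | .ξ i => 2 ^ (i + 1) - 1

/-- The rank of a pair of monomials: first the total number of factors `τ_i`, then the degree of
the left monomial. -/
def biRank : ((SteenrodGen →₀ ℕ) × (SteenrodGen →₀ ℕ)) →+ ℕ ×ₗ ℕ where
  toFun x := toLex (numTau x.1 + numTau x.2, monoWeight x.1)
  map_zero' := by simp
  map_add' x y := by
    rw [← toLex_add, Prod.mk_add_mk (numTau x.1 + _), Prod.fst_add, Prod.snd_add, map_add,
      map_add, map_add, add_add_add_comm]

theorem biRank_lt {x y : (SteenrodGen →₀ ℕ) × (SteenrodGen →₀ ℕ)} :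
    biRank x < biRank y ↔ numTau x.1 + numTau x.2 < numTau y.1 + numTau y.2 ∨
      (numTau x.1 + numTau x.2 = numTau y.1 + numTau y.2 ∧ monoWeight x.1 < monoWeight y.1) :=
  Prod.Lex.toLex_lt_toLex

/-- The monomial `ξ_i`, where `ξ_0 = 1`. -/
def xiMono : ℕ → SteenrodGen →₀ ℕ
  | 0 => 0
  | i + 1 => Finsupp.single (.ξ i) 1

theorem numTau_xiMono (i : ℕ) : numTau (xiMono i) = 0 := by
  cases i <;> simp [xiMono]

theorem monoWeight_xiMono (i : ℕ) : monoWeight (xiMono i) = 2 ^ i - 1 := by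
  cases i <;> simp [xiMono, monoWeight, Finsupp.weight_single]

theorem monoWeight_τ (i : ℕ) : monoWeight (Finsupp.single (.τ i) 1) = 2 ^ i := by
  simp [monoWeight, Finsupp.weight_single]

theorem monoMap_xiMono {B : Type*} [CommRing B] (π : DualSteenrod →+* B) (i : ℕ) :
    monoMap π (Multiplicative.ofAdd (xiMono i)) = π (DualSteenrod.ξ i) := by
  cases i with
  | zero => simp [xiMono, DualSteenrod.ξ]
  | succ i => rw [xiMono, monoMap_single, pow_one]; rfl

theorem monoMap_τ {B : Type*} [CommRing B] (π : DualSteenrod →+* B) (i : ℕ) :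
    monoMap π (Multiplicative.ofAdd (Finsupp.single (.τ i) 1)) = π (DualSteenrod.τ i) := by
  rw [monoMap_single, pow_one]; rfl

/-- Rewriting `τ_i ^ 2` in a monomial. -/
theorem monoMap_sq {B : Type*} [CommRing B] [Algebra Coeff B] {π : DualSteenrod →+* B}
    (hπ : ∀ h : Coeff, π (algebraMap _ _ h) = algebraMap _ _ h) (m : SteenrodGen →₀ ℕ) (i : ℕ) :
    monoMap π (Multiplicative.ofAdd (m + Finsupp.single (.τ i) 2)) =
      algebraMap Coeff B Coeff.a *
        monoMap π (Multiplicative.ofAdd (m + Finsupp.single (.τ (i + 1)) 1)) +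
      (algebraMap Coeff B Coeff.u *
        monoMap π (Multiplicative.ofAdd (m + xiMono (i + 1))) +
      algebraMap Coeff B Coeff.a * monoMap π
        (Multiplicative.ofAdd (m + Finsupp.single (.τ 0) 1 + xiMono (i + 1)))) := by
  have h := congrArg π (DualSteenrod.τ_sq i)
  simp only [map_pow, map_add, map_mul, hπ] at h
  simp only [ofAdd_add, map_mul, monoMap_τ, monoMap_xiMono]
  rw [monoMap_single, show π (DualSteenrod.mk (X (.τ i))) = π (DualSteenrod.τ i) from rfl, h]
  ring

/-- The exponents of the quotient in which `ξ_i ^ (2 ^ h i) = 0` for `i ≥ 1` and `τ_i = 0` for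
`i ≥ n`. -/
def shapeExp (h : ℕ → ℕ) (n : ℕ) : SteenrodGen → ℕ
  | .τ i => if i < n then 2 else 1
  | .ξ i => 2 ^ h (i + 1)

/-- The condition under which `ξ_i ^ (2 ^ h i)` for `i ≥ 1` and `τ_i` for `i ≥ n` generate a Hopf
algebroid ideal. -/
structure IsHopfShape (h : ℕ → ℕ) (n : ℕ) : Prop where
  le_sub : ∀ k, h (k + 1) ≤ n - (k + 1)
  le_add : ∀ k j, h (k + 1) ≤ j + h (k + 1 + j)

variable {B : Type*} [CommRing B] [Algebra Coeff B] {𝒷 : RO → AddSubgroup B}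
variable {C : Type*} [CommRing C] [Algebra Coeff C] {𝒸 : RO → AddSubgroup C}
variable {X : HopfAlgebroid Coeff.deg 𝒷} {Y : HopfAlgebroid Coeff.deg 𝒸}
variable (q : HopfAlgebroid.Hom DualSteenrod.hopfAlgebroid X) (f : HopfAlgebroid.Hom X Y)

/-- The coaction of `C` on `B`, restricted to the dual Steenrod algebra. -/
def coactHom : DualSteenrod →+* BiTensor Y.ηR B :=
  (BiTensor.ringLift DualSteenrod.ηR
    ((BiTensor.inl Y.ηR B).comp (f.toRingHom.comp q.toRingHom))
    ((BiTensor.inr Y.ηR).comp q.toRingHom) (fun h => by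
      have h1 := q.map_ηR h
      have h2 := q.map_ηL h
      simp only [RingHom.comp_apply]
      rw [show DualSteenrod.ηR h = DualSteenrod.hopfAlgebroid.ηR h from rfl, h1, f.map_ηR, h2,
        BiTensor.inl_ηR])).comp DualSteenrod.Δ

/-- The coaction is by definition only linear. Identified with a ring map, it can be computed on
monomials from its values on the τ_i and ξ_i. -/
theorem coact_eq (x : DualSteenrod) : f.comodule.coact (q.toRingHom x) = coactHom q f x := by
  change f.mapLeft B (X.Δ (q.toRingHom x)) = _
  rw [q.map_Δ, coactHom, RingHom.comp_apply,
    show DualSteenrod.hopfAlgebroid.Δ x = DualSteenrod.Δ x from rfl]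
  induction DualSteenrod.Δ x using BiTensor.induction with
  | zero => rw [map_zero]; exact (congrArg _ (map_zero _)).trans (map_zero _)
  | pure a b =>
    rw [BiTensor.ringLift_tmul]
    refine (congrArg (f.mapLeft B) (BiTensor.ringLift_tmul _ _ _ _ a b)).trans ?_
    rw [RingHom.comp_apply, RingHom.comp_apply, ← BiTensor.tmul_eq, f.mapLeft_tmul,
      BiTensor.tmul_eq]
    rfl
  | add x y hx hy =>
    rw [map_add, ← hx, ← hy]
    exact (congrArg _ (map_add _ _ _)).trans (map_add _ _ _)

theorem coactHom_ξ (n : ℕ) : coactHom q f (DualSteenrod.ξ n) =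
    conv (fun p => BiTensor.inl Y.ηR B (f.toRingHom (q.toRingHom (DualSteenrod.ξ p))))
      (fun p => BiTensor.inr Y.ηR (q.toRingHom (DualSteenrod.ξ p))) n := by
  rw [coactHom, RingHom.comp_apply, DualSteenrod.Δ_ξ, map_conv]
  simp only [BiTensor.ringLift_inl, BiTensor.ringLift_inr, RingHom.comp_apply]

theorem coactHom_τ (n : ℕ) : coactHom q f (DualSteenrod.τ n) =
    conv (fun p => BiTensor.inl Y.ηR B (f.toRingHom (q.toRingHom (DualSteenrod.ξ p))))
      (fun p => BiTensor.inr Y.ηR (q.toRingHom (DualSteenrod.τ p))) n +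
    BiTensor.inl Y.ηR B (f.toRingHom (q.toRingHom (DualSteenrod.τ n))) := by
  rw [coactHom, RingHom.comp_apply, DualSteenrod.Δ_τ, map_add, map_conv]
  simp only [BiTensor.ringLift_inl, BiTensor.ringLift_inr, RingHom.comp_apply]

/-- The tensor product of two monomials. -/
def biMono : Multiplicative ((SteenrodGen →₀ ℕ) × (SteenrodGen →₀ ℕ)) →* BiTensor Y.ηR B where
  toFun x := BiTensor.tmul Y.ηR
    (monoMap (f.toRingHom.comp q.toRingHom) (Multiplicative.ofAdd x.toAdd.1))
    (monoMap q.toRingHom (Multiplicative.ofAdd x.toAdd.2))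
  map_one' := by simp [BiTensor.one_def]
  map_mul' x y := by
    simp [BiTensor.tmul_mul_tmul, ofAdd_add]

theorem biMono_apply (m₁ m₂ : SteenrodGen →₀ ℕ) :
    biMono q f (Multiplicative.ofAdd (m₁, m₂)) = BiTensor.tmul Y.ηR
      (monoMap (f.toRingHom.comp q.toRingHom) (Multiplicative.ofAdd m₁))
      (monoMap q.toRingHom (Multiplicative.ofAdd m₂)) := rfl

/-- Each term of the coaction on τ_n contains exactly one τ, and each term for ξ_n none, so the
weight of the left factor decides. The left factor ξ_p^{2^r}, p + r = n, has weight 2^n - 2^r. This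
is less than the weight 2^n of τ_n and, for r ≥ 1, less than the weight 2^n - 1 of ξ_n. Hence τ_n ⊗
1 and ξ_n ⊗ 1 lead. -/
theorem hasLeading_coactHom_X (s : SteenrodGen) :
    HasLeading Coeff (biMono q f) biRank (coactHom q f (DualSteenrod.mk (MvPolynomial.X s)))
      (Finsupp.single s 1, 0) := by
  have hterm : ∀ p k : ℕ, ∀ m₂ : SteenrodGen →₀ ℕ,
      BiTensor.inl Y.ηR B (f.toRingHom (q.toRingHom (DualSteenrod.ξ p))) ^ k *
        BiTensor.inr Y.ηR (monoMap q.toRingHom (Multiplicative.ofAdd m₂)) =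
      biMono q f (Multiplicative.ofAdd (k • xiMono p, m₂)) := fun p k m₂ => by
    rw [biMono_apply, BiTensor.tmul_eq, ofAdd_nsmul, map_pow, monoMap_xiMono, map_pow]
    rfl
  have hpow : ∀ p k : ℕ, 2 ^ k * (2 ^ p - 1) = 2 ^ (p + k) - 2 ^ k := fun p k => by
    rw [Nat.mul_sub, mul_one, ← pow_add, add_comm]
  unfold HasLeading
  cases s with
  | τ i =>
    rw [show DualSteenrod.mk (MvPolynomial.X (.τ i)) = DualSteenrod.τ i from rfl, coactHom_τ,
      biMono_apply, monoMap_τ, ofAdd_zero, map_one, ← BiTensor.inl_apply, RingHom.comp_apply,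
      add_sub_cancel_right, conv]
    refine sum_mem fun p hp => ?_
    rw [Finset.HasAntidiagonal.mem_antidiagonal] at hp
    rw [← monoMap_τ q.toRingHom, hterm]
    refine Submodule.subset_span ⟨_, ?_, rfl⟩
    refine biRank_lt.2 (Or.inr ⟨?_, ?_⟩)
    · simp [numTau_xiMono]
    · have h1 := hpow p.1 p.2
      have h2 : 0 < 2 ^ p.2 := by positivity
      have h3 : 0 < 2 ^ (p.1 + p.2) := by positivity
      simp only [map_nsmul, monoWeight_xiMono, monoWeight_τ, smul_eq_mul, h1, ← hp]
      omega
  | ξ i =>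
    rw [show DualSteenrod.mk (MvPolynomial.X (.ξ i)) = DualSteenrod.ξ (i + 1) from rfl, coactHom_ξ,
      biMono_apply, show Finsupp.single (SteenrodGen.ξ i) 1 = xiMono (i + 1) from rfl,
      monoMap_xiMono, ofAdd_zero, map_one, ← BiTensor.inl_apply, RingHom.comp_apply, conv,
      Finset.Nat.sum_antidiagonal_succ', pow_zero, pow_one,
      show DualSteenrod.ξ 0 = 1 from rfl, map_one, map_one, mul_one, add_sub_cancel_left]
    refine sum_mem fun p hp => ?_
    rw [Finset.HasAntidiagonal.mem_antidiagonal] at hp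
    rw [← monoMap_xiMono q.toRingHom (p.2 + 1), hterm]
    refine Submodule.subset_span ⟨_, ?_, rfl⟩
    refine biRank_lt.2 (Or.inr ⟨?_, ?_⟩)
    · simp [numTau_xiMono]
    · have h1 := hpow p.1 (p.2 + 1)
      -- The term r = 0, which is the leading one, has been split off. With r ≥ 1 the bound 2^r ≥ 2
      -- makes the comparison with 2^n - 1 strict.
      have h2 : 2 ≤ 2 ^ (p.2 + 1) := Nat.le_self_pow (Nat.succ_ne_zero _) 2
      have h3 : 2 ^ (p.2 + 1) ≤ 2 ^ (p.1 + (p.2 + 1)) :=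
        Nat.pow_le_pow_right (by norm_num) (by omega)
      simp only [map_nsmul, monoWeight_xiMono, smul_eq_mul, h1, ← hp, ← add_assoc]
      rw [← add_assoc] at h3
      omega

theorem hasLeading_coactHom (m : SteenrodGen →₀ ℕ) :
    HasLeading Coeff (biMono q f) biRank (coactHom q f (DualSteenrod.mk (monomial m 1)))
      (m, 0) := by
  induction m using Finsupp.induction_linear with
  | zero =>
    rw [monomial_zero', C_1, map_one, map_one]
    exact HasLeading.one
  | add m n hm hn =>
    have h := hm.mul hn
    rwa [← map_mul, ← map_mul, monomial_mul, one_mul, Prod.mk_add_mk, add_zero] at h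
  | single s k =>
    have h := (hasLeading_coactHom_X q f s).pow k
    rwa [← map_pow, ← map_pow, X_pow_eq_monomial, Prod.smul_mk, smul_zero, Finsupp.smul_single,
      smul_eq_mul, mul_one] at h

section Coinvariant
variable {q f} {h : ℕ → ℕ} {n : ℕ}

theorem IsPresented.ξ_pow_eq_zero {π : DualSteenrod →+* C} (hC : IsPresented (shapeExp h n) π)
    {k N : ℕ} (hN : h (k + 1) ≤ N) : π (DualSteenrod.ξ (k + 1)) ^ 2 ^ N = 0 := by
  have h1 := hC.X_pow_eq_zero (s := .ξ k) (by simp [shapeExp]) (by simp)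
  exact pow_eq_zero_of_le (Nat.pow_le_pow_right (by norm_num) hN) h1

theorem IsPresented.τ_eq_zero {π : DualSteenrod →+* C} (hC : IsPresented (shapeExp h n) π)
    {k : ℕ} (hk : n ≤ k) : π (DualSteenrod.τ k) = 0 := by
  have h0 : shapeExp h n (.τ k) = 1 := by simp [shapeExp, hk]
  have h1 := hC.X_pow_eq_zero (s := .τ k) (by simp [h0]) (by simp [h0])
  rwa [h0, pow_one] at h1

/-- By Frobenius, the terms are ξ_p^{2^{r+h(p+r)}} ⊗ ξ_r^{2^{h(p+r)}} with p + r = i + 1. For p ≥ 1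
the left factor vanishes in `C` because h(p) ≤ r + h(p+r), so only p = 0 remains. -/
theorem coactHom_ξ_pow (hC : IsPresented (shapeExp h n) (f.toRingHom.comp q.toRingHom))
    (hs : IsHopfShape h n) (i : ℕ) :
    coactHom q f (DualSteenrod.ξ (i + 1)) ^ 2 ^ h (i + 1) =
    BiTensor.inr Y.ηR (q.toRingHom (DualSteenrod.ξ (i + 1))) ^ 2 ^ h (i + 1) := by
  have h2 : (2 : BiTensor Y.ηR B) = 0 := Coeff.map_two (algebraMap _ _)
  rw [coactHom_ξ, conv, sum_pow_two_pow h2, Finset.Nat.sum_antidiagonal_succ,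
    Finset.sum_eq_zero, add_zero]
  · simp [show DualSteenrod.ξ 0 = 1 from rfl]
  · intro p hp
    rw [Finset.HasAntidiagonal.mem_antidiagonal] at hp
    have h1 := hs.le_add p.1 p.2
    rw [show p.1 + 1 + p.2 = i + 1 by omega] at h1
    have h3 := hC.ξ_pow_eq_zero h1
    rw [RingHom.comp_apply] at h3
    rw [mul_pow, ← pow_mul, ← pow_add, ← map_pow, h3, map_zero, zero_mul]

/-- In `C` the term τ_i ⊗ 1 is zero, and so is ξ_p^{2^k} for p ≥ 1 and p + k = i, as h(p) ≤ n - p ≤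
k. Only 1 ⊗ τ_i remains. -/
theorem coactHom_τ_of_le (hC : IsPresented (shapeExp h n) (f.toRingHom.comp q.toRingHom))
    (hs : IsHopfShape h n) {i : ℕ} (hi : n ≤ i) :
    coactHom q f (DualSteenrod.τ i) =
    BiTensor.inr Y.ηR (q.toRingHom (DualSteenrod.τ i)) := by
  have h1 := hC.τ_eq_zero hi
  rw [RingHom.comp_apply] at h1
  rw [coactHom_τ, h1, map_zero, add_zero, conv, Finset.sum_eq_single (0, i)]
  · simp [show DualSteenrod.ξ 0 = 1 from rfl]
  · rintro ⟨p, k⟩ hp hne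
    rw [Finset.HasAntidiagonal.mem_antidiagonal] at hp
    cases p with
    | zero => simp_all
    | succ p =>
      have h2 := hs.le_sub p
      have h3 := hC.ξ_pow_eq_zero (k := p) (N := k) (by simp only at hp; omega)
      rw [RingHom.comp_apply] at h3
      rw [← map_pow, h3, map_zero, zero_mul]
  · intro h; simp at h

/-- A monomial in the elements `ξ_i ^ (2 ^ h i)` and `τ_i`, `i ≥ n`, is coinvariant. -/
theorem coactHom_coinvariant (hC : IsPresented (shapeExp h n) (f.toRingHom.comp q.toRingHom))
    (hs : IsHopfShape h n) {m : SteenrodGen →₀ ℕ}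
    (hm : ∀ s, m s % shapeExp h n s = 0) (hτ : ∀ i, m (.τ i) < 2) :
    coactHom q f (DualSteenrod.mk (monomial m 1)) = biMono q f (Multiplicative.ofAdd (0, m)) := by
  have h1 : ∀ s, coactHom q f (DualSteenrod.mk (MvPolynomial.X s)) ^ m s =
      BiTensor.inr Y.ηR (q.toRingHom (DualSteenrod.mk (MvPolynomial.X s))) ^ m s := by
    rintro (i | i)
    · by_cases hi : i < n
      -- For i < n the exponent of τ_i is even and less than 2, hence zero. These τ_i are not
      -- coinvariant in general, but they do not occur.
      · have h2 := hm (.τ i)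
        have h3 := hτ i
        rw [shapeExp, if_pos hi] at h2
        rw [show m (.τ i) = 0 by omega, pow_zero, pow_zero]
      · exact congrArg (· ^ m (.τ i)) (coactHom_τ_of_le hC hs (not_lt.1 hi))
    · obtain ⟨k, hk⟩ := Nat.dvd_of_mod_eq_zero (hm (.ξ i))
      rw [hk, pow_mul, pow_mul]
      exact congrArg (· ^ k) (coactHom_ξ_pow hC hs i)
  rw [biMono_apply, ofAdd_zero, map_one (monoMap _), ← BiTensor.inr_apply, monoMap_ofAdd,
    monomial_eq, C_1, one_mul, Finsupp.prod]
  simp only [map_prod, map_pow]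
  exact Finset.prod_congr rfl fun s _ => h1 s

end Coinvariant

end CofreeSteenrod

/-! ### Cofreeness for presented quotients. -/

section CofreeTheorem
open MvPolynomial

variable {B : Type*} [CommRing B] [Algebra Coeff B] {𝒷 : RO → AddSubgroup B}
variable {C : Type*} [CommRing C] [Algebra Coeff C] {𝒸 : RO → AddSubgroup C}
variable {X : HopfAlgebroid Coeff.deg 𝒷} {Y : HopfAlgebroid Coeff.deg 𝒸}
variable (q : HopfAlgebroid.Hom DualSteenrod.hopfAlgebroid X) (f : HopfAlgebroid.Hom X Y)

/-- The reduced monomials for the exponents `e` in which the exponent of `s` is divisible by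
`e' s`. -/
abbrev CofreeIndex (e e' : SteenrodGen → ℕ) : Type :=
  {m : SteenrodGen →₀ ℕ // Reduced e m ∧ ∀ s, m s % e' s = 0}

theorem Reduced.lt {e : SteenrodGen → ℕ} {m : SteenrodGen →₀ ℕ} (hm : Reduced e m)
    {s : SteenrodGen} (hs : e s ≠ 0) : m s < e s := by
  rw [← hm s]
  exact Nat.mod_lt _ (Nat.pos_of_ne_zero hs)

theorem reduced_of_lt {e : SteenrodGen → ℕ} {m : SteenrodGen →₀ ℕ}
    (hm : ∀ s, e s ≠ 0 → m s < e s) : Reduced e m := fun s => by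
  by_cases hs : e s = 0
  · rw [hs, Nat.mod_zero]
  · exact Nat.mod_eq_of_lt (hm s hs)

/-- If e = e'k and m = e'l at some variable, then m < e gives l + 1 ≤ k, so adding c < e' stays
below e'(l + 1) ≤ e. Divisibility of the exponents is what makes this work. -/
theorem reduced_add {e e' : SteenrodGen → ℕ} (hdvd : ∀ s, e' s ∣ e s) (hpos : ∀ s, e' s ≠ 0)
    {m c : SteenrodGen →₀ ℕ} (hm : Reduced e m) (hm' : ∀ s, m s % e' s = 0) (hc : Reduced e' c) :
    Reduced e (c + m) := by
  refine reduced_of_lt fun s hs => ?_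
  have h1 := hm.lt hs
  have h2 := hc.lt (hpos s)
  obtain ⟨k, hk⟩ := hdvd s
  obtain ⟨l, hl⟩ := Nat.dvd_of_mod_eq_zero (hm' s)
  rw [Finsupp.add_apply]
  rw [hk, hl] at h1
  have h3 : l + 1 ≤ k := lt_of_mul_lt_mul_left h1 (Nat.zero_le _)
  have h4 := Nat.mul_le_mul_left (e' s) h3
  rw [hk, hl]
  linarith

/-- A reduced monomial for `e` is uniquely the product of a reduced monomial for `e'` and a
monomial whose exponents are divisible by those of `e'`. -/
theorem reduced_bijective {e e' : SteenrodGen → ℕ} (hdvd : ∀ s, e' s ∣ e s)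
    (hpos : ∀ s, e' s ≠ 0) :
    Function.Bijective fun x : (Σ _ : CofreeIndex e e', {c // Reduced e' c}) =>
      (⟨x.2.1 + x.1.1, reduced_add hdvd hpos x.1.2.1 x.1.2.2 x.2.2⟩ : {m // Reduced e m}) := by
  constructor
  · rintro ⟨⟨m, hm⟩, ⟨c, hc⟩⟩ ⟨⟨m', hm'⟩, ⟨c', hc'⟩⟩ h
    have h1 : c + m = c' + m' := congrArg Subtype.val h
    have h2 : c = c' := by
      ext s
      have h3 := DFunLike.congr_fun h1 s
      simp only [Finsupp.add_apply] at h3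
      have h4 := congrArg (· % e' s) h3
      simp only [Nat.add_mod, hm.2 s, hm'.2 s, add_zero, Nat.mod_mod] at h4
      rwa [hc s, hc' s] at h4
    subst h2
    have h3 := add_left_cancel h1
    subst h3
    rfl
  · rintro ⟨m, hm⟩
    have hfin : ∀ s, m s % e' s ≠ 0 → s ∈ m.support := fun s hs => by
      rw [Finsupp.mem_support_iff]
      intro h
      rw [h, Nat.zero_mod] at hs
      exact hs rfl
    -- Division with remainder in each exponent: `c` collects the remainders, and `m - c` has
    -- exponents divisible by those of `e'`.
    let c : SteenrodGen →₀ ℕ := Finsupp.onFinset m.support (fun s => m s % e' s) hfin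
    have hle : ∀ s, c s ≤ m s := fun s => Nat.mod_le _ _
    refine ⟨⟨⟨m - c, reduced_of_lt fun s hs => ?_, fun s => ?_⟩, ⟨c, fun s => ?_⟩⟩, ?_⟩
    · exact lt_of_le_of_lt (Nat.sub_le _ _) (hm.lt hs)
    · exact Nat.sub_mod_eq_zero_of_mod_eq (Nat.mod_mod _ _).symm
    · exact Nat.mod_mod _ _
    · refine Subtype.ext (Finsupp.ext fun s => ?_)
      exact Nat.add_sub_cancel' (hle s)

/-- The projection of `B` onto the span of the monomials in `CofreeIndex e e'`. -/
def cofreeProj {e : SteenrodGen → ℕ} (e' : SteenrodGen → ℕ) {π : DualSteenrod →+* B}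
    (hB : IsPresented e π) : B →ₗ[Coeff] CofreeIndex e e' →₀ Coeff :=
  (Finsupp.lcomapDomain (fun m => (⟨m.1, m.2.1⟩ : {m // Reduced e m}))
    (fun _ _ h => Subtype.ext (congrArg (fun x => x.1) h))).comp hB.basis.repr.toLinearMap

theorem cofreeProj_apply {e e' : SteenrodGen → ℕ} {π : DualSteenrod →+* B}
    (hB : IsPresented e π) (b : B) (m : CofreeIndex e e') :
    cofreeProj e' hB b m = hB.basis.repr b ⟨m.1, m.2.1⟩ := rfl

theorem cofreeProj_monoMap {e e' : SteenrodGen → ℕ} {π : DualSteenrod →+* B}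
    (hB : IsPresented e π) (m : CofreeIndex e e') :
    cofreeProj e' hB (monoMap π (Multiplicative.ofAdd m.1)) = Finsupp.single m 1 := by
  classical
  ext m'
  rw [cofreeProj_apply, ← hB.basis_apply ⟨m.1, m.2.1⟩, hB.basis.repr_self, Finsupp.single_apply,
    Finsupp.single_apply]
  simp only [Subtype.ext_iff]

theorem cofreeProj_monoMap_eq_zero {e e' : SteenrodGen → ℕ} {π : DualSteenrod →+* B}
    (hB : IsPresented e π) {m : SteenrodGen →₀ ℕ} (hm : Reduced e m)
    (hm' : ¬ ∀ s, m s % e' s = 0) :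
    cofreeProj e' hB (monoMap π (Multiplicative.ofAdd m)) = 0 := by
  classical
  ext m'
  rw [cofreeProj_apply, ← hB.basis_apply ⟨m, hm⟩, hB.basis.repr_self, Finsupp.single_apply,
    if_neg, Finsupp.zero_apply]
  intro h
  exact hm' (by rw [show m = m'.1 from congrArg (fun x => x.1) h]; exact m'.2.2)

section
variable {q f} {e e' : SteenrodGen → ℕ}
variable (hB : IsPresented e q.toRingHom)
  (hC : IsPresented e' (f.toRingHom.comp q.toRingHom))

/-- The rank of a basis element of the cofree comodule. -/
def cofreeRank (x : Σ _ : CofreeIndex e e', {c // Reduced e' c}) : ℕ ×ₗ ℕ :=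
  biRank (x.2.1, x.1.1)

/-- The image in the cofree comodule of a tensor product of two monomials is a linear combination
of basis elements of at most the same rank. -/
theorem mapRight_biMono_mem (m₁ m₂ : SteenrodGen →₀ ℕ) :
    BiTensor.mapRight Y.ηR (cofreeProj e' hB) (biMono q f (Multiplicative.ofAdd (m₁, m₂))) ∈
      Submodule.span Coeff (BiTensor.basis Y.ηR (CofreeIndex e e') hC.basis ''
        {x | cofreeRank x ≤ biRank (m₁, m₂)}) := by
  classical
  induction hN : numTau m₁ + numTau m₂ using Nat.strong_induction_on generalizing m₁ m₂ with
  | _ N ih =>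
    subst hN
    let S := Submodule.span Coeff (BiTensor.basis Y.ηR (CofreeIndex e e') hC.basis ''
        {x | cofreeRank x ≤ biRank (m₁, m₂)})
    let L := BiTensor.mapRight Y.ηR (cofreeProj e' hB)
    -- A pair with fewer τ's has smaller rank whatever its weights, because the number of τ's is the
    -- first component of the rank. The induction hypothesis then places its image in `S`.
    have step : ∀ (h : Coeff) (n₁ n₂ : SteenrodGen →₀ ℕ),
        numTau n₁ + numTau n₂ < numTau m₁ + numTau m₂ →
        L (h • biMono q f (Multiplicative.ofAdd (n₁, n₂))) ∈ S := by
      intro h n₁ n₂ hlt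
      have h1 := ih _ hlt n₁ n₂ rfl
      have h2 : L (h • biMono q f (Multiplicative.ofAdd (n₁, n₂))) =
          h • L (biMono q f (Multiplicative.ofAdd (n₁, n₂))) := map_smul L h _
      rw [h2]
      refine Submodule.smul_mem _ _ (Submodule.span_mono (Set.image_mono fun x hx => ?_) h1)
      exact le_trans hx (le_of_lt (biRank_lt.2 (Or.inl hlt)))
    have hsplit : ∀ (m : SteenrodGen →₀ ℕ) (i : ℕ), 2 ≤ m (.τ i) →
        ∃ m', m = m' + Finsupp.single (.τ i) 2 := fun m i hi => by
      refine ⟨m - Finsupp.single (.τ i) 2, ?_⟩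
      ext t
      simp only [Finsupp.add_apply, Finsupp.tsub_apply, Finsupp.single_apply]
      split_ifs with h
      · subst h; omega
      · omega
    change L (biMono q f (Multiplicative.ofAdd (m₁, m₂))) ∈ S
    by_cases h1 : ∃ i, 2 ≤ m₁ (.τ i)
    · obtain ⟨i, hi⟩ := h1
      obtain ⟨m, rfl⟩ := hsplit _ i hi
      have key : biMono q f (Multiplicative.ofAdd (m + Finsupp.single (.τ i) 2, m₂)) =
          Coeff.a • biMono q f (Multiplicative.ofAdd (m + Finsupp.single (.τ (i + 1)) 1, m₂)) +
          (Coeff.u • biMono q f (Multiplicative.ofAdd (m + xiMono (i + 1), m₂)) +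
          Coeff.a • biMono q f
            (Multiplicative.ofAdd (m + Finsupp.single (.τ 0) 1 + xiMono (i + 1), m₂))) := by
        simp only [biMono_apply]
        rw [monoMap_sq hC.map_algebraMap, BiTensor.add_tmul, BiTensor.add_tmul]
        rfl
      rw [key, map_add, map_add]
      refine add_mem (step _ _ _ ?_) (add_mem (step _ _ _ ?_) (step _ _ _ ?_)) <;>
        simp only [map_add, numTau_τ, numTau_xiMono] <;> omega
    by_cases h2 : ∃ i, 2 ≤ m₂ (.τ i)
    · obtain ⟨i, hi⟩ := h2
      obtain ⟨m, rfl⟩ := hsplit _ i hi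
      have ha : Y.ηR Coeff.a = algebraMap Coeff C Coeff.a := by
        rw [← f.map_ηR, ← q.map_ηR, show DualSteenrod.hopfAlgebroid.ηR = DualSteenrod.ηR from rfl,
          DualSteenrod.ηR_a, q.map_ηL, f.map_ηL]
      have hu : Y.ηR Coeff.u = algebraMap Coeff C Coeff.u + algebraMap Coeff C Coeff.a *
          f.toRingHom (q.toRingHom (DualSteenrod.τ 0)) := by
        rw [← f.map_ηR, ← q.map_ηR, show DualSteenrod.hopfAlgebroid.ηR = DualSteenrod.ηR from rfl,
          DualSteenrod.ηR_u, map_add, map_add, map_mul, map_mul, q.map_ηL, f.map_ηL, q.map_ηL,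
          f.map_ηL]
      -- The coefficients of the relation for τ_i² in the right factor move to the left one through
      -- the right unit. As `ηR` maps u to u + aτ_0, an extra τ_0 appears on the left, but each new
      -- term still has at most one τ in place of the two removed.
      have key : biMono q f (Multiplicative.ofAdd (m₁, m + Finsupp.single (.τ i) 2)) =
          Coeff.a • biMono q f (Multiplicative.ofAdd (m₁, m + Finsupp.single (.τ (i + 1)) 1)) +
          ((Coeff.u • biMono q f (Multiplicative.ofAdd (m₁, m + xiMono (i + 1))) +
          Coeff.a • biMono q f
            (Multiplicative.ofAdd (m₁ + Finsupp.single (.τ 0) 1, m + xiMono (i + 1)))) +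
          Coeff.a • biMono q f
            (Multiplicative.ofAdd (m₁, m + Finsupp.single (.τ 0) 1 + xiMono (i + 1)))) := by
        simp only [biMono_apply]
        rw [monoMap_sq hB.map_algebraMap, BiTensor.tmul_add, BiTensor.tmul_add,
          ← Algebra.smul_def, ← Algebra.smul_def, ← Algebra.smul_def, ← BiTensor.balanced,
          ← BiTensor.balanced, ← BiTensor.balanced, ha, hu, mul_add, BiTensor.add_tmul]
        simp only [BiTensor.hsmul_def, BiTensor.smul_tmul, ofAdd_add, map_mul, monoMap_τ,
          RingHom.comp_apply]
        simp only [mul_comm, mul_left_comm, mul_assoc]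
      rw [key, map_add, map_add, map_add]
      refine add_mem (step _ _ _ ?_) (add_mem (add_mem (step _ _ _ ?_) (step _ _ _ ?_))
        (step _ _ _ ?_)) <;> simp only [map_add, numTau_τ, numTau_xiMono] <;> omega
    -- Without any τ_i², a monomial that is not reduced is zero in its quotient. For reduced
    -- monomials the projection leaves either a basis element of the same rank or zero.
    push Not at h1 h2
    change BiTensor.tmul Y.ηR _ (cofreeProj e' hB _) ∈ S
    have hzero : ∀ m : CofreeIndex e e' →₀ Coeff, BiTensor.tmul Y.ηR (0 : C) m = 0 := fun m =>
      (BiTensor.mkLeft Y.ηR m).map_zero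
    have hzero' : ∀ c : C, BiTensor.tmul Y.ηR c (0 : CofreeIndex e e' →₀ Coeff) = 0 := fun c =>
      (BiTensor.tmulHom Y.ηR c).map_zero
    by_cases h3 : Reduced e' m₁
    · by_cases h4 : Reduced e m₂
      · by_cases h5 : ∀ s, m₂ s % e' s = 0
        · refine Submodule.subset_span ⟨⟨⟨m₂, h4, h5⟩, ⟨m₁, h3⟩⟩,
            le_refl (biRank (m₁, m₂)), ?_⟩
          rw [BiTensor.basis_apply, hC.basis_apply]
          exact congrArg _ (cofreeProj_monoMap hB ⟨m₂, h4, h5⟩).symm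
        · have := cofreeProj_monoMap_eq_zero hB h4 h5
          simp only [toAdd_ofAdd]
          rw [this, hzero']
          exact zero_mem _
      · have := hB.monoMap_eq_zero h4 h2
        simp only [toAdd_ofAdd]
        rw [this, map_zero, hzero']
        exact zero_mem _
    · have := hC.monoMap_eq_zero h3 h1
      simp only [toAdd_ofAdd]
      rw [this, hzero]
      exact zero_mem _

end

/-- The degree of a monomial. -/
def monoDeg : (SteenrodGen →₀ ℕ) →+ RO := Finsupp.weight SteenrodGen.deg

theorem monoMap_mem (m : SteenrodGen →₀ ℕ) :
    monoMap q.toRingHom (Multiplicative.ofAdd m) ∈ 𝒷 (monoDeg m) := by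
  have := Coeff.isGrading_deg.gradedMonoid
  refine q.map_mem ⟨monomial m 1, ?_, rfl⟩
  have h := polyDeg_monomial (𝓇 := Coeff.deg) SteenrodGen.deg (V := (0 : RO))
    (r := 1) SetLike.GradedOne.one_mem m
  rwa [zero_add] at h

/-- A quotient `B` of the dual Steenrod algebra is cofree over a quotient `C` of `B` that is given
by a Hopf shape whose exponents divide those of `B`. -/
theorem isCofree_of_isPresented {e : SteenrodGen → ℕ} {h : ℕ → ℕ} {n : ℕ}
    (hB : IsPresented e q.toRingHom)
    (hC : IsPresented (shapeExp h n) (f.toRingHom.comp q.toRingHom)) (hs : IsHopfShape h n)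
    (hdvd : ∀ s, shapeExp h n s ∣ e s) : f.IsCofree := by
  have hpos : ∀ s, shapeExp h n s ≠ 0 := by
    rintro (i | i)
    · rw [shapeExp]; split_ifs <;> simp
    · simp [shapeExp]
  let e' := shapeExp h n
  -- The cogenerators are the coinvariant monomials, placed in their own degrees.
  refine f.isCofree_of_bijective (fun m : CofreeIndex e e' => monoDeg m.1) (cofreeProj e' hB) ?_ ?_
  · intro V b hb m
    exact X.repr_mem hB.basis (fun m => monoDeg m.1)
      (fun m => by rw [hB.basis_apply]; exact monoMap_mem q m.1) hb ⟨m.1, m.2.1⟩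
  · refine bijective_of_unitriangular
      (hB.basis.reindex (Equiv.ofBijective _ (reduced_bijective hdvd hpos)).symm)
      (BiTensor.basis Y.ηR (CofreeIndex e e') hC.basis) cofreeRank _ ?_
    rintro ⟨m, c⟩
    rw [Module.Basis.reindex_apply, Equiv.symm_symm, Equiv.ofBijective_apply, hB.basis_apply]
    -- Coinvariance of `m` needs τ-exponents below 2, and these come from reducedness in `B`, where
    -- the exponent bound of each τ_i is 1 or 2.
    have hτ : ∀ i, m.1 (.τ i) < 2 := fun i => by
      rcases hB.exponent_τ i with h1 | h1
      · have := m.2.1.lt (s := .τ i) (by omega)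
        omega
      · have := m.2.1.lt (s := .τ i) (by omega)
        omega
    -- Multiplicativity of the coaction: the leading term c ⊗ 1 for `c` times the exact value 1 ⊗ m
    -- for `m`.
    have hlead := (hasLeading_coactHom q f c.1).mul
      (HasLeading.refl (R := Coeff) (t := biMono q f) (rk := biRank) (0, m.1))
    rw [← coactHom_coinvariant hC hs m.2.2 hτ, ← map_mul, ← map_mul, monomial_mul, one_mul,
      Prod.mk_add_mk, add_zero, zero_add] at hlead
    let L := BiTensor.mapRight Y.ηR (cofreeProj e' hB)
    have h1 : f.comodule.toCofree (cofreeProj e' hB)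
        (monoMap q.toRingHom (Multiplicative.ofAdd (c.1 + m.1))) =
        L (coactHom q f (DualSteenrod.mk (monomial (c.1 + m.1) 1))) :=
      congrArg L (coact_eq q f _)
    have h2 : BiTensor.basis Y.ηR (CofreeIndex e e') hC.basis ⟨m, c⟩ =
        L (biMono q f (Multiplicative.ofAdd (c.1, m.1))) := by
      rw [BiTensor.basis_apply, hC.basis_apply]
      exact congrArg _ (cofreeProj_monoMap hB m).symm
    refine (congrArg₂ (· - ·) h1 h2).trans (map_sub L _ _).symm ▸ ?_
    -- Rewriting in terms of the basis never raises the rank, so terms strictly below (c, m) remain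
    -- strictly below.
    have hle : lowerSpan Coeff (biMono q f) biRank (biRank (c.1, m.1)) ≤
        (Submodule.span Coeff (BiTensor.basis Y.ηR (CofreeIndex e e') hC.basis ''
          {y | cofreeRank y < cofreeRank ⟨m, c⟩})).comap L := by
      refine Submodule.span_le.2 ?_
      rintro _ ⟨⟨m₁, m₂⟩, hlt, rfl⟩
      refine Submodule.span_mono (Set.image_mono fun x hx => ?_) (mapRight_biMono_mem hB hC m₁ m₂)
      exact lt_of_le_of_lt (show cofreeRank x ≤ _ from hx) (show biRank (m₁, m₂) < _ from hlt)
    exact hle hlead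

end CofreeTheorem

/-! ### Hopf ideals from shapes, and the profiles of E(n) and A(n). -/

section Shapes
open MvPolynomial

/-- The ideal generated by `ξ_i ^ (2 ^ h i)` for `i ≥ 1` and `τ_i` for `i ≥ n`. -/
def shapeIdeal (h : ℕ → ℕ) (n : ℕ) : Ideal DualSteenrod :=
  Ideal.span ({x | ∃ i, x = DualSteenrod.ξ (i + 1) ^ 2 ^ h (i + 1)} ∪
    {x | ∃ i, n ≤ i ∧ x = DualSteenrod.τ i})

variable {h : ℕ → ℕ} {n : ℕ}

theorem ξ_pow_mem_shapeIdeal {k N : ℕ} (hN : h (k + 1) ≤ N) :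
    DualSteenrod.ξ (k + 1) ^ 2 ^ N ∈ shapeIdeal h n :=
  Ideal.pow_mem_of_pow_mem (shapeIdeal h n) (Ideal.subset_span (Or.inl ⟨k, rfl⟩))
    (Nat.pow_le_pow_right (by norm_num) hN)

theorem τ_mem_shapeIdeal {i : ℕ} (hi : n ≤ i) : DualSteenrod.τ i ∈ shapeIdeal h n :=
  Ideal.subset_span (Or.inr ⟨i, hi, rfl⟩)

theorem shapeIdeal_le {J : Ideal DualSteenrod}
    (hξ : ∀ i, DualSteenrod.ξ (i + 1) ^ 2 ^ h (i + 1) ∈ J)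
    (hτ : ∀ i, n ≤ i → DualSteenrod.τ i ∈ J) : shapeIdeal h n ≤ J := by
  refine Ideal.span_le.2 ?_
  rintro _ (⟨i, rfl⟩ | ⟨i, hi, rfl⟩)
  · exact hξ i
  · exact hτ i hi

theorem shapeIdeal_anti {h' : ℕ → ℕ} {n' : ℕ} (hh : ∀ k, h' (k + 1) ≤ h (k + 1)) (hn : n' ≤ n) :
    shapeIdeal h n ≤ shapeIdeal h' n' :=
  shapeIdeal_le (fun i => ξ_pow_mem_shapeIdeal (hh i)) fun _ hi => τ_mem_shapeIdeal (hn.trans hi)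

/-- The conjugates of the `ξ_i` satisfy the relations of the shape. -/
theorem convInv_ξ_pow_mem {p N : ℕ} (hN : ∀ j k, j + (k + 1) = p + 1 → h (k + 1) ≤ j + N) :
    convInv DualSteenrod.ξ (p + 1) ^ 2 ^ N ∈ shapeIdeal h n := by
  -- The recursion writes the conjugate as a sum of ξ_{p+1-j}^{2^j} times the j-th conjugate, with j
  -- ≤ p. After Frobenius the first factor alone lies in the ideal, so no induction on `p` is
  -- needed.
  rw [convInv, sum_pow_two_pow DualSteenrod.two_eq_zero]
  refine sum_mem fun j _ => ?_
  rw [mul_pow, ← pow_mul, ← pow_add]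
  refine Ideal.mul_mem_right _ _ ?_
  obtain ⟨k, hk⟩ : ∃ k, p + 1 - (j : ℕ) = k + 1 := ⟨p - j, by have := j.2; omega⟩
  rw [hk]
  exact ξ_pow_mem_shapeIdeal (hN j k (by have := j.2; omega))

/-- The structure maps are ring maps, so generators suffice. For ξ_i^{2^{h(i)}}, the coproduct terms
with a positive-index ξ_p on the left are absorbed by h(p) ≤ r + h(p+r); for τ_i with i ≥ n, by h(p)
≤ n - p ≤ r. The terms with p = 0 lie in the ideal generated by the right factor. The antipode is
treated alike with conjugates. -/
theorem IsHopfShape.isHopfIdeal (hs : IsHopfShape h n) :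
    DualSteenrod.hopfAlgebroid.IsHopfIdeal (shapeIdeal h n) where
  homogeneous := by
    refine ⟨_, ?_, rfl⟩
    rintro _ (⟨i, rfl⟩ | ⟨i, hi, rfl⟩)
    · exact ⟨_, SetLike.pow_mem_graded _ (DualSteenrod.ξ_mem (i + 1))⟩
    · exact ⟨_, DualSteenrod.τ_mem i⟩
  ε_mem := by
    change shapeIdeal h n ≤ RingHom.ker DualSteenrod.ε
    refine shapeIdeal_le (fun i => ?_) (fun i _ => DualSteenrod.ε_τ i)
    rw [RingHom.mem_ker, map_pow, DualSteenrod.ε_ξ, convOne, if_neg (Nat.succ_ne_zero i)]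
    exact zero_pow (by positivity)
  Δ_mem := by
    change shapeIdeal h n ≤ ((shapeIdeal h n).map (BiTensor.inl DualSteenrod.ηR DualSteenrod) ⊔
      (shapeIdeal h n).map (BiTensor.inr DualSteenrod.ηR)).comap DualSteenrod.Δ
    have hl : ∀ x ∈ shapeIdeal h n, BiTensor.inl DualSteenrod.ηR DualSteenrod x ∈
        (shapeIdeal h n).map (BiTensor.inl DualSteenrod.ηR DualSteenrod) ⊔
        (shapeIdeal h n).map (BiTensor.inr DualSteenrod.ηR) := fun x hx =>
      Ideal.mem_sup_left (Ideal.mem_map_of_mem _ hx)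
    have hr : ∀ x ∈ shapeIdeal h n, BiTensor.inr DualSteenrod.ηR x ∈
        (shapeIdeal h n).map (BiTensor.inl DualSteenrod.ηR DualSteenrod) ⊔
        (shapeIdeal h n).map (BiTensor.inr DualSteenrod.ηR) := fun x hx =>
      Ideal.mem_sup_right (Ideal.mem_map_of_mem _ hx)
    refine shapeIdeal_le (fun i => ?_) (fun i hi => ?_)
    · rw [Ideal.mem_comap, map_pow, DualSteenrod.Δ_ξ, conv,
        sum_pow_two_pow DualSteenrod.tensor_two_eq_zero]
      refine sum_mem fun ⟨p, r⟩ hp => ?_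
      rw [Finset.HasAntidiagonal.mem_antidiagonal] at hp
      rw [mul_pow, ← pow_mul, ← pow_add]
      cases p with
      | zero =>
        obtain rfl : r = i + 1 := by simpa using hp
        refine Ideal.mul_mem_left _ _ ?_
        rw [← map_pow]
        exact hr _ (ξ_pow_mem_shapeIdeal le_rfl)
      | succ p =>
        refine Ideal.mul_mem_right _ _ ?_
        rw [← map_pow]
        refine hl _ (ξ_pow_mem_shapeIdeal ?_)
        rw [← hp]
        exact hs.le_add p r
    · rw [Ideal.mem_comap, DualSteenrod.Δ_τ, conv]
      refine add_mem (sum_mem fun ⟨p, r⟩ hp => ?_) (hl _ (τ_mem_shapeIdeal hi))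
      rw [Finset.HasAntidiagonal.mem_antidiagonal] at hp
      cases p with
      | zero =>
        obtain rfl : r = i := by simpa using hp
        exact Ideal.mul_mem_left _ _ (hr _ (τ_mem_shapeIdeal hi))
      | succ p =>
        refine Ideal.mul_mem_right _ _ ?_
        rw [← map_pow]
        refine hl _ (ξ_pow_mem_shapeIdeal ?_)
        have := hs.le_sub p
        simp only at hp ⊢
        omega
  c_mem := by
    change shapeIdeal h n ≤ (shapeIdeal h n).comap DualSteenrod.c
    refine shapeIdeal_le (fun i => ?_) (fun i hi => ?_)
    · rw [Ideal.mem_comap, map_pow, DualSteenrod.c_ξ]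
      refine convInv_ξ_pow_mem fun j k hjk => ?_
      rw [← hjk, add_comm j (k + 1)]
      exact hs.le_add k j
    · rw [Ideal.mem_comap, DualSteenrod.c_τ, conv]
      refine sum_mem fun ⟨p, r⟩ hp => ?_
      rw [Finset.HasAntidiagonal.mem_antidiagonal] at hp
      cases p with
      | zero =>
        obtain rfl : r = i := by simpa using hp
        exact Ideal.mul_mem_left _ _ (τ_mem_shapeIdeal hi)
      | succ p =>
        refine Ideal.mul_mem_right _ _ (convInv_ξ_pow_mem fun j k hjk => ?_)
        -- Here (p + 1) + r = i ≥ n and j + (k + 1) = p + 1, so h(k+1) ≤ n - (k+1) ≤ j + r.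
        have := hs.le_sub k
        simp only at hp ⊢
        omega

/-- For i < n the defining relation is itself a generator. For i ≥ n it is not, but its terms are
multiples of τ_i, τ_{i+1} and ξ_{i+1}. The last is a generator too, since h(i+1) ≤ n - (i+1) = 0. -/
theorem steenrodIdeal_le_relIdeal (hs : IsHopfShape h n) :
    steenrodIdeal ≤ relIdeal (shapeExp h n) := by
  refine Ideal.span_le.2 ?_
  rintro _ ⟨i, rfl⟩
  change steenrodRel i ∈ relIdeal (shapeExp h n)
  have hgen : ∀ s, shapeExp h n s ≠ 0 →
      relGen (shapeExp h n) s ∈ relIdeal (shapeExp h n) := fun s hs =>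
    Ideal.subset_span (Set.mem_image_of_mem _ hs)
  by_cases hi : i < n
  · have h1 : shapeExp h n (.τ i) = 2 := by simp [shapeExp, hi]
    have h2 := hgen (.τ i) (by simp [h1])
    rwa [relGen, if_pos h1] at h2
  · have hτ : ∀ j, n ≤ j → (MvPolynomial.X (.τ j) : MvPolynomial SteenrodGen Coeff) ∈
        relIdeal (shapeExp h n) := fun j hj => by
      have h1 : shapeExp h n (.τ j) = 1 := by simp [shapeExp, hj]
      have h2 := hgen (.τ j) (by simp [h1])
      rwa [relGen, if_neg (by simp [h1]), h1, pow_one] at h2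
    have hξ : (MvPolynomial.X (.ξ i) : MvPolynomial SteenrodGen Coeff) ∈
        relIdeal (shapeExp h n) := by
      have h0 := hs.le_sub i
      have h1 : shapeExp h n (.ξ i) = 1 := by
        rw [shapeExp, show h (i + 1) = 0 by omega, pow_zero]
      have h2 := hgen (.ξ i) (by simp [h1])
      rwa [relGen, h1, pow_one] at h2
    rw [steenrodRel]
    refine sub_mem (Ideal.pow_mem_of_mem _ (hτ i (by omega)) 2 (by norm_num))
      (add_mem (Ideal.mul_mem_left _ _ (hτ (i + 1) (by omega))) (Ideal.mul_mem_left _ _ hξ))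

/-- The generators attached to τ_i with i < n are defining relations, which die in the dual Steenrod
algebra. The others map to the generators of the shape ideal. -/
theorem map_relIdeal : (relIdeal (shapeExp h n)).map DualSteenrod.mk = shapeIdeal h n := by
  refine le_antisymm ?_ (shapeIdeal_le (fun i => ?_) (fun i hi => ?_))
  · rw [relIdeal, Ideal.map_span, Ideal.span_le]
    rintro _ ⟨_, ⟨i | i, -, rfl⟩, rfl⟩
    · rw [relGen]
      split_ifs with hi
      · have : DualSteenrod.mk (steenrodRel i) = 0 :=
          Ideal.Quotient.eq_zero_iff_mem.2 (Ideal.subset_span ⟨i, rfl⟩)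
        rw [this]
        exact zero_mem _
      · have hn : n ≤ i := by
          by_contra hn
          exact hi (by simp [shapeExp, not_le.1 hn])
        rw [map_pow, show shapeExp h n (.τ i) = 1 by simp [shapeExp, hn], pow_one]
        exact τ_mem_shapeIdeal hn
    · rw [relGen, map_pow]
      exact ξ_pow_mem_shapeIdeal le_rfl
  · have h1 : relGen (shapeExp h n) (.ξ i) ∈ relIdeal (shapeExp h n) :=
      Ideal.subset_span (Set.mem_image_of_mem _ (by simp [shapeExp]))
    have h2 := Ideal.mem_map_of_mem DualSteenrod.mk h1
    rwa [relGen, map_pow] at h2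
  · have h0 : shapeExp h n (.τ i) = 1 := by simp [shapeExp, hi]
    have h1 : relGen (shapeExp h n) (.τ i) ∈ relIdeal (shapeExp h n) :=
      Ideal.subset_span (Set.mem_image_of_mem _ (by simp [h0]))
    have h2 := Ideal.mem_map_of_mem DualSteenrod.mk h1
    rwa [relGen, if_neg (by simp [h0]), h0, pow_one] at h2

theorem IsHopfShape.isPresented (hs : IsHopfShape h n) {I : Ideal DualSteenrod}
    (hI : I = shapeIdeal h n) : IsPresented (shapeExp h n) (Ideal.Quotient.mk I) where
  exponent_τ i := by
    rw [shapeExp]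
    split_ifs
    · exact Or.inr rfl
    · exact Or.inl rfl
  surjective := Ideal.Quotient.mk_surjective
  ker := by
    subst hI
    rw [← RingHom.comap_ker, Ideal.mk_ker, ← map_relIdeal]
    -- The preimage of the image of `relIdeal` is its sum with `steenrodIdeal`, which it already
    -- contains.
    refine (Ideal.comap_map_of_surjective DualSteenrod.mk Ideal.Quotient.mk_surjective _).trans ?_
    refine sup_eq_left.2 (le_trans (le_of_eq ?_) (steenrodIdeal_le_relIdeal hs))
    exact Ideal.mk_ker
  map_algebraMap _ := rfl

/-- The exponents of the dual Steenrod algebra itself. -/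
def fullExp : SteenrodGen → ℕ
  | .τ _ => 2
  | .ξ _ => 0

/-- The exponent 0 imposes no relation on the ξ's, so exactly the defining relations remain. The
dual Steenrod algebra thereby fits the same scheme as its quotients, and 0 is divisible by every
exponent. -/
theorem isPresented_id : IsPresented fullExp (RingHom.id DualSteenrod) where
  exponent_τ _ := Or.inr rfl
  surjective := Function.surjective_id
  ker := by
    rw [RingHom.id_comp]
    refine (show RingHom.ker DualSteenrod.mk = steenrodIdeal from Ideal.mk_ker).trans ?_
    have hgen : ∀ i, relGen fullExp (.τ i) = steenrodRel i := fun i => by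
      rw [relGen, if_pos (show fullExp (.τ i) = 2 from rfl)]
    refine congrArg Ideal.span (Set.ext fun x => ⟨?_, ?_⟩)
    · rintro ⟨i, rfl⟩
      exact ⟨.τ i, by simp [fullExp], hgen i⟩
    · rintro ⟨i | i, hi, rfl⟩
      · exact ⟨i, (hgen i).symm⟩
      · exact absurd rfl hi
  map_algebraMap _ := rfl

theorem shapeExp_dvd_fullExp (s : SteenrodGen) : shapeExp h n s ∣ fullExp s := by
  rcases s with i | i
  · rw [shapeExp, fullExp]
    split_ifs <;> simp
  · exact dvd_zero _

theorem shapeExp_dvd {h' : ℕ → ℕ} {n' : ℕ} (hh : ∀ k, h' (k + 1) ≤ h (k + 1)) (hn : n' ≤ n)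
    (s : SteenrodGen) : shapeExp h' n' s ∣ shapeExp h n s := by
  rcases s with i | i
  · rw [shapeExp, shapeExp]
    split_ifs
    · exact dvd_rfl
    · omega
    · exact one_dvd _
    · exact dvd_rfl
  · exact pow_dvd_pow _ (hh i)

/-- The identity morphism of a Hopf algebroid. -/
def HopfAlgebroid.Hom.id {G : Type*} [AddCommGroup G] [DecidableEq G] {H : Type*} [CommRing H]
    {𝒽 : G → AddSubgroup H} {A : Type*} [CommRing A] [Algebra H A] {𝒶 : G → AddSubgroup A}
    (X : HopfAlgebroid 𝒽 𝒶) : HopfAlgebroid.Hom X X where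
  toRingHom := RingHom.id A
  map_mem hb := hb
  map_ηL _ := rfl
  map_ηR _ := rfl
  map_ε _ := rfl
  map_Δ b := by
    rw [RingHom.id_apply]
    induction X.Δ b using BiTensor.induction with
    | zero => rw [map_zero]
    | pure x y => rw [BiTensor.ringLift_tmul, BiTensor.tmul_eq]; rfl
    | add x y hx hy => rw [map_add, ← hx, ← hy]
  map_c _ := rfl

theorem quotientHom_isCofree (hs : IsHopfShape h n) {I : Ideal DualSteenrod}
    (hI : I = shapeIdeal h n) (hI' : DualSteenrod.hopfAlgebroid.IsHopfIdeal I) :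
    (DualSteenrod.hopfAlgebroid.quotientHom hI').IsCofree :=
  isCofree_of_isPresented (HopfAlgebroid.Hom.id _) _ isPresented_id (hs.isPresented hI) hs
    shapeExp_dvd_fullExp

theorem factorHom_isCofree {h' : ℕ → ℕ} {n' : ℕ} (hs : IsHopfShape h n) (hs' : IsHopfShape h' n')
    (hh : ∀ k, h' (k + 1) ≤ h (k + 1)) (hn : n' ≤ n) {I J : Ideal DualSteenrod}
    (hI : I = shapeIdeal h n) (hJ : J = shapeIdeal h' n')
    (hI' : DualSteenrod.hopfAlgebroid.IsHopfIdeal I)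
    (hJ' : DualSteenrod.hopfAlgebroid.IsHopfIdeal J) :
    ∃ hle : I ≤ J, (DualSteenrod.hopfAlgebroid.factorHom hI' hJ' hle).IsCofree :=
  ⟨by rw [hI, hJ]; exact shapeIdeal_anti hh hn,
    isCofree_of_isPresented (DualSteenrod.hopfAlgebroid.quotientHom hI') _ (hs.isPresented hI)
      (hs'.isPresented hJ) hs' (shapeExp_dvd hh hn)⟩

/-- With d = n - i - 1, Frobenius applied to the relation writes τ_i^{2^{d+1}} as a multiple of
τ_{i+1}^{2^d} plus a multiple of ξ_{i+1}^{2^d}. The first is in the ideal by induction on n - i, the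
second because h(i+1) ≤ d. This makes the profile generators with i < n redundant. -/
theorem τ_pow_mem_shapeIdeal (hs : IsHopfShape h n) (i : ℕ) :
    DualSteenrod.τ i ^ 2 ^ (n - i) ∈ shapeIdeal h n := by
  induction hd : n - i generalizing i with
  | zero =>
    rw [pow_zero, pow_one]
    exact τ_mem_shapeIdeal (by omega)
  | succ d ih =>
    have hpow : ∀ x y : DualSteenrod, (x + y) ^ 2 ^ d = x ^ 2 ^ d + y ^ 2 ^ d := fun x y => by
      have := sum_pow_two_pow DualSteenrod.two_eq_zero Finset.univ ![x, y] d
      simpa [Fin.sum_univ_two] using this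
    rw [pow_succ', pow_mul, DualSteenrod.τ_sq, hpow, mul_pow, mul_pow _ (DualSteenrod.ξ _)]
    have h1 := hs.le_sub i
    exact add_mem (Ideal.mul_mem_left _ _ (ih (i + 1) (by omega)))
      (Ideal.mul_mem_left _ _ (ξ_pow_mem_shapeIdeal (by omega)))

theorem Profile.ideal_eq_shapeIdeal (hs : IsHopfShape h n) {p : Profile}
    (hh : ∀ i, p.h (i + 1) = h (i + 1)) (hk : ∀ i, p.k i = (n - i : ℕ)) :
    p.ideal = shapeIdeal h n := by
  refine le_antisymm (Ideal.span_le.2 ?_) (shapeIdeal_le (fun i => ?_) (fun i hi => ?_))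
  · rintro _ (⟨i, e, he, rfl⟩ | ⟨i, e, he, rfl⟩)
    · rw [hh, Nat.cast_inj] at he
      exact ξ_pow_mem_shapeIdeal he.le
    · rw [hk, Nat.cast_inj] at he
      rw [← he]
      exact τ_pow_mem_shapeIdeal hs i
  · exact Ideal.subset_span (Or.inl ⟨i, _, hh i, rfl⟩)
  -- For i ≥ n the truncated difference n - i is 0, so the profile generator is τ_i to the power
  -- 2^0.
  · refine Ideal.subset_span (Or.inr ⟨i, 0, ?_, ?_⟩)
    · rw [hk, Nat.sub_eq_zero_of_le hi]
    · rw [pow_zero, pow_one]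

theorem isHopfShape_zero (n : ℕ) : IsHopfShape (fun _ => 0) n :=
  ⟨fun _ => Nat.zero_le _, fun _ _ => Nat.zero_le _⟩

theorem isHopfShape_sub (n : ℕ) : IsHopfShape (fun i => n - i) n :=
  ⟨fun _ => le_rfl, fun k j => by omega⟩

theorem profileE_ideal (n : ℕ) : (profileE n).ideal = shapeIdeal (fun _ => 0) n :=
  Profile.ideal_eq_shapeIdeal (isHopfShape_zero n) (fun _ => rfl) fun _ => rfl

theorem profileA_ideal (n : ℕ) : (profileA n).ideal = shapeIdeal (fun i => n - i) n :=
  Profile.ideal_eq_shapeIdeal (isHopfShape_sub n) (fun _ => rfl) fun _ => rfl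

/-- In both families the exponent of τ_0 is the index n, so comparing profiles at τ_0 compares
indices. -/
theorem le_of_natCast_sub_le {m n : ℕ} (h : ((m - 0 : ℕ) : ℕ∞) ≤ ((n - 0 : ℕ) : ℕ∞)) : m ≤ n := by
  simpa using h

end Shapes

end EquivSteenrod
end

/-- For every `n`, the ideals that define `E(n)_⋆` and `A(n)_⋆` are Hopf algebroid ideals of the
`ℤ/2`-equivariant dual Steenrod algebra `A_⋆`, the Hopf algebroid `A_⋆` is a cofree comodule over
the quotients `E(n)_⋆` and `A(n)_⋆`, and, whenever the profile functions are comparable, these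
quotients are cofree comodules over each other. -/
theorem mainTheorem2 :
    ∃ (hE : ∀ n, EquivSteenrod.DualSteenrod.hopfAlgebroid.IsHopfIdeal
        (EquivSteenrod.profileE n).ideal)
      (hA : ∀ n, EquivSteenrod.DualSteenrod.hopfAlgebroid.IsHopfIdeal
        (EquivSteenrod.profileA n).ideal),
      (∀ n, (EquivSteenrod.DualSteenrod.hopfAlgebroid.quotientHom (hE n)).IsCofree) ∧
      (∀ n, (EquivSteenrod.DualSteenrod.hopfAlgebroid.quotientHom (hA n)).IsCofree) ∧
      (∀ m n, EquivSteenrod.profileE m ≤ EquivSteenrod.profileE n →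
        ∃ hle : (EquivSteenrod.profileE n).ideal ≤ (EquivSteenrod.profileE m).ideal,
          (EquivSteenrod.DualSteenrod.hopfAlgebroid.factorHom (hE n) (hE m) hle).IsCofree) ∧
      (∀ m n, EquivSteenrod.profileA m ≤ EquivSteenrod.profileA n →
        ∃ hle : (EquivSteenrod.profileA n).ideal ≤ (EquivSteenrod.profileA m).ideal,
          (EquivSteenrod.DualSteenrod.hopfAlgebroid.factorHom (hA n) (hA m) hle).IsCofree) ∧
      (∀ m n, EquivSteenrod.profileE m ≤ EquivSteenrod.profileA n →
        ∃ hle : (EquivSteenrod.profileA n).ideal ≤ (EquivSteenrod.profileE m).ideal,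
          (EquivSteenrod.DualSteenrod.hopfAlgebroid.factorHom (hA n) (hE m) hle).IsCofree) ∧
      (∀ m n, EquivSteenrod.profileA m ≤ EquivSteenrod.profileE n →
        ∃ hle : (EquivSteenrod.profileE n).ideal ≤ (EquivSteenrod.profileA m).ideal,
          (EquivSteenrod.DualSteenrod.hopfAlgebroid.factorHom (hE n) (hA m) hle).IsCofree) := by
  have hE : ∀ n, EquivSteenrod.DualSteenrod.hopfAlgebroid.IsHopfIdeal
      (EquivSteenrod.profileE n).ideal := fun n => by
    rw [EquivSteenrod.profileE_ideal]
    exact (EquivSteenrod.isHopfShape_zero n).isHopfIdeal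
  have hA : ∀ n, EquivSteenrod.DualSteenrod.hopfAlgebroid.IsHopfIdeal
      (EquivSteenrod.profileA n).ideal := fun n => by
    rw [EquivSteenrod.profileA_ideal]
    exact (EquivSteenrod.isHopfShape_sub n).isHopfIdeal
  refine ⟨hE, hA, fun n => ?_, fun n => ?_, fun m n hmn => ?_, fun m n hmn => ?_,
    fun m n hmn => ?_, fun m n hmn => ?_⟩
  · exact EquivSteenrod.quotientHom_isCofree (EquivSteenrod.isHopfShape_zero n)
      (EquivSteenrod.profileE_ideal n) _
  · exact EquivSteenrod.quotientHom_isCofree (EquivSteenrod.isHopfShape_sub n)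
      (EquivSteenrod.profileA_ideal n) _
  · exact EquivSteenrod.factorHom_isCofree (EquivSteenrod.isHopfShape_zero n)
      (EquivSteenrod.isHopfShape_zero m) (fun _ => le_rfl)
      (EquivSteenrod.le_of_natCast_sub_le (hmn 0).2)
      (EquivSteenrod.profileE_ideal n) (EquivSteenrod.profileE_ideal m) _ _
  · exact EquivSteenrod.factorHom_isCofree (EquivSteenrod.isHopfShape_sub n)
      (EquivSteenrod.isHopfShape_sub m) (fun k => Nat.cast_le.1 (hmn k).1)
      (EquivSteenrod.le_of_natCast_sub_le (hmn 0).2)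
      (EquivSteenrod.profileA_ideal n) (EquivSteenrod.profileA_ideal m) _ _
  · exact EquivSteenrod.factorHom_isCofree (EquivSteenrod.isHopfShape_sub n)
      (EquivSteenrod.isHopfShape_zero m) (fun _ => Nat.zero_le _)
      (EquivSteenrod.le_of_natCast_sub_le (hmn 0).2)
      (EquivSteenrod.profileA_ideal n) (EquivSteenrod.profileE_ideal m) _ _
  -- Comparability forces m - (k + 1) = 0 for all k, that is m ≤ 1; the hypothesis supplies the
  -- inequality between the exponents of the ξ's directly.
  · exact EquivSteenrod.factorHom_isCofree (EquivSteenrod.isHopfShape_zero n)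
      (EquivSteenrod.isHopfShape_sub m) (fun k => Nat.cast_le.1 (hmn k).1)
      (EquivSteenrod.le_of_natCast_sub_le (hmn 0).2)
      (EquivSteenrod.profileE_ideal n) (EquivSteenrod.profileA_ideal m) _ _
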